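/- Let $a,b>0$ and let $f:\mathbb R\to\mathbb R$ satisfy, with $F(u)=\int_0^u f(s)\,ds$: ($f_1$) $f$ is continuous and $\lim_{u\to0}f(u)/u=0$; ($f_2$) $\limsup_{|u|\to\infty}|f(u)|/|u|^{p-1}<\infty$ for some $p\in(2,6)$; ($f_3$) there is $\mu>2$ with $uf(u)\ge\mu F(u)>0$ for all $u\ne0$. Let $V\in C^1(\mathbb R^3,\mathbb R)$ satisfy, with $\frac{\partial V}{\partial r}(x)=(\frac{x}{|x|},\nabla V(x))$: ($V_1$) $V_0\le V(x)\le V_1$ for all $x$, where $V_0,V_1>0$ are constants; ($V_2$) $\lim_{|x|\to\infty}\frac{\partial V}{\partial r}(x)e^{\gamma|x|}=+\infty$ for every $\gamma>0$; ($V_3$) there is $\bar c>1$ with $|\nabla V(x)|\le\bar c\,\frac{\partial V}{\partial r}(x)$ for $|x|\ge\bar c$; ($V_4$) the function $x\mapsto(\nabla V(x),x)$ belongs to $L^\infty(\mathbb R^3)\cup L^2(\mathbb R^3)$, and $\frac{\mu-2}{\mu}V(x)\ge(\nabla V(x),x)\ge0$ for almost every $x$. Let $H=\{u\in H^1(\mathbb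 R^3):\int Vu^2<\infty\}$ with inner product $\langle u,v\rangle=\int_{\mathbb R^3}(a\nabla u\cdot\nabla v+Vuv)$ and norm $\|u\|=\langle u,u\rangle^{1/2}$. Fix $0<\alpha<\frac{\mu-2}{\mu}$, put $W(x)=1+|x|^\alpha$, and fix $r\in(\max\{p,4\},6)$. For $\lambda\ge0$ let $E_\lambda=\{u\in H:\int\lambda Wu^2<\infty\}$ with norm $\|u\|_{E_\lambda}=\big(\int_{\mathbb R^3}(|\nabla u|^2+Vu^2+\lambda Wu^2)\big)^{1/2}$, and consider $$-\Big(a+b\int_{\mathbb R^3}|\nabla u|^2\Big)\Delta u+V(x)u+\lambda W(x)u=f(u)+\lambda|u|^{r-2}u\ \text{ in }\mathbb R^3,\qquad u\in E_\lambda.\tag{$K_\lambda$}$$ A solution of $(K_\lambda)$ is a $u\in E_\lambda$ such that for all $v\in E_\lambda$ $$\int(a\nabla u\cdot\nabla v+Vuv+\lambda Wuv)+b\int|\nabla u|^2\int\nabla u\cdot\nabla v=\int\big(f(u)v+\lambda|u|^{r-2}uv\big).$$ Let $\lambda_n\ge0$ with $\lambda_n\to0$, let $u_n\in E_{\lambda_n}$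 be a (possibly sign-changing) solution of $(K_{\lambda_n})$ for each $n$, and suppose $\|u_n\|_{E_{\lambda_n}}\le M$ with $M$ independent of $n$. Then there exist a subsequence, still denoted by $\{u_n\}$, an integer $k\ge0$, numbers $a_1,\dots,a_k\ge0$ and $A\ge0$, functions $u_0,w_1,\dots,w_k\in H$ with $w_j\not\equiv0$, and $k$ sequences of points $\{y_n^j\}\subset\mathbb R^3$, $1\le j\le k$, such that (i) $u_n\rightharpoonup u_0$ and $u_n(\cdot+y_n^j)\rightharpoonup w_j$ weakly in $H$ as $n\to\infty$, for $1\le j\le k$; (ii) $|y_n^j|\to\infty$ for every $j$, and $|y_n^j-y_n^i|\to\infty$ for $i\ne j$, as $n\to\infty$; (iii) $\big\|u_n-u_0-\sum_{i=1}^k w_i(\cdot-y_n^i)\big\|\to0$ as $n\to\infty$; (iv) $A=\|\nabla u_0\|_2^2+\sum_{i=1}^k\|\nabla w_i\|_2^2$; (v) for every $1\le j\le k$, $|w_j|\in H^1(\mathbb R^3)$ and, for every $\varphi\in C_0^\infty(\mathbb R^3)$ with $\varphi\ge0$, $$(a+bA)\int_{\mathbb R^3}\nabla|w_j|\cdot\nabla\varphi+(V_0+a_j)\int_{\mathbb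 R^3}|w_j|\varphi\le\int_{\mathbb R^3}|f(w_j)|\varphi.$$ -/

import Mathlib

open MeasureTheory Filter Topology
open scoped ContDiff Gradient

/-- Three-dimensional Euclidean space. -/
abbrev R3 : Type := EuclideanSpace ℝ (Fin 3)

/-! ### Weak gradients and the space `H¹(ℝ³)` -/

/-- `φ ∈ C₀^∞(ℝ³)`. -/
def IsTestFunction (φ : R3 → ℝ) : Prop :=
  ContDiff ℝ ∞ φ ∧ HasCompactSupport φ

/-- `g` is a weak (distributional) gradient of `u`: both are locally integrable and
`∫ u ∇φ = - ∫ φ g` for every test function `φ`. -/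
def IsWeakGradient (u : R3 → ℝ) (g : R3 → R3) : Prop :=
  LocallyIntegrable u ∧ LocallyIntegrable g ∧
    ∀ φ : R3 → ℝ, IsTestFunction φ → ∫ x, u x • ∇ φ x = - ∫ x, φ x • g x

open Classical in
/-- The weak gradient of `u` (unique up to a null set when it exists; `0` otherwise). -/
noncomputable def weakGrad (u : R3 → ℝ) : R3 → R3 :=
  if h : ∃ g : R3 → R3, IsWeakGradient u g then h.choose else 0

theorem isWeakGradient_weakGrad {u : R3 → ℝ} (h : ∃ g : R3 → R3, IsWeakGradient u g) :
    IsWeakGradient u (weakGrad u) := by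
  unfold weakGrad
  rw [dif_pos h]
  exact h.choose_spec

/-- `u ∈ H¹(ℝ³)`: `u` is square integrable and has a square integrable weak gradient. -/
def MemH1 (u : R3 → ℝ) : Prop :=
  MemLp u 2 volume ∧ ∃ g : R3 → R3, MemLp g 2 volume ∧ IsWeakGradient u g

/-- The squared Dirichlet norm `‖∇u‖₂²`. -/
noncomputable def dirichlet (u : R3 → ℝ) : ℝ :=
  ∫ x, ‖weakGrad u x‖ ^ 2

/-! ### Hypotheses on the nonlinearity and on the potential -/

/-- The primitive `F(u) = ∫₀ᵘ f(s) ds`. -/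
noncomputable def primitiveF (f : ℝ → ℝ) (u : ℝ) : ℝ :=
  ∫ s in (0 : ℝ)..u, f s

/-- The hypotheses (f₁), (f₂), (f₃) on the nonlinearity, with exponents `p` and `μ`. -/
structure NonlinearityHyp (f : ℝ → ℝ) (p μ : ℝ) : Prop where
  continuous : Continuous f
  small_at_zero : Tendsto (fun u : ℝ => f u / u) (𝓝[≠] 0) (𝓝 0)
  two_lt_p : 2 < p
  p_lt_six : p < 6
  /- the upper limit of `|f u| / |u| ^ (p - 1)` as `|u| → ∞` is finite -/
  growth : IsBoundedUnder (· ≤ ·) (cocompact ℝ) (fun u : ℝ => |f u| / |u| ^ (p - 1))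
  two_lt_mu : 2 < μ
  superquadratic : ∀ u : ℝ, u ≠ 0 → μ * primitiveF f u ≤ u * f u ∧ 0 < μ * primitiveF f u

/-- The radial derivative `∂V/∂r (x) = (x / |x|, ∇V(x))`. -/
noncomputable def radialDeriv (V : R3 → ℝ) (x : R3) : ℝ :=
  inner ℝ (‖x‖⁻¹ • x) (∇ V x)

/-- The hypotheses `V ∈ C¹` and (V₁), (V₂), (V₃), (V₄) on the potential, with the bounds
`V₀ ≤ V ≤ V₁` and the exponent `μ` of the nonlinearity. -/
structure PotentialHyp (V : R3 → ℝ) (V₀ V₁ μ : ℝ) : Prop where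
  contDiff : ContDiff ℝ 1 V
  V₀_pos : 0 < V₀
  V₁_pos : 0 < V₁
  bounds : ∀ x, V₀ ≤ V x ∧ V x ≤ V₁
  radial_growth : ∀ γ : ℝ, 0 < γ →
    Tendsto (fun x : R3 => radialDeriv V x * Real.exp (γ * ‖x‖)) (cocompact R3) atTop
  gradient_control : ∃ c : ℝ, 1 < c ∧ ∀ x : R3, c ≤ ‖x‖ → ‖∇ V x‖ ≤ c * radialDeriv V x
  integrability : MemLp (fun x : R3 => inner ℝ (∇ V x) x) ⊤ volume ∨
    MemLp (fun x : R3 => inner ℝ (∇ V x) x) 2 volume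
  pohozaev_bounds : ∀ᵐ x : R3, inner ℝ (∇ V x) x ≤ (μ - 2) / μ * V x ∧ 0 ≤ inner ℝ (∇ V x) x

/-! ### The spaces `H` and `E_λ` -/

/-- `u ∈ H`: `u ∈ H¹(ℝ³)` and `∫ V u² < ∞`. -/
def MemH (V : R3 → ℝ) (u : R3 → ℝ) : Prop :=
  MemH1 u ∧ Integrable (fun x => V x * u x ^ 2)

/-- The inner product of `H`: `⟨u, v⟩ = ∫ a ∇u·∇v + V u v`. -/
noncomputable def innerH (a : ℝ) (V : R3 → ℝ) (u v : R3 → ℝ) : ℝ :=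
  ∫ x, (a * inner ℝ (weakGrad u x) (weakGrad v x) + V x * u x * v x)

/-- The norm of `H`: `‖u‖ = √⟨u, u⟩`. -/
noncomputable def normH (a : ℝ) (V : R3 → ℝ) (u : R3 → ℝ) : ℝ :=
  Real.sqrt (innerH a V u u)

/-- Weak convergence `v_n ⇀ w` in the Hilbert space `H`. -/
def WeakConvH (a : ℝ) (V : R3 → ℝ) (v : ℕ → R3 → ℝ) (w : R3 → ℝ) : Prop :=
  (∀ n, MemH V (v n)) ∧ MemH V w ∧
    ∀ φ : R3 → ℝ, MemH V φ →
      Tendsto (fun n => innerH a V (v n) φ) atTop (𝓝 (innerH a V w φ))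

/-- The coercive weight `W(x) = 1 + |x|^α`. -/
noncomputable def weightW (α : ℝ) (x : R3) : ℝ :=
  1 + ‖x‖ ^ α

/-- `u ∈ E_λ`: `u ∈ H` and `∫ λ W u² < ∞`. -/
def MemE (V : R3 → ℝ) (α lam : ℝ) (u : R3 → ℝ) : Prop :=
  MemH V u ∧ Integrable (fun x => lam * weightW α x * u x ^ 2)

/-- The norm of `E_λ`: `(∫ |∇u|² + V u² + λ W u²)^{1/2}`. -/
noncomputable def normE (V : R3 → ℝ) (α lam : ℝ) (u : R3 → ℝ) : ℝ :=
  Real.sqrt (∫ x, (‖weakGrad u x‖ ^ 2 + V x * u x ^ 2 + lam * weightW α x * u x ^ 2))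

/-! ### The modified Kirchhoff problem -/

/-- The derivative `I_λ'(u) v` of the energy functional of the modified problem. -/
noncomputable def derivI (a b : ℝ) (f : ℝ → ℝ) (V : R3 → ℝ) (α r lam : ℝ)
    (u v : R3 → ℝ) : ℝ :=
  (∫ x, (a * inner ℝ (weakGrad u x) (weakGrad v x) + V x * u x * v x
      + lam * weightW α x * u x * v x))
    + b * dirichlet u * (∫ x, inner ℝ (weakGrad u x) (weakGrad v x))
    - ∫ x, (f (u x) * v x + lam * |u x| ^ (r - 2) * u x * v x)

/-- `u` is a (weak) solution of the problem `(K_λ)`: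
`-(a + b ∫|∇u|²) Δu + V u + λ W u = f(u) + λ |u|^{r-2} u`, `u ∈ E_λ`. -/
def IsSolutionK (a b : ℝ) (f : ℝ → ℝ) (V : R3 → ℝ) (α r lam : ℝ) (u : R3 → ℝ) : Prop :=
  MemE V α lam u ∧ ∀ v : R3 → ℝ, MemE V α lam v → derivI a b f V α r lam u v = 0

/-! ### Test functions and gradients -/

/-! The argument is a concentration-compactness scheme in which the equation itself provides both
the bound on the number of profiles and the strong convergence. Estimates are made for an `H¹`
function together with any representative of its weak gradient (`H1Pair`), so that the choice hidden
in `weakGrad` matters only when hypotheses are read and conclusions are stated.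

Kato's inequality. Multiplying the equation by a smoothed sign of `u_n` times a nonnegative test
function gives a differential inequality for `|u_n|` (`IsWeakSol.kato`). It survives weak limits of
translates `u_n(· + y_n)` (`BoundedSols.kato_limit`). The Laplacian is moved onto the test function,
so that local `L²` convergence of the moduli is enough. The nonlinear term is handled by Fatou's
lemma and subcritical growth. On a fixed ball `W(x + y_n)` differs from `W(y_n)` by a bounded amount
because `α ≤ 1`, so `λ_n W` acts in the limit like the constant `lim λ_n W(y_n)`. These limits are
the numbers `a_j`.

Finitely many profiles. Testing the limit inequality with `|w|` itself, absorbing the linear part of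
`f` into the `V₀` term and applying Sobolev's inequality bounds `‖∇w‖₂²` below by a constant common
to all nonzero profiles (`exists_grad_lower_bound`). While the remainder keeps `L²` mass in some
ball of fixed radius, a further nonzero profile can be split off, with a center that diverges from
the earlier ones (`IsProfile.exists_succ`). Gradient energies of profiles add up
(`tendsto_energy_sub`), so this stops. From then on the remainder vanishes in the sense of Lions and
tends to zero in `L⁴` (`exists_vanishing_const`).

Strong convergence. The equation is tested with `u_n` minus the translated profiles. A profile need
not have finite weighted norm, hence it is first replaced by a nearby test function
(`IsWeakSol.energy_sub_le`). The nonlinear term is at most a small multiple of bounded quantities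
plus a multiple of the `L⁴` norm of the remainder. The weighted cross terms are controlled because
`λ_n W(y_n)` is bounded: the weighted energy is bounded while a fixed amount of mass stays near
`y_n` (`BoundedSols.exists_weight_bound`). This yields `BoundedSols.tendsto_remainder`. The energy
splitting then becomes exact and identifies `lim ‖∇u_n‖₂²`, the coefficient in the limit
inequalities, with `A`. -/

theorem continuous_gradient {φ : R3 → ℝ} (h : ContDiff ℝ 1 φ) : Continuous (∇ φ) :=
  (LinearIsometryEquiv.continuous _).comp (h.continuous_fderiv one_ne_zero)

theorem hasCompactSupport_gradient {φ : R3 → ℝ} (h : HasCompactSupport φ) :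
    HasCompactSupport (∇ φ) := by
  have h1 := h.fderiv (𝕜 := ℝ)
  exact h1.comp_left (g := (InnerProductSpace.toDual ℝ R3).symm) (map_zero _)

theorem memLp_gradient {φ : R3 → ℝ} (h : ContDiff ℝ 1 φ) (hc : HasCompactSupport φ)
    (p : ENNReal) : MemLp (∇ φ) p volume :=
  (continuous_gradient h).memLp_of_hasCompactSupport (hasCompactSupport_gradient hc)

namespace IsTestFunction

variable {φ ψ : R3 → ℝ}

theorem contDiff_one (h : IsTestFunction φ) : ContDiff ℝ 1 φ := h.1.of_le (by simp)

theorem continuous (h : IsTestFunction φ) : Continuous φ := h.1.continuous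

theorem memLp (h : IsTestFunction φ) (p : ENNReal) : MemLp φ p volume :=
  h.continuous.memLp_of_hasCompactSupport h.2

theorem memLp_gradient (h : IsTestFunction φ) (p : ENNReal) : MemLp (∇ φ) p volume :=
  _root_.memLp_gradient h.contDiff_one h.2 p

theorem differentiableAt (h : IsTestFunction φ) (x : R3) : DifferentiableAt ℝ φ x :=
  h.contDiff_one.differentiable one_ne_zero x

theorem mul (h : IsTestFunction φ) (h' : IsTestFunction ψ) :
    IsTestFunction (fun x => φ x * ψ x) :=
  ⟨h.1.mul h'.1, h.2.mul_right⟩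

theorem comp_add_right (h : IsTestFunction φ) (y : R3) :
    IsTestFunction (fun x => φ (x + y)) :=
  ⟨h.1.comp (contDiff_id.add contDiff_const), h.2.comp_homeomorph (Homeomorph.addRight y)⟩

theorem exists_bound (h : IsTestFunction φ) : ∃ C, 0 ≤ C ∧ ∀ x, |φ x| ≤ C := by
  obtain ⟨C, hC⟩ := h.2.exists_bound_of_continuous h.continuous
  exact ⟨C, (norm_nonneg _).trans (hC 0), hC⟩

theorem exists_bound_gradient (h : IsTestFunction φ) : ∃ C, 0 ≤ C ∧ ∀ x, ‖∇ φ x‖ ≤ C := by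
  obtain ⟨C, hC⟩ := (hasCompactSupport_gradient h.2).exists_bound_of_continuous
    (continuous_gradient h.contDiff_one)
  exact ⟨C, (norm_nonneg _).trans (hC 0), hC⟩

theorem exists_ball (h : IsTestFunction φ) : ∃ R, 0 < R ∧ ∀ x, R < ‖x‖ → φ x = 0 := by
  obtain ⟨R, hR, h0⟩ := h.2.isCompact.isBounded.exists_pos_norm_le
  exact ⟨R, hR, fun x hx => by_contra fun hne => not_lt.2 (h0 x (subset_tsupport _ hne)) hx⟩

end IsTestFunction

theorem gradient_mul {φ ψ : R3 → ℝ} {x : R3} (hφ : DifferentiableAt ℝ φ x)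
    (hψ : DifferentiableAt ℝ ψ x) :
    ∇ (fun x => φ x * ψ x) x = φ x • ∇ ψ x + ψ x • ∇ φ x := by
  refine ext_inner_right ℝ fun v => ?_
  rw [inner_gradient_left, fderiv_fun_mul hφ hψ, inner_add_left, inner_smul_left,
    inner_smul_left, inner_gradient_left, inner_gradient_left]
  simp

theorem gradient_comp_add_right (φ : R3 → ℝ) (y x : R3) :
    ∇ (fun x => φ (x + y)) x = ∇ φ (x + y) := by
  simp only [gradient, fderiv_comp_add_right]

theorem gradient_comp_scalar {φ : R3 → ℝ} {G : ℝ → ℝ} {x : R3} (hG : DifferentiableAt ℝ G (φ x))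
    (hφ : DifferentiableAt ℝ φ x) :
    ∇ (fun x => G (φ x)) x = deriv G (φ x) • ∇ φ x := by
  refine ext_inner_right ℝ fun v => ?_
  have h := (hG.hasDerivAt.comp_hasFDerivAt x hφ.hasFDerivAt).fderiv
  have h' : fderiv ℝ (fun x => G (φ x)) x = deriv G (φ x) • fderiv ℝ φ x := h
  rw [inner_gradient_left, h', inner_smul_left, inner_gradient_left]
  simp

theorem norm_gradient (φ : R3 → ℝ) (x : R3) : ‖∇ φ x‖ = ‖fderiv ℝ φ x‖ := by
  simp [gradient]

/-! ### Square integrable functions -/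

section L2

variable {E : Type*} [NormedAddCommGroup E] [InnerProductSpace ℝ E]

theorem memLp_comp_add_right {X : Type*} [NormedAddCommGroup X] {f : R3 → X} {p : ENNReal}
    (hf : MemLp f p volume) (y : R3) :
    MemLp (fun x => f (x + y)) p volume :=
  hf.comp_measurePreserving (measurePreserving_add_right volume y)

theorem MeasureTheory.MemLp.integrable_inner_two {f g : R3 → E} (hf : MemLp f 2 volume)
    (hg : MemLp g 2 volume) : Integrable (fun x => inner ℝ (f x) (g x)) := by
  refine (hf.norm.integrable_mul hg.norm).mono' (hf.1.inner hg.1) ?_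
  exact Eventually.of_forall fun x => norm_inner_le_norm (𝕜 := ℝ) _ _

theorem MeasureTheory.MemLp.integrable_smul_two {f : R3 → ℝ} {g : R3 → E} (hf : MemLp f 2 volume)
    (hg : MemLp g 2 volume) : Integrable (fun x => f x • g x) := by
  refine (hf.norm.integrable_mul hg.norm).mono' (hf.1.smul hg.1) ?_
  exact Eventually.of_forall fun x => by simp [norm_smul]

theorem MeasureTheory.MemLp.integrable_mul_two {f g : R3 → ℝ} (hf : MemLp f 2 volume)
    (hg : MemLp g 2 volume) : Integrable (fun x => f x * g x) :=
  hf.integrable_mul hg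

theorem MeasureTheory.MemLp.integrable_normsq {X : Type*} [NormedAddCommGroup X] {f : R3 → X}
    (hf : MemLp f 2 volume) :
    Integrable (fun x => ‖f x‖ ^ 2) :=
  (memLp_two_iff_integrable_sq_norm hf.1).1 hf

theorem MeasureTheory.MemLp.integrable_sq' {f : R3 → ℝ} (hf : MemLp f 2 volume) :
    Integrable (fun x => f x ^ 2) :=
  (memLp_two_iff_integrable_sq hf.1).1 hf

end L2

/-! ### Pairs consisting of an `H¹` function and its gradient -/

/-- `u` is square integrable and `g` is its square integrable weak gradient. -/
structure H1Pair (u : R3 → ℝ) (g : R3 → R3) : Prop where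
  memLp : MemLp u 2 volume
  memLp_grad : MemLp g 2 volume
  integral_eq : ∀ φ : R3 → ℝ, IsTestFunction φ → ∫ x, u x • ∇ φ x = - ∫ x, φ x • g x

theorem MeasureTheory.MemLp.locallyIntegrable_two {X : Type*} [NormedAddCommGroup X] {f : R3 → X}
    (hf : MemLp f 2 volume) : LocallyIntegrable f :=
  hf.locallyIntegrable (by norm_num)

namespace H1Pair

variable {u v : R3 → ℝ} {g h : R3 → R3}

theorem isWeakGradient (H : H1Pair u g) : IsWeakGradient u g :=
  ⟨H.memLp.locallyIntegrable_two, H.memLp_grad.locallyIntegrable_two, H.integral_eq⟩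

theorem memH1 (H : H1Pair u g) : MemH1 u := ⟨H.memLp, g, H.memLp_grad, H.isWeakGradient⟩

/-- Uniqueness is the fundamental lemma of the calculus of variations. -/
theorem ae_eq_of_isWeakGradient {g g' : R3 → R3} (h : IsWeakGradient u g)
    (h' : IsWeakGradient u g') : g =ᵐ[volume] g' :=
  ae_eq_of_integral_contDiff_smul_eq h.2.1 h'.2.1 fun φ hφ hc => by
    have := (h.2.2 φ ⟨hφ, hc⟩).symm.trans (h'.2.2 φ ⟨hφ, hc⟩)
    exact neg_injective this

theorem weakGrad_ae (H : H1Pair u g) : weakGrad u =ᵐ[volume] g :=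
  ae_eq_of_isWeakGradient (isWeakGradient_weakGrad ⟨g, H.isWeakGradient⟩) H.isWeakGradient

theorem congr_ae (H : H1Pair u g) (hu : u =ᵐ[volume] v) (hg : g =ᵐ[volume] h) :
    H1Pair v h := by
  refine ⟨H.memLp.ae_eq hu, H.memLp_grad.ae_eq hg, fun φ hφ => ?_⟩
  have e1 : ∫ x, u x • ∇ φ x = ∫ x, v x • ∇ φ x :=
    integral_congr_ae (hu.mono fun x hx => by simp only [hx])
  have e2 : ∫ x, φ x • g x = ∫ x, φ x • h x :=
    integral_congr_ae (hg.mono fun x hx => by simp only [hx])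
  rw [← e1, ← e2, H.integral_eq φ hφ]

theorem add (H : H1Pair u g) (H' : H1Pair v h) :
    H1Pair (fun x => u x + v x) (fun x => g x + h x) := by
  refine ⟨H.memLp.add H'.memLp, H.memLp_grad.add H'.memLp_grad, fun φ hφ => ?_⟩
  simp only [add_smul, smul_add]
  rw [integral_add, integral_add, H.integral_eq φ hφ, H'.integral_eq φ hφ, neg_add]
  exacts [(hφ.memLp 2).integrable_smul_two H.memLp_grad,
    (hφ.memLp 2).integrable_smul_two H'.memLp_grad,
    H.memLp.integrable_smul_two (hφ.memLp_gradient 2),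
    H'.memLp.integrable_smul_two (hφ.memLp_gradient 2)]

theorem const_mul (H : H1Pair u g) (c : ℝ) :
    H1Pair (fun x => c * u x) (fun x => c • g x) := by
  refine ⟨H.memLp.const_mul c, H.memLp_grad.const_smul c, fun φ hφ => ?_⟩
  simp only [mul_smul, smul_comm _ c]
  rw [integral_smul, integral_smul, H.integral_eq φ hφ, smul_neg]

theorem sub (H : H1Pair u g) (H' : H1Pair v h) :
    H1Pair (fun x => u x - v x) (fun x => g x - h x) := by
  simpa [sub_eq_add_neg] using H.add (H'.const_mul (-1))

theorem zero : H1Pair (fun _ => 0) (fun _ => 0) :=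
  ⟨MemLp.zero', MemLp.zero', fun φ _ => by simp⟩

theorem sum {ι : Type*} (s : Finset ι) {u : ι → R3 → ℝ} {g : ι → R3 → R3}
    (H : ∀ i ∈ s, H1Pair (u i) (g i)) :
    H1Pair (fun x => ∑ i ∈ s, u i x) (fun x => ∑ i ∈ s, g i x) := by
  classical
  induction s using Finset.induction_on with
  | empty => simpa using zero
  | insert a s ha ih =>
    simp only [Finset.sum_insert ha]
    exact (H a (by simp)).add (ih fun i hi => H i (by simp [hi]))

theorem comp_add_right (H : H1Pair u g) (y : R3) :
    H1Pair (fun x => u (x + y)) (fun x => g (x + y)) := by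
  refine ⟨memLp_comp_add_right H.memLp y, memLp_comp_add_right H.memLp_grad y, fun φ hφ => ?_⟩
  have h1 := H.integral_eq _ (hφ.comp_add_right (-y))
  rw [← integral_add_right_eq_self _ y, ← integral_add_right_eq_self (fun x => φ (x + -y) • g x) y]
    at h1
  simpa [gradient_comp_add_right] using h1

theorem of_contDiff (hu : ContDiff ℝ 1 u) (hc : HasCompactSupport u) : H1Pair u (∇ u) := by
  refine ⟨hu.continuous.memLp_of_hasCompactSupport hc, memLp_gradient hu hc 2, fun φ hφ => ?_⟩
  have hi1 := (hu.continuous.memLp_of_hasCompactSupport hc).integrable_smul_two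
    (hφ.memLp_gradient 2)
  have hi2 := (hφ.memLp 2).integrable_smul_two (memLp_gradient hu hc 2)
  -- Pairing with a fixed vector reduces the claim to scalar integration by parts for a directional
  -- derivative.
  refine ext_inner_left ℝ fun v => ?_
  rw [inner_neg_right, ← integral_inner hi1, ← integral_inner hi2]
  have hi3 := hi1.const_inner (𝕜 := ℝ) v
  have hi4 := hi2.const_inner (𝕜 := ℝ) v
  simp only [inner_smul_right, inner_gradient_right, conj_trivial] at hi3 hi4 ⊢
  rw [integral_mul_fderiv_eq_neg_fderiv_mul_of_integrable]
  · simp only [mul_comm]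
  · simpa only [mul_comm] using hi4
  · exact hi3
  · exact (hu.continuous.memLp_of_hasCompactSupport (p := 2) hc).integrable_mul (hφ.memLp 2)
  · exact fun x _ => hu.differentiable one_ne_zero x
  · exact fun x _ => hφ.differentiableAt x

theorem of_test (hu : IsTestFunction u) : H1Pair u (∇ u) := of_contDiff hu.contDiff_one hu.2

theorem test_mul {χ : R3 → ℝ} (H : H1Pair u g) (hχ : IsTestFunction χ) :
    H1Pair (fun x => χ x * u x) (fun x => χ x • g x + u x • ∇ χ x) := by
  obtain ⟨C, hC0, hC⟩ := hχ.exists_bound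
  obtain ⟨D, hD0, hD⟩ := hχ.exists_bound_gradient
  have m1 : MemLp (fun x => χ x * u x) 2 volume :=
    (H.memLp.const_mul C).mono (hχ.continuous.aestronglyMeasurable.mul H.memLp.1)
      (Eventually.of_forall fun x => by
        simpa [abs_of_nonneg hC0] using mul_le_mul_of_nonneg_right (hC x) (abs_nonneg _))
  have m2 : MemLp (fun x => χ x • g x) 2 volume :=
    (H.memLp_grad.const_smul C).mono (hχ.continuous.aestronglyMeasurable.smul H.memLp_grad.1)
      (Eventually.of_forall fun x => by
        simpa [norm_smul, abs_of_nonneg hC0] using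
          mul_le_mul_of_nonneg_right (hC x) (norm_nonneg _))
  have m3 : MemLp (fun x => u x • ∇ χ x) 2 volume :=
    (H.memLp.const_mul D).mono
      (H.memLp.1.smul (continuous_gradient hχ.contDiff_one).aestronglyMeasurable)
      (Eventually.of_forall fun x => by
        simpa [norm_smul, abs_of_nonneg hD0, mul_comm] using
          mul_le_mul_of_nonneg_right (hD x) (abs_nonneg _))
  refine ⟨m1, m2.add m3, fun φ hφ => ?_⟩
  -- The product rule for the weak gradient is the classical product rule for `χ φ`, used as a test
  -- function for `u`.
  have h1 := H.integral_eq _ (hχ.mul hφ)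
  simp only [gradient_mul (hχ.differentiableAt _) (hφ.differentiableAt _), smul_add,
    smul_smul] at h1 ⊢
  have i1 : Integrable (fun x => (u x * χ x) • ∇ φ x) := by
    simpa only [mul_comm] using m1.integrable_smul_two (hφ.memLp_gradient 2)
  have i2 : Integrable (fun x => (φ x * u x) • ∇ χ x) := by
    simpa only [smul_smul] using (hφ.memLp 2).integrable_smul_two m3
  have i3 : Integrable (fun x => (φ x * χ x) • g x) := by
    simpa only [smul_smul] using (hφ.memLp 2).integrable_smul_two m2
  have e2 : (fun x => (u x * φ x) • ∇ χ x) = fun x => (φ x * u x) • ∇ χ x := by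
    ext1 x; rw [mul_comm]
  rw [integral_add i1 (e2 ▸ i2), e2] at h1
  rw [integral_add i3 i2]
  simp only [mul_comm (χ _)] at h1 ⊢
  rw [eq_sub_of_add_eq h1]
  abel

end H1Pair

theorem MemH1.h1Pair {u : R3 → ℝ} (h : MemH1 u) : H1Pair u (weakGrad u) := by
  obtain ⟨hu, g, hg, hw⟩ := h
  exact ⟨hu, hg.ae_eq (H1Pair.ae_eq_of_isWeakGradient hw (isWeakGradient_weakGrad ⟨g, hw⟩)),
    (isWeakGradient_weakGrad ⟨g, hw⟩).2.2⟩

theorem H1Pair.dirichlet_eq {u : R3 → ℝ} {g : R3 → R3} (H : H1Pair u g) :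
    dirichlet u = ∫ x, ‖g x‖ ^ 2 :=
  integral_congr_ae (H.weakGrad_ae.mono fun x hx => by simp only [hx])

/-! ### The `L²` seminorm -/

section L2norm

variable {X : Type*} [NormedAddCommGroup X]

theorem eLpNorm_two_sq {α : Type*} [MeasurableSpace α] {ν : Measure α} (f : α → X) :
    eLpNorm f 2 ν ^ 2 = ∫⁻ x, ‖f x‖ₑ ^ 2 ∂ν := by
  have h := eLpNorm_nnreal_pow_eq_lintegral (μ := ν) (f := f) (p := 2) (by norm_num)
  simpa using h

theorem eLpNorm_two_le_iff {α : Type*} [MeasurableSpace α] {ν : Measure α} (f : α → X)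
    (B : ENNReal) : eLpNorm f 2 ν ≤ B ↔ ∫⁻ x, ‖f x‖ₑ ^ 2 ∂ν ≤ B ^ 2 := by
  rw [← eLpNorm_two_sq, ENNReal.pow_le_pow_left_iff two_ne_zero]

theorem eLpNorm_two_sq_eq_ofReal {f : R3 → X} (hf : MemLp f 2 volume) :
    eLpNorm f 2 volume ^ 2 = ENNReal.ofReal (∫ x, ‖f x‖ ^ 2) := by
  rw [eLpNorm_two_sq, ofReal_integral_eq_lintegral_ofReal hf.integrable_normsq
    (Eventually.of_forall fun x => by positivity)]
  congr 1 with x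
  rw [ENNReal.ofReal_pow (norm_nonneg _), ofReal_norm]

theorem tendsto_eLpNorm_two_iff {ι : Type*} {l : Filter ι} {F : ι → R3 → X} :
    Tendsto (fun n => eLpNorm (F n) 2 volume) l (𝓝 0) ↔
      Tendsto (fun n => ∫⁻ x, ‖F n x‖ₑ ^ 2) l (𝓝 0) := by
  simp only [← eLpNorm_two_sq]
  constructor
  · intro h
    simpa [Function.comp_def] using ((ENNReal.continuous_pow 2).tendsto 0).comp h
  · intro h
    rw [ENNReal.tendsto_nhds_zero] at h ⊢
    intro ε hε
    filter_upwards [h (ε ^ 2) (by positivity)] with n hn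
    exact (ENNReal.pow_le_pow_left_iff two_ne_zero).1 hn

theorem tendsto_eLpNorm_two_of_dominated {F : ℕ → R3 → X} {b : R3 → ℝ}
    (hF : ∀ n, AEStronglyMeasurable (F n) volume) (hb : MemLp b 2 volume)
    (hbd : ∀ n, ∀ᵐ x, ‖F n x‖ ≤ b x) (hlim : ∀ᵐ x, Tendsto (fun n => F n x) atTop (𝓝 0)) :
    Tendsto (fun n => eLpNorm (F n) 2 volume) atTop (𝓝 0) := by
  rw [tendsto_eLpNorm_two_iff]
  have := tendsto_lintegral_of_dominated_convergence' (f := fun _ => 0)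
    (F := fun n x => ‖F n x‖ₑ ^ 2) (fun x => ‖b x‖ₑ ^ 2) (fun n => (hF n).enorm.pow_const 2)
    (fun n => (hbd n).mono fun x hx => by
      have : ‖F n x‖ₑ ≤ ‖b x‖ₑ := by
        rw [enorm_le_iff_norm_le]
        exact hx.trans (le_abs_self _)
      simp only
      gcongr)
    (by
      rw [← eLpNorm_two_sq]
      exact ENNReal.pow_ne_top hb.eLpNorm_ne_top)
    (hlim.mono fun x hx => by
      simpa [Function.comp_def] using ((ENNReal.continuous_pow 2).tendsto _).comp hx.enorm)
  simpa using this

/-- Translations preserve measure and depend continuously on `t` in the compact-open topology;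
composition with such maps is continuous in `L²`. -/
theorem continuous_translate_Lp {f : R3 → X} (hf : MemLp f 2 volume) :
    Tendsto (fun t => eLpNorm (fun x => f (x + t) - f x) 2 volume) (𝓝 (0 : R3)) (𝓝 0) := by
  let g : R3 → C(R3, R3) := fun t => ⟨fun x => x + t, by fun_prop⟩
  have hg : Continuous g :=
    ContinuousMap.continuous_of_continuous_uncurry g (by
      simp only [g, Function.uncurry_def, ContinuousMap.coe_mk]; fun_prop)
  have hm : ∀ t, MeasurePreserving (g t) volume volume := fun t =>
    measurePreserving_add_right volume t
  have h1 := Filter.Tendsto.compMeasurePreservingLp (p := 2) (f := fun _ : R3 => hf.toLp f)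
    tendsto_const_nhds (hg.tendsto 0) hm (hm 0) (by norm_num)
  rw [tendsto_iff_edist_tendsto_0] at h1
  refine h1.congr fun t => ?_
  rw [Lp.edist_def]
  refine eLpNorm_congr_ae ?_
  rw [Lp.toLp_compMeasurePreserving hf (hm t), Lp.toLp_compMeasurePreserving hf (hm 0)]
  filter_upwards [(hf.comp_measurePreserving (hm t)).coeFn_toLp,
    (hf.comp_measurePreserving (hm 0)).coeFn_toLp] with x h1 h2
  rw [Pi.sub_apply, h1, h2]
  simp [g]

end L2norm

/-! ### Mollification -/

/-- A mollifying kernel at scale `ε`. -/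
structure IsKernel (η : R3 → ℝ) (ε : ℝ) : Prop where
  test : IsTestFunction η
  nonneg : ∀ x, 0 ≤ η x
  integral_eq_one : ∫ x, η x = 1
  eq_zero : ∀ x, ε ≤ ‖x‖ → η x = 0

theorem exists_isKernel {ε : ℝ} (hε : 0 < ε) : ∃ η, IsKernel η ε := by
  let b : ContDiffBump (0 : R3) := ⟨ε / 2, ε, by positivity, by linarith⟩
  refine ⟨b.normed volume, ⟨b.contDiff_normed, b.hasCompactSupport_normed⟩, b.nonneg_normed,
    b.integral_normed, fun x hx => ?_⟩
  have : x ∉ Function.support (b.normed volume) := by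
    rw [b.support_normed_eq]
    simpa using hx
  simpa using this

/-- The convolution of `f` with the kernel `η`. -/
noncomputable def mollify {E : Type*} [NormedAddCommGroup E] [NormedSpace ℝ E]
    (η : R3 → ℝ) (f : R3 → E) (x : R3) : E :=
  ∫ t, η (x - t) • f t

section Mollify

variable {E : Type*} [NormedAddCommGroup E] [InnerProductSpace ℝ E] {η : R3 → ℝ} {ε : ℝ}

theorem IsTestFunction.integrable {φ : R3 → ℝ} (h : IsTestFunction φ) : Integrable φ :=
  memLp_one_iff_integrable.1 (h.memLp 1)

theorem IsTestFunction.comp_sub_left {φ : R3 → ℝ} (h : IsTestFunction φ) (x : R3) :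
    IsTestFunction (fun t => φ (x - t)) :=
  ⟨h.1.comp (contDiff_const.sub contDiff_id), h.2.comp_homeomorph (Homeomorph.subLeft x)⟩

theorem gradient_comp_sub_left {φ : R3 → ℝ} (h : IsTestFunction φ) (x t : R3) :
    ∇ (fun t => φ (x - t)) t = - ∇ φ (x - t) := by
  have h1 : HasFDerivAt (fun t => φ (x - t)) (-(fderiv ℝ φ (x - t))) t := by
    have := (h.differentiableAt (x - t)).hasFDerivAt.comp t ((hasFDerivAt_id t).const_sub x)
    simpa [Function.comp_def] using this
  simp [gradient, h1.fderiv]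

theorem mollify_eq (η : R3 → ℝ) (f : R3 → E) (x : R3) :
    mollify η f x = ∫ t, η t • f (x - t) := by
  unfold mollify
  rw [← integral_sub_left_eq_self (fun t => η t • f (x - t)) volume x]
  simp

theorem memLp_comp_sub_left {X : Type*} [NormedAddCommGroup X] {f : R3 → X} {p : ENNReal}
    (hf : MemLp f p volume) (x : R3) :
    MemLp (fun t => f (x - t)) p volume :=
  hf.comp_measurePreserving (Measure.measurePreserving_sub_left volume x)

theorem IsKernel.lintegral_eq_one (hη : IsKernel η ε) :
    ∫⁻ t, ENNReal.ofReal (η t) = 1 := by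
  rw [← ofReal_integral_eq_lintegral_ofReal
    hη.test.integrable (Eventually.of_forall hη.nonneg), hη.integral_eq_one]
  simp

/-- Jensen's inequality for the probability measure with density `η`. -/
theorem enorm_integral_kernel_sq_le [CompleteSpace E] (hη : IsKernel η ε) {k : R3 → E}
    (hk : AEStronglyMeasurable k volume) :
    ‖∫ t, η t • k t‖ₑ ^ 2 ≤ ∫⁻ t, ENNReal.ofReal (η t) * ‖k t‖ₑ ^ 2 := by
  have hm : Measurable fun t => ENNReal.ofReal (η t) :=
    ENNReal.measurable_ofReal.comp hη.test.continuous.measurable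
  let ν : Measure R3 := volume.withDensity fun t => ENNReal.ofReal (η t)
  have : IsProbabilityMeasure ν := ⟨by
    simp only [ν, withDensity_apply _ MeasurableSet.univ, Measure.restrict_univ]
    exact hη.lintegral_eq_one⟩
  have hk' : AEStronglyMeasurable k ν := hk.mono_ac (withDensity_absolutelyContinuous _ _)
  have h1 : ‖∫ t, η t • k t‖ₑ ≤ eLpNorm k 1 ν := by
    refine (enorm_integral_le_lintegral_enorm _).trans ?_
    rw [eLpNorm_one_eq_lintegral_enorm, lintegral_withDensity_eq_lintegral_mul_non_measurable₀ _
      hm.aemeasurable (Eventually.of_forall fun t => ENNReal.ofReal_lt_top)]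
    refine lintegral_mono fun t => ?_
    simp only [enorm_smul, Pi.mul_apply]
    rw [Real.enorm_of_nonneg (hη.nonneg t)]
  have h2 : eLpNorm k 1 ν ≤ eLpNorm k 2 ν :=
    eLpNorm_le_eLpNorm_of_exponent_le (by norm_num) hk'
  calc ‖∫ t, η t • k t‖ₑ ^ 2 ≤ eLpNorm k 2 ν ^ 2 := by gcongr; exact h1.trans h2
    _ = ∫⁻ t, ENNReal.ofReal (η t) * ‖k t‖ₑ ^ 2 := by
      rw [eLpNorm_two_sq, lintegral_withDensity_eq_lintegral_mul_non_measurable₀ _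
        hm.aemeasurable (Eventually.of_forall fun t => ENNReal.ofReal_lt_top)]
      rfl

/-- The mollification error is an average, with weight `η`, of the differences `f(· - t) - f`.
Jensen and Tonelli bound it by the largest of their norms over the support of the kernel. -/
theorem eLpNorm_mollify_sub_le [CompleteSpace E] (hη : IsKernel η ε) {f : R3 → E}
    (hf : MemLp f 2 volume) {B : ENNReal}
    (hB : ∀ t, ‖t‖ ≤ ε → eLpNorm (fun x => f (x + t) - f x) 2 volume ≤ B) :
    eLpNorm (fun x => mollify η f x - f x) 2 volume ≤ B := by
  rw [eLpNorm_two_le_iff]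
  have hm : Measurable fun t => ENNReal.ofReal (η t) :=
    ENNReal.measurable_ofReal.comp hη.test.continuous.measurable
  have hmeas : AEStronglyMeasurable (fun z : R3 × R3 => f (z.1 - z.2) - f z.1)
      (volume.prod volume) :=
    (hf.1.comp_quasiMeasurePreserving
      (quasiMeasurePreserving_sub_of_right_invariant volume volume)).sub hf.1.comp_fst
  have hpt : ∀ x, ‖mollify η f x - f x‖ₑ ^ 2
      ≤ ∫⁻ t, ENNReal.ofReal (η t) * ‖f (x - t) - f x‖ₑ ^ 2 := by
    intro x
    have e : mollify η f x - f x = ∫ t, η t • (f (x - t) - f x) := by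
      simp only [smul_sub]
      rw [integral_sub ((hη.test.memLp 2).integrable_smul_two (memLp_comp_sub_left hf x))
        (hη.test.integrable.smul_const _), mollify_eq, integral_smul_const,
        hη.integral_eq_one, one_smul]
    rw [e]
    exact enorm_integral_kernel_sq_le hη
      ((memLp_comp_sub_left hf x).1.sub aestronglyMeasurable_const)
  calc ∫⁻ x, ‖mollify η f x - f x‖ₑ ^ 2
      ≤ ∫⁻ x, ∫⁻ t, ENNReal.ofReal (η t) * ‖f (x - t) - f x‖ₑ ^ 2 := lintegral_mono hpt
    _ = ∫⁻ t, ∫⁻ x, ENNReal.ofReal (η t) * ‖f (x - t) - f x‖ₑ ^ 2 := by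
      refine lintegral_lintegral_swap ?_
      exact (hm.comp measurable_snd).aemeasurable.mul (hmeas.enorm.pow_const 2)
    _ = ∫⁻ t, ENNReal.ofReal (η t) * ∫⁻ x, ‖f (x - t) - f x‖ₑ ^ 2 := by
      congr 1 with t
      rw [lintegral_const_mul' _ _ ENNReal.ofReal_ne_top]
    _ ≤ ∫⁻ t, ENNReal.ofReal (η t) * B ^ 2 := by
      refine lintegral_mono fun t => ?_
      by_cases ht : ε ≤ ‖t‖
      · simp [hη.eq_zero t ht]
      · gcongr
        rw [← eLpNorm_two_le_iff]
        simpa [sub_eq_add_neg] using hB (-t) (by simpa using (not_le.1 ht).le)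
    _ = B ^ 2 := by
      rw [lintegral_mul_const _ hm, hη.lintegral_eq_one, one_mul]

theorem mollify_eq_convolution (η : R3 → ℝ) (u : R3 → ℝ) :
    mollify η u = convolution u η (ContinuousLinearMap.mul ℝ ℝ) volume := by
  ext x
  simp [mollify, convolution_def, mul_comm]

theorem contDiff_mollify (hη : IsTestFunction η) {u : R3 → ℝ} (hu : MemLp u 2 volume) :
    ContDiff ℝ ∞ (mollify η u) := by
  rw [mollify_eq_convolution]
  exact hη.2.contDiff_convolution_right _ hu.locallyIntegrable_two hη.1

/-- The derivative falls on the kernel, and `t ↦ η(x - t)` is a legitimate test function for the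
weak gradient of `u`; the sign from reflection cancels the one from integration by parts. -/
theorem gradient_mollify (hη : IsTestFunction η) {u : R3 → ℝ} {g : R3 → R3} (H : H1Pair u g)
    (x : R3) : ∇ (mollify η u) x = mollify η g x := by
  have h1 := hη.2.hasFDerivAt_convolution_right (ContinuousLinearMap.mul ℝ ℝ)
    H.memLp.locallyIntegrable_two hη.contDiff_one x
  rw [← mollify_eq_convolution] at h1
  have h2 := H.integral_eq _ (hη.comp_sub_left x)
  have hi : Integrable (fun t => u t • ∇ η (x - t)) :=
    H.memLp.integrable_smul_two (memLp_comp_sub_left (hη.memLp_gradient 2) x)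
  simp only [gradient_comp_sub_left hη, smul_neg, integral_neg, neg_inj] at h2
  refine ext_inner_right ℝ fun v => ?_
  rw [inner_gradient_left, h1.fderiv, mollify, ← h2, real_inner_comm, ← integral_inner hi,
    convolution_precompR_apply]
  · simp only [convolution_def, inner_smul_right, inner_gradient_right, conj_trivial,
      ContinuousLinearMap.mul_apply']
  · exact H.memLp.locallyIntegrable_two
  · exact hη.2.fderiv (𝕜 := ℝ)
  · exact hη.contDiff_one.continuous_fderiv one_ne_zero

end Mollify

/-! ### Strong convergence in `L²` and closedness of the weak gradient -/

section Closed

variable {E : Type*} [NormedAddCommGroup E] [InnerProductSpace ℝ E]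

theorem tendsto_integral_smul_of_eLpNorm {k : R3 → ℝ} (hk : MemLp k 2 volume)
    {F : ℕ → R3 → E} {F₀ : R3 → E} (hF : ∀ n, MemLp (F n) 2 volume) (hF₀ : MemLp F₀ 2 volume)
    (h : Tendsto (fun n => eLpNorm (fun x => F n x - F₀ x) 2 volume) atTop (𝓝 0)) :
    Tendsto (fun n => ∫ x, k x • F n x) atTop (𝓝 (∫ x, k x • F₀ x)) := by
  refine tendsto_integral_of_L1 _ (hk.integrable_smul_two hF₀).1
    (Eventually.of_forall fun n => hk.integrable_smul_two (hF n)) ?_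
  have h1 : Tendsto (fun n => eLpNorm k 2 volume * eLpNorm (fun x => F n x - F₀ x) 2 volume)
      atTop (𝓝 0) := by
    have := ENNReal.Tendsto.const_mul h (Or.inr hk.eLpNorm_ne_top)
    simpa using this
  refine tendsto_of_tendsto_of_tendsto_of_le_of_le tendsto_const_nhds h1
    (fun n => zero_le) fun n => ?_
  have h2 := eLpNorm_smul_le_mul_eLpNorm (p := 2) (q := 2) (r := 1) ((hF n).sub hF₀).1 hk.1
  rw [eLpNorm_one_eq_lintegral_enorm] at h2
  refine le_trans (le_of_eq ?_) h2
  congr 1 with x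
  simp [smul_sub]

/-- For a fixed test function both sides of the defining identity are continuous in `L²`, so the
weak gradient is a closed operator. -/
theorem H1Pair.of_tendsto {u : ℕ → R3 → ℝ} {g : ℕ → R3 → R3} {u₀ : R3 → ℝ} {g₀ : R3 → R3}
    (H : ∀ n, H1Pair (u n) (g n)) (hu₀ : MemLp u₀ 2 volume) (hg₀ : MemLp g₀ 2 volume)
    (hu : Tendsto (fun n => eLpNorm (fun x => u n x - u₀ x) 2 volume) atTop (𝓝 0))
    (hg : Tendsto (fun n => eLpNorm (fun x => g n x - g₀ x) 2 volume) atTop (𝓝 0)) :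
    H1Pair u₀ g₀ := by
  refine ⟨hu₀, hg₀, fun φ hφ => ?_⟩
  have h1 := tendsto_integral_smul_of_eLpNorm (hφ.memLp 2) (fun n => (H n).memLp_grad) hg₀ hg
  have h2 : Tendsto (fun n => ∫ x, u n x • ∇ φ x) atTop (𝓝 (∫ x, u₀ x • ∇ φ x)) := by
    refine tendsto_integral_of_L1 _ (hu₀.integrable_smul_two (hφ.memLp_gradient 2)).1
      (Eventually.of_forall fun n => (H n).memLp.integrable_smul_two (hφ.memLp_gradient 2)) ?_
    have h1 : Tendsto (fun n => eLpNorm (fun x => u n x - u₀ x) 2 volume * eLpNorm (∇ φ) 2 volume)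
        atTop (𝓝 0) := by
      have := ENNReal.Tendsto.mul_const hu (Or.inr (hφ.memLp_gradient 2).eLpNorm_ne_top)
      simpa using this
    refine tendsto_of_tendsto_of_tendsto_of_le_of_le tendsto_const_nhds h1
      (fun n => zero_le) fun n => ?_
    have h2 := eLpNorm_smul_le_mul_eLpNorm (p := 2) (q := 2) (r := 1)
      (hφ.memLp_gradient 2).1 ((H n).memLp.sub hu₀).1
    rw [eLpNorm_one_eq_lintegral_enorm] at h2
    refine le_trans (le_of_eq ?_) h2
    congr 1 with x
    simp [sub_smul]
  refine tendsto_nhds_unique h2 (h1.neg.congr fun n => ?_)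
  rw [(H n).integral_eq φ hφ]

end Closed

/-! ### Density of test functions -/

/-- The cutoffs are dilations of one bump by factors `n + 1 ≥ 1`, which can only decrease the
gradient; hence a single bound `D`. -/
theorem exists_cutoff : ∃ D : ℝ, 0 ≤ D ∧ ∀ n : ℕ, ∃ χ : R3 → ℝ, IsTestFunction χ ∧
    (∀ x, 0 ≤ χ x) ∧ (∀ x, χ x ≤ 1) ∧ (∀ x, ‖x‖ < n + 1 → χ x = 1) ∧ ∀ x, ‖∇ χ x‖ ≤ D := by
  let b : ContDiffBump (0 : R3) := ⟨1, 2, by norm_num, by norm_num⟩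
  have hb : IsTestFunction b := ⟨b.contDiff, b.hasCompactSupport⟩
  obtain ⟨D, hD0, hD⟩ := hb.exists_bound_gradient
  refine ⟨D, hD0, fun n => ?_⟩
  have hn : (0 : ℝ) < n + 1 := by positivity
  have hc : ((n : ℝ) + 1)⁻¹ ≠ 0 := (inv_pos.2 hn).ne'
  refine ⟨fun x => b (((n : ℝ) + 1)⁻¹ • x), ⟨b.contDiff.comp (contDiff_const_smul _),
    hb.2.comp_homeomorph (Homeomorph.smulOfNeZero _ hc)⟩, fun x => b.nonneg,
    fun x => b.le_one, fun x hx => b.one_of_mem_closedBall ?_, fun x => ?_⟩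
  · rw [mem_closedBall_zero_iff, norm_smul, norm_inv, Real.norm_of_nonneg hn.le,
      inv_mul_le_iff₀ hn]
    simpa [b] using hx.le
  · have h1 : HasFDerivAt (fun x => b (((n : ℝ) + 1)⁻¹ • x))
        (((n : ℝ) + 1)⁻¹ • fderiv ℝ b (((n : ℝ) + 1)⁻¹ • x)) x := by
      have := (hb.differentiableAt (((n : ℝ) + 1)⁻¹ • x)).hasFDerivAt.comp x
        ((hasFDerivAt_id x).const_smul ((n : ℝ) + 1)⁻¹)
      simpa [Function.comp_def] using this
    rw [norm_gradient, h1.fderiv, norm_smul, ← norm_gradient, norm_inv, Real.norm_of_nonneg hn.le]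
    refine le_trans (mul_le_of_le_one_left (norm_nonneg _) (inv_le_one_of_one_le₀ ?_)) (hD _)
    have : (0 : ℝ) ≤ n := n.cast_nonneg
    linarith

namespace H1Pair

variable {u : R3 → ℝ} {g : R3 → R3}

theorem exists_test_of_bounded_support (H : H1Pair u g) {R : ℝ} (hR : ∀ x, R < ‖x‖ → u x = 0)
    {ε : ENNReal} (hε : ε ≠ 0) :
    ∃ φ, IsTestFunction φ ∧ eLpNorm (fun x => φ x - u x) 2 volume ≤ ε ∧
      eLpNorm (fun x => ∇ φ x - g x) 2 volume ≤ ε ∧ ((∀ x, 0 ≤ u x) → ∀ x, 0 ≤ φ x) := by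
  have h1 := (ENNReal.tendsto_nhds_zero.1 (continuous_translate_Lp H.memLp)) ε
    (pos_iff_ne_zero.2 hε)
  have h2 := (ENNReal.tendsto_nhds_zero.1 (continuous_translate_Lp H.memLp_grad)) ε
    (pos_iff_ne_zero.2 hε)
  obtain ⟨δ, hδ, h⟩ := Metric.eventually_nhds_iff.1 (h1.and h2)
  obtain ⟨η, hη⟩ := exists_isKernel (half_pos hδ)
  have hδ' : ∀ t : R3, ‖t‖ ≤ δ / 2 → dist t 0 < δ := fun t ht => by
    rw [dist_zero_right]; linarith
  refine ⟨mollify η u, ⟨contDiff_mollify hη.test H.memLp,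
    HasCompactSupport.intro (isCompact_closedBall 0 (R + δ / 2)) fun x hx => ?_⟩,
    eLpNorm_mollify_sub_le hη H.memLp fun t ht => (h (hδ' t ht)).1, ?_,
    fun h0 x => integral_nonneg fun t => mul_nonneg (hη.nonneg _) (h0 t)⟩
  · unfold mollify
    rw [← integral_zero R3 ℝ]
    congr 1 with t
    by_cases ht : R < ‖t‖
    · simp [hR t ht]
    · have : δ / 2 ≤ ‖x - t‖ := by
        have hx' : R + δ / 2 < ‖x‖ := by simpa using hx
        have := norm_sub_norm_le x t
        linarith [not_lt.1 ht]
      simp [hη.eq_zero _ this]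
  · simp only [gradient_mollify hη.test H]
    exact eLpNorm_mollify_sub_le hη H.memLp_grad fun t ht => (h (hδ' t ht)).2

/-- Cut off, then mollify. Both operations preserve nonnegativity, which is needed later to
approximate `|w|` by admissible test functions in Kato's inequality. -/
theorem exists_test (H : H1Pair u g) {ε : ENNReal} (hε : ε ≠ 0) :
    ∃ φ, IsTestFunction φ ∧ eLpNorm (fun x => φ x - u x) 2 volume ≤ ε ∧
      eLpNorm (fun x => ∇ φ x - g x) 2 volume ≤ ε ∧ ((∀ x, 0 ≤ u x) → ∀ x, 0 ≤ φ x) := by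
  obtain ⟨D, hD0, hD⟩ := exists_cutoff
  choose χ hχ hχ0 hχ1 hχe hχD using hD
  have hH : ∀ n, H1Pair (fun x => χ n x * u x) (fun x => χ n x • g x + u x • ∇ (χ n) x) :=
    fun n => H.test_mul (hχ n)
  have hev : ∀ x : R3, ∀ᶠ n : ℕ in atTop, χ n x = 1 ∧ ∇ (χ n) x = 0 := by
    intro x
    obtain ⟨N, hN⟩ := exists_nat_gt ‖x‖
    filter_upwards [eventually_ge_atTop N] with n hn
    have hx : ‖x‖ < n + 1 := by
      have : (N : ℝ) ≤ n := by exact_mod_cast hn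
      linarith
    refine ⟨hχe n x hx, ?_⟩
    have : χ n =ᶠ[𝓝 x] fun _ => 1 := by
      filter_upwards [(isOpen_lt continuous_norm continuous_const).mem_nhds hx] with z hz
      exact hχe n z hz
    rw [this.gradient_eq, gradient_fun_const]
  have ht1 : Tendsto (fun n => eLpNorm (fun x => χ n x * u x - u x) 2 volume) atTop (𝓝 0) := by
    refine tendsto_eLpNorm_two_of_dominated (fun n => ((hH n).memLp.sub H.memLp).1) H.memLp.norm
      (fun n => Eventually.of_forall fun x => ?_) (Eventually.of_forall fun x => ?_)
    · have : χ n x * u x - u x = -(1 - χ n x) * u x := by ring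
      rw [this, norm_mul]
      refine mul_le_of_le_one_left (norm_nonneg _) ?_
      rw [norm_neg, Real.norm_of_nonneg (by linarith [hχ1 n x])]
      linarith [hχ0 n x]
    · exact tendsto_const_nhds.congr' ((hev x).mono fun n hn => by simp [hn.1])
  have ht2 : Tendsto (fun n => eLpNorm (fun x => χ n x • g x + u x • ∇ (χ n) x - g x) 2 volume)
      atTop (𝓝 0) := by
    refine tendsto_eLpNorm_two_of_dominated (fun n => ((hH n).memLp_grad.sub H.memLp_grad).1)
      (H.memLp_grad.norm.add (H.memLp.norm.const_mul D))
      (fun n => Eventually.of_forall fun x => ?_) (Eventually.of_forall fun x => ?_)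
    · have : χ n x • g x + u x • ∇ (χ n) x - g x = -((1 - χ n x) • g x) + u x • ∇ (χ n) x := by
        rw [sub_smul, one_smul]; abel
      rw [this]
      refine (norm_add_le _ _).trans (add_le_add ?_ ?_)
      · rw [norm_neg, norm_smul]
        refine mul_le_of_le_one_left (norm_nonneg _) ?_
        rw [Real.norm_of_nonneg (by linarith [hχ1 n x])]
        linarith [hχ0 n x]
      · rw [norm_smul, mul_comm]
        exact mul_le_mul_of_nonneg_right (hχD n x) (norm_nonneg _)
    · exact tendsto_const_nhds.congr' ((hev x).mono fun n hn => by simp [hn.1, hn.2])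
  have hε2 : 0 < ε / 2 := ENNReal.half_pos hε
  obtain ⟨n, hn1, hn2⟩ := ((ENNReal.tendsto_nhds_zero.1 ht1 _ hε2).and
    (ENNReal.tendsto_nhds_zero.1 ht2 _ hε2)).exists
  obtain ⟨R, -, hR⟩ := (hχ n).exists_ball
  obtain ⟨φ, hφ, h1, h2, h3⟩ := (hH n).exists_test_of_bounded_support (R := R)
    (fun x hx => by simp [hR x hx]) hε2.ne'
  refine ⟨φ, hφ, ?_, ?_, fun h0 => h3 fun x => mul_nonneg (hχ0 n x) (h0 x)⟩
  · calc eLpNorm (fun x => φ x - u x) 2 volume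
        = eLpNorm ((fun x => φ x - χ n x * u x) + fun x => χ n x * u x - u x) 2 volume := by
          congr 1; ext x; simp
      _ ≤ ε / 2 + ε / 2 := (eLpNorm_add_le ((hφ.memLp 2).sub (hH n).memLp).1
          ((hH n).memLp.sub H.memLp).1 (by norm_num)).trans (add_le_add h1 hn1)
      _ = ε := ENNReal.add_halves ε
  · calc eLpNorm (fun x => ∇ φ x - g x) 2 volume
        = eLpNorm ((fun x => ∇ φ x - (χ n x • g x + u x • ∇ (χ n) x)) +
            fun x => χ n x • g x + u x • ∇ (χ n) x - g x) 2 volume := by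
          congr 1; ext1 x; simp only [Pi.add_apply]; abel
      _ ≤ ε / 2 + ε / 2 := (eLpNorm_add_le ((hφ.memLp_gradient 2).sub (hH n).memLp_grad).1
          ((hH n).memLp_grad.sub H.memLp_grad).1 (by norm_num)).trans (add_le_add h2 hn2)
      _ = ε := ENNReal.add_halves ε

theorem exists_seq_test (H : H1Pair u g) : ∃ φ : ℕ → R3 → ℝ, (∀ n, IsTestFunction (φ n)) ∧
    Tendsto (fun n => eLpNorm (fun x => φ n x - u x) 2 volume) atTop (𝓝 0) ∧
    Tendsto (fun n => eLpNorm (fun x => ∇ (φ n) x - g x) 2 volume) atTop (𝓝 0) ∧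
    (∀ᵐ x, Tendsto (fun n => φ n x) atTop (𝓝 (u x))) ∧
    ((∀ x, 0 ≤ u x) → ∀ n x, 0 ≤ φ n x) := by
  have hε : ∀ n : ℕ, ((n : ENNReal) + 1)⁻¹ ≠ 0 := fun n => by simp
  have hlim : Tendsto (fun n : ℕ => ((n : ENNReal) + 1)⁻¹) atTop (𝓝 0) := by
    have := ENNReal.tendsto_inv_nat_nhds_zero.comp (tendsto_add_atTop_nat 1)
    simpa [Function.comp_def] using this
  choose φ hφ h1 h2 h3 using fun n => H.exists_test (hε n)
  have h1' := tendsto_of_tendsto_of_tendsto_of_le_of_le tendsto_const_nhds hlim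
    (fun n => zero_le) h1
  have h2' := tendsto_of_tendsto_of_tendsto_of_le_of_le tendsto_const_nhds hlim
    (fun n => zero_le) h2
  have hm : TendstoInMeasure volume φ atTop u :=
    tendstoInMeasure_of_tendsto_eLpNorm (by norm_num) (fun n => ((hφ n).memLp 2).1) H.memLp.1 h1'
  obtain ⟨σ, hσ, hae⟩ := hm.exists_seq_tendsto_ae
  exact ⟨fun n => φ (σ n), fun n => hφ _, h1'.comp hσ.tendsto_atTop, h2'.comp hσ.tendsto_atTop,
    hae, fun h0 n => h3 _ h0⟩

/-! ### Chain rule -/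

/-- The chain rule is classical along test functions `φ_n → u`. In the limit, `G'(φ_n)∇φ_n - G'(u)g`
is split into `G'(φ_n)(∇φ_n - g)`, small because `G'` is bounded, and `(G'(φ_n) - G'(u))g`, small by
dominated convergence along an a.e. convergent sequence. -/
theorem comp_scalar (H : H1Pair u g) {G : ℝ → ℝ} (hG : ContDiff ℝ 1 G) (hG0 : G 0 = 0)
    {L : ℝ} (hL : ∀ s, |deriv G s| ≤ L) :
    H1Pair (fun x => G (u x)) (fun x => deriv G (u x) • g x) := by
  have hL0 : 0 ≤ L := (abs_nonneg _).trans (hL 0)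
  have hlip : ∀ s t, |G s - G t| ≤ L * |s - t| := fun s t =>
    Convex.norm_image_sub_le_of_norm_deriv_le (s := Set.univ)
      (fun x _ => hG.differentiable one_ne_zero x) (fun x _ => hL x) convex_univ
      (Set.mem_univ t) (Set.mem_univ s)
  have hG' : Continuous (deriv G) := hG.continuous_deriv le_rfl
  obtain ⟨φ, hφ, h1, h2, h3, -⟩ := H.exists_seq_test
  have mu : MemLp (fun x => G (u x)) 2 volume :=
    (H.memLp.const_mul L).mono (hG.continuous.comp_aestronglyMeasurable H.memLp.1)
      (Eventually.of_forall fun x => by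
        have := hlip (u x) 0
        rw [hG0] at this
        simpa [abs_of_nonneg hL0] using this)
  have mg : MemLp (fun x => deriv G (u x) • g x) 2 volume :=
    (H.memLp_grad.const_smul L).mono
      ((hG'.comp_aestronglyMeasurable H.memLp.1).smul H.memLp_grad.1)
      (Eventually.of_forall fun x => by
        simpa [norm_smul, abs_of_nonneg hL0] using
          mul_le_mul_of_nonneg_right (hL (u x)) (norm_nonneg (g x)))
  have hpair : ∀ n, H1Pair (fun x => G (φ n x)) (fun x => deriv G (φ n x) • ∇ (φ n) x) := by
    intro n
    have := of_contDiff (u := fun x => G (φ n x)) (hG.comp (hφ n).contDiff_one)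
      ((hφ n).2.comp_left hG0)
    refine this.congr_ae .rfl (Eventually.of_forall fun x => ?_)
    exact gradient_comp_scalar (hG.differentiable one_ne_zero _) ((hφ n).differentiableAt x)
  refine of_tendsto hpair mu mg ?_ ?_
  · have hlim : Tendsto (fun n => ENNReal.ofReal L * eLpNorm (fun x => φ n x - u x) 2 volume)
        atTop (𝓝 0) := by
      simpa using ENNReal.Tendsto.const_mul h1 (Or.inr ENNReal.ofReal_ne_top)
    refine tendsto_of_tendsto_of_tendsto_of_le_of_le tendsto_const_nhds hlim
      (fun n => zero_le) fun n => ?_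
    exact eLpNorm_le_mul_eLpNorm_of_ae_le_mul (Eventually.of_forall fun x => hlip _ _) 2
  · have hlim1 : Tendsto (fun n => ENNReal.ofReal L * eLpNorm (fun x => ∇ (φ n) x - g x) 2 volume)
        atTop (𝓝 0) := by
      simpa using ENNReal.Tendsto.const_mul h2 (Or.inr ENNReal.ofReal_ne_top)
    have hm2 : ∀ n, AEStronglyMeasurable
        (fun x => (deriv G (φ n x) - deriv G (u x)) • g x) volume := fun n =>
      ((hG'.comp_aestronglyMeasurable ((hφ n).memLp 2).1).sub
        (hG'.comp_aestronglyMeasurable H.memLp.1)).smul H.memLp_grad.1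
    have hlim2 : Tendsto (fun n => eLpNorm (fun x => (deriv G (φ n x) - deriv G (u x)) • g x)
        2 volume) atTop (𝓝 0) := by
      refine tendsto_eLpNorm_two_of_dominated hm2
        (H.memLp_grad.norm.const_mul (2 * L)) (fun n => Eventually.of_forall fun x => ?_) ?_
      · rw [norm_smul]
        gcongr
        calc ‖deriv G (φ n x) - deriv G (u x)‖ ≤ ‖deriv G (φ n x)‖ + ‖deriv G (u x)‖ :=
              norm_sub_le _ _
          _ ≤ L + L := add_le_add (hL _) (hL _)
          _ = 2 * L := by ring
      · filter_upwards [h3] with x hx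
        have := (((hG'.tendsto _).comp hx).sub_const (deriv G (u x))).smul_const (g x)
        simpa using this
    have hsum := hlim1.add hlim2
    rw [add_zero] at hsum
    refine tendsto_of_tendsto_of_tendsto_of_le_of_le tendsto_const_nhds hsum
      (fun n => zero_le) fun n => ?_
    have hm1 : AEStronglyMeasurable (fun x => deriv G (φ n x) • (∇ (φ n) x - g x)) volume :=
      (hG'.comp_aestronglyMeasurable ((hφ n).memLp 2).1).smul
        (((hφ n).memLp_gradient 2).sub H.memLp_grad).1
    calc eLpNorm (fun x => deriv G (φ n x) • ∇ (φ n) x - deriv G (u x) • g x) 2 volume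
        = eLpNorm ((fun x => deriv G (φ n x) • (∇ (φ n) x - g x)) +
            fun x => (deriv G (φ n x) - deriv G (u x)) • g x) 2 volume := by
          congr 1; ext1 x
          simp only [Pi.add_apply, smul_sub, sub_smul]; abel
      _ ≤ _ := eLpNorm_add_le hm1 (hm2 n) (by norm_num)
      _ ≤ _ := by
        gcongr
        exact eLpNorm_le_mul_eLpNorm_of_ae_le_mul (Eventually.of_forall fun x => by
          rw [norm_smul]
          exact mul_le_mul_of_nonneg_right (hL _) (norm_nonneg _)) 2

end H1Pair

/-! ### The modulus of an `H¹` function -/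

theorem hasDerivAt_sqrt_sq_add {ε : ℝ} (hε : 0 < ε) (s : ℝ) :
    HasDerivAt (fun s => √(s ^ 2 + ε ^ 2) - ε) (s / √(s ^ 2 + ε ^ 2)) s := by
  have h0 : s ^ 2 + ε ^ 2 ≠ 0 := by positivity
  have h1 : HasDerivAt (fun s : ℝ => s ^ 2 + ε ^ 2) (2 * s) s := by
    simpa using (hasDerivAt_pow 2 s).add_const (ε ^ 2)
  have h2 := (h1.sqrt h0).sub_const ε
  rwa [mul_div_mul_left _ _ two_ne_zero] at h2

theorem contDiff_sqrt_sq_add {ε : ℝ} (hε : 0 < ε) :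
    ContDiff ℝ 1 (fun s : ℝ => √(s ^ 2 + ε ^ 2) - ε) :=
  (((contDiff_id.pow 2).add contDiff_const).sqrt fun s => by
    have : 0 < s ^ 2 + ε ^ 2 := by positivity
    exact this.ne').sub contDiff_const

theorem abs_le_sqrt_sq_add (ε s : ℝ) : |s| ≤ √(s ^ 2 + ε ^ 2) :=
  Real.abs_le_sqrt (by nlinarith [sq_nonneg ε])

theorem sqrt_sq_add_le {ε : ℝ} (hε : 0 < ε) (s : ℝ) : √(s ^ 2 + ε ^ 2) ≤ |s| + ε := by
  rw [Real.sqrt_le_left (by positivity)]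
  nlinarith [sq_abs s, abs_nonneg s]

theorem abs_div_sqrt_sq_add_le_one (ε s : ℝ) : |s / √(s ^ 2 + ε ^ 2)| ≤ 1 := by
  rw [abs_div, abs_of_nonneg (Real.sqrt_nonneg _)]
  exact div_le_one_of_le₀ (abs_le_sqrt_sq_add ε s) (Real.sqrt_nonneg _)

theorem abs_div_abs_le_one (s : ℝ) : |s / (|s|)| ≤ 1 := by
  rw [abs_div, abs_abs]
  exact div_self_le_one _

/-- With the convention `0 / 0 = 0`, the quotient `s / |s|` is the sign of `s`, so the limit is also
correct at `s = 0`. -/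
theorem tendsto_div_sqrt_sq_add (s : ℝ) :
    Tendsto (fun ε : ℝ => s / √(s ^ 2 + ε ^ 2)) (𝓝 0) (𝓝 (s / |s|)) := by
  rcases eq_or_ne s 0 with rfl | hs
  · simp
  · have : ContinuousAt (fun ε : ℝ => s / √(s ^ 2 + ε ^ 2)) 0 := by
      refine continuousAt_const.div (by fun_prop) ?_
      have : 0 < √(s ^ 2 + 0 ^ 2) := Real.sqrt_pos.2 (by positivity)
      exact this.ne'
    simpa [ContinuousAt, Real.sqrt_sq_eq_abs] using this

theorem tendsto_one_div_add_nhds_zero : Tendsto (fun n : ℕ => 1 / ((n : ℝ) + 1)) atTop (𝓝 0) :=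
  tendsto_one_div_add_atTop_nhds_zero_nat

/-- The modulus is approximated by the smooth functions `√(s² + ε²) - ε`, which vanish at zero and
are 1-Lipschitz; the chain rule applies to them and closedness of the gradient gives the limit. -/
theorem H1Pair.abs {u : R3 → ℝ} {g : R3 → R3} (H : H1Pair u g) :
    H1Pair (fun x => |u x|) (fun x => (u x / |u x|) • g x) := by
  let e : ℕ → ℝ := fun n => 1 / ((n : ℝ) + 1)
  have he : ∀ n, 0 < e n := fun n => by positivity
  have hlim : Tendsto e atTop (𝓝 0) := tendsto_one_div_add_nhds_zero
  have hd : ∀ n s, deriv (fun s => √(s ^ 2 + e n ^ 2) - e n) s = s / √(s ^ 2 + e n ^ 2) :=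
    fun n s => (hasDerivAt_sqrt_sq_add (he n) s).deriv
  have hp : ∀ n, H1Pair (fun x => √(u x ^ 2 + e n ^ 2) - e n)
      (fun x => (u x / √(u x ^ 2 + e n ^ 2)) • g x) := fun n => by
    have := H.comp_scalar (contDiff_sqrt_sq_add (he n)) (by simp [(he n).le]) (L := 1)
      (fun s => by rw [hd]; exact abs_div_sqrt_sq_add_le_one _ _)
    simpa only [hd] using this
  have hm : AEStronglyMeasurable (fun x => (u x / |u x|) • g x) volume :=
    (H.memLp.1.aemeasurable.div H.memLp.1.norm.aemeasurable).aestronglyMeasurable.smul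
      H.memLp_grad.1
  have mg : MemLp (fun x => (u x / |u x|) • g x) 2 volume :=
    H.memLp_grad.mono hm (Eventually.of_forall fun x => by
      rw [norm_smul]
      exact mul_le_of_le_one_left (norm_nonneg _) (abs_div_abs_le_one _))
  refine H1Pair.of_tendsto hp H.memLp.norm mg ?_ ?_
  · refine tendsto_eLpNorm_two_of_dominated (fun n => ((hp n).memLp.sub H.memLp.norm).1)
      (H.memLp.norm) (fun n => Eventually.of_forall fun x => ?_)
      (Eventually.of_forall fun x => ?_)
    · have h1 := abs_le_sqrt_sq_add (e n) (u x)
      have h2 := sqrt_sq_add_le (he n) (u x)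
      have h3 : e n ≤ √(u x ^ 2 + e n ^ 2) :=
        Real.le_sqrt_of_sq_le (by nlinarith [sq_nonneg (u x)])
      simp only [Real.norm_eq_abs]
      rw [abs_le]
      constructor <;> linarith [abs_nonneg (u x)]
    · rw [← sub_self (|u x|)]
      refine Tendsto.sub_const ?_ _
      have : Continuous fun ε : ℝ => √(u x ^ 2 + ε ^ 2) - ε := by fun_prop
      simpa [Real.sqrt_sq_eq_abs, Function.comp_def] using (this.tendsto 0).comp hlim
  · refine tendsto_eLpNorm_two_of_dominated (fun n => ((hp n).memLp_grad.sub mg).1)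
      (H.memLp_grad.norm.const_mul 2) (fun n => Eventually.of_forall fun x => ?_)
      (Eventually.of_forall fun x => ?_)
    · rw [← sub_smul, norm_smul]
      gcongr
      calc _ ≤ ‖u x / √(u x ^ 2 + e n ^ 2)‖ + ‖u x / |u x|‖ := norm_sub_le _ _
        _ ≤ 1 + 1 := add_le_add (abs_div_sqrt_sq_add_le_one _ _) (abs_div_abs_le_one _)
        _ = 2 := by norm_num
    · have := (((tendsto_div_sqrt_sq_add (u x)).comp hlim).smul_const (g x)).sub_const
        ((u x / |u x|) • g x)
      simpa using this

/-! ### Translations -/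

theorem enorm_integral_sq_le {E α : Type*} [NormedAddCommGroup E] [NormedSpace ℝ E]
    [MeasurableSpace α] {ν : Measure α} [IsProbabilityMeasure ν] {k : α → E}
    (hk : AEStronglyMeasurable k ν) : ‖∫ t, k t ∂ν‖ₑ ^ 2 ≤ ∫⁻ t, ‖k t‖ₑ ^ 2 ∂ν := by
  rw [← eLpNorm_two_sq]
  gcongr
  refine (enorm_integral_le_lintegral_enorm _).trans ?_
  rw [← eLpNorm_one_eq_lintegral_enorm]
  exact eLpNorm_le_eLpNorm_of_exponent_le (by norm_num) hk

/-- The increment is the integral of `∇φ · y` along the segment from `x` to `x + y`. Jensen in the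
segment parameter, Tonelli and translation invariance finish the proof. -/
theorem IsTestFunction.eLpNorm_translate_sub_le {φ : R3 → ℝ} (hφ : IsTestFunction φ) (y : R3) :
    eLpNorm (fun x => φ (x + y) - φ x) 2 volume ≤ ‖y‖ₑ * eLpNorm (∇ φ) 2 volume := by
  rw [eLpNorm_two_le_iff, mul_pow, eLpNorm_two_sq]
  let ν : Measure ℝ := volume.restrict (Set.Ioc 0 1)
  have : IsProbabilityMeasure ν := ⟨by simp [ν]⟩
  have hc := continuous_gradient hφ.contDiff_one
  have hpt : ∀ x, φ (x + y) - φ x = ∫ t, inner ℝ (∇ φ (x + t • y)) y ∂ν := by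
    intro x
    have hd : ∀ t : ℝ, HasDerivAt (fun t : ℝ => φ (x + t • y)) (inner ℝ (∇ φ (x + t • y)) y) t := by
      intro t
      have h1 : HasDerivAt (fun t : ℝ => x + t • y) y t := by
        simpa using ((hasDerivAt_id t).smul_const y).const_add x
      have := (hφ.differentiableAt (x + t • y)).hasFDerivAt.comp_hasDerivAt t h1
      rw [inner_gradient_left]
      exact this
    have hcont : Continuous fun t : ℝ => inner ℝ (∇ φ (x + t • y)) y := by fun_prop
    have := intervalIntegral.integral_eq_sub_of_hasDerivAt (a := 0) (b := 1) (fun t _ => hd t)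
      (hcont.intervalIntegrable _ _)
    rw [intervalIntegral.integral_of_le zero_le_one] at this
    simp only [ν, this]
    simp
  calc ∫⁻ x, ‖φ (x + y) - φ x‖ₑ ^ 2
      ≤ ∫⁻ x, ∫⁻ t, ‖y‖ₑ ^ 2 * ‖∇ φ (x + t • y)‖ₑ ^ 2 ∂ν := by
        refine lintegral_mono fun x => ?_
        rw [hpt x]
        refine (enorm_integral_sq_le (Continuous.aestronglyMeasurable (by fun_prop))).trans ?_
        refine lintegral_mono fun t => ?_
        rw [← mul_pow, mul_comm]
        gcongr
        rw [← ofReal_norm, ← ofReal_norm, ← ofReal_norm, ← ENNReal.ofReal_mul (norm_nonneg _)]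
        exact ENNReal.ofReal_le_ofReal (norm_inner_le_norm (𝕜 := ℝ) _ _)
    _ = ∫⁻ t, ∫⁻ x, ‖y‖ₑ ^ 2 * ‖∇ φ (x + t • y)‖ₑ ^ 2 ∂volume ∂ν := by
        refine lintegral_lintegral_swap (Measurable.aemeasurable ?_)
        have : Continuous fun z : R3 × ℝ => ∇ φ (z.1 + z.2 • y) := by fun_prop
        exact (this.enorm.measurable.pow_const 2).const_mul _
    _ = ∫⁻ t, ‖y‖ₑ ^ 2 * ∫⁻ x, ‖∇ φ x‖ₑ ^ 2 ∂volume ∂ν := by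
        congr 1 with t
        rw [lintegral_const_mul' _ _ (by simp),
          lintegral_add_right_eq_self (fun x => ‖∇ φ x‖ₑ ^ 2) (t • y)]
    _ = ‖y‖ₑ ^ 2 * ∫⁻ x, ‖∇ φ x‖ₑ ^ 2 := by simp

theorem eLpNorm_comp_add_right {X : Type*} [NormedAddCommGroup X] {f : R3 → X} {p : ENNReal}
    (hf : AEStronglyMeasurable f volume) (y : R3) :
    eLpNorm (fun x => f (x + y)) p volume = eLpNorm f p volume :=
  eLpNorm_comp_measurePreserving hf (measurePreserving_add_right volume y)

theorem tendsto_eLpNorm_of_sub {X : Type*} [NormedAddCommGroup X] {f : ℕ → R3 → X} {f₀ : R3 → X}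
    (hf : ∀ n, MemLp (f n) 2 volume) (hf₀ : MemLp f₀ 2 volume)
    (h : Tendsto (fun n => eLpNorm (fun x => f n x - f₀ x) 2 volume) atTop (𝓝 0)) :
    Tendsto (fun n => eLpNorm (f n) 2 volume) atTop (𝓝 (eLpNorm f₀ 2 volume)) := by
  have h1 : Tendsto (fun n => (hf n).toLp (f n)) atTop (𝓝 (hf₀.toLp f₀)) := by
    rw [Lp.tendsto_Lp_iff_tendsto_eLpNorm'']
    exact h
  have := ((continuous_enorm.tendsto _).comp h1)
  simpa [Function.comp_def, Lp.enorm_toLp] using this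

theorem H1Pair.eLpNorm_translate_sub_le {u : R3 → ℝ} {g : R3 → R3} (H : H1Pair u g) (y : R3) :
    eLpNorm (fun x => u (x + y) - u x) 2 volume ≤ ‖y‖ₑ * eLpNorm g 2 volume := by
  obtain ⟨φ, hφ, h1, h2, -, -⟩ := H.exists_seq_test
  have hg := ENNReal.Tendsto.const_mul (a := ‖y‖ₑ)
    (tendsto_eLpNorm_of_sub (fun n => (hφ n).memLp_gradient 2) H.memLp_grad h2)
    (Or.inr enorm_ne_top)
  have hu : Tendsto (fun n => eLpNorm (fun x => φ n (x + y) - φ n x) 2 volume) atTop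
      (𝓝 (eLpNorm (fun x => u (x + y) - u x) 2 volume)) := by
    refine tendsto_eLpNorm_of_sub
      (fun n => (memLp_comp_add_right ((hφ n).memLp 2) y).sub ((hφ n).memLp 2))
      ((memLp_comp_add_right H.memLp y).sub H.memLp) ?_
    have h3 := h1.add h1
    rw [add_zero] at h3
    refine tendsto_of_tendsto_of_tendsto_of_le_of_le tendsto_const_nhds h3
      (fun n => zero_le) fun n => ?_
    have hm := ((hφ n).memLp 2).sub H.memLp
    have e1 := eLpNorm_comp_add_right (p := 2) hm.1 y
    have e2 := eLpNorm_sub_le (memLp_comp_add_right hm y).1 hm.1 (p := 2) (by norm_num)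
    rw [e1] at e2
    refine le_trans (le_of_eq ?_) e2
    congr 1; ext x
    simp only [Pi.sub_apply]; ring
  exact le_of_tendsto_of_tendsto' hu hg fun n => (hφ n).eLpNorm_translate_sub_le y

/-! ### The Sobolev inequality -/

/-- Gagliardo-Nirenberg-Sobolev for test functions in dimension three (`2* = 6`), carried over by
density: Fatou along an a.e. convergent sequence on the left, continuity of the `L²` norm on the
right. -/
theorem exists_sobolev_const : ∃ S : ENNReal, S ≠ ⊤ ∧ ∀ (u : R3 → ℝ) (g : R3 → R3), H1Pair u g →
    eLpNorm u 6 volume ≤ S * eLpNorm g 2 volume := by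
  refine ⟨eLpNormLESNormFDerivOfEqInnerConst (volume : Measure R3) 2, ENNReal.coe_ne_top,
    fun u g H => ?_⟩
  have htest : ∀ φ : R3 → ℝ, IsTestFunction φ → eLpNorm φ 6 volume
      ≤ eLpNormLESNormFDerivOfEqInnerConst (volume : Measure R3) 2 * eLpNorm (∇ φ) 2 volume := by
    intro φ hφ
    have := eLpNorm_le_eLpNorm_fderiv_of_eq_inner (volume : Measure R3) hφ.contDiff_one hφ.2
      (p := 2) (p' := 6) (by norm_num) (by simp) (by simp; norm_num)
    have e : eLpNorm (∇ φ) 2 volume = eLpNorm (fderiv ℝ φ) 2 volume :=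
      eLpNorm_congr_norm_ae (Eventually.of_forall fun x => norm_gradient φ x)
    rw [e]
    exact_mod_cast this
  obtain ⟨φ, hφ, h1, h2, h3, -⟩ := H.exists_seq_test
  have hg := ENNReal.Tendsto.const_mul
    (a := (eLpNormLESNormFDerivOfEqInnerConst (volume : Measure R3) 2 : ENNReal))
    (tendsto_eLpNorm_of_sub (fun n => (hφ n).memLp_gradient 2) H.memLp_grad h2)
    (Or.inr ENNReal.coe_ne_top)
  calc eLpNorm u 6 volume ≤ liminf (fun n => eLpNorm (φ n) 6 volume) atTop :=
        Lp.eLpNorm_lim_le_liminf_eLpNorm (fun n => ((hφ n).memLp 2).1) u h3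
    _ ≤ liminf (fun n => eLpNormLESNormFDerivOfEqInnerConst (volume : Measure R3) 2
          * eLpNorm (∇ (φ n)) 2 volume) atTop :=
        liminf_le_liminf (Eventually.of_forall fun n => htest _ (hφ n))
    _ = _ := hg.liminf_eq

/-! ### Weak convergence in `L²` -/

section Weak

variable {E : Type*} [NormedAddCommGroup E] [InnerProductSpace ℝ E]

/-- Weak convergence in `L²(ℝ³; E)`. -/
structure WeakL2 (v : ℕ → R3 → E) (w : R3 → E) : Prop where
  memLp : ∀ n, MemLp (v n) 2 volume
  memLp_lim : MemLp w 2 volume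
  tendsto : ∀ φ : R3 → E, MemLp φ 2 volume →
    Tendsto (fun n => ∫ x, inner ℝ (v n x) (φ x)) atTop (𝓝 (∫ x, inner ℝ (w x) (φ x)))

namespace WeakL2

variable {v v' : ℕ → R3 → E} {w w' : R3 → E}

theorem comp (h : WeakL2 v w) {σ : ℕ → ℕ} (hσ : StrictMono σ) : WeakL2 (fun n => v (σ n)) w :=
  ⟨fun _ => h.memLp _, h.memLp_lim, fun φ hφ => (h.tendsto φ hφ).comp hσ.tendsto_atTop⟩

theorem const (hw : MemLp w 2 volume) : WeakL2 (fun _ => w) w :=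
  ⟨fun _ => hw, hw, fun _ _ => tendsto_const_nhds⟩

theorem add (h : WeakL2 v w) (h' : WeakL2 v' w') :
    WeakL2 (fun n x => v n x + v' n x) (fun x => w x + w' x) := by
  refine ⟨fun n => (h.memLp n).add (h'.memLp n), h.memLp_lim.add h'.memLp_lim, fun φ hφ => ?_⟩
  simp only [inner_add_left]
  rw [integral_add (h.memLp_lim.integrable_inner_two hφ) (h'.memLp_lim.integrable_inner_two hφ)]
  refine ((h.tendsto φ hφ).add (h'.tendsto φ hφ)).congr fun n => ?_
  rw [integral_add ((h.memLp n).integrable_inner_two hφ) ((h'.memLp n).integrable_inner_two hφ)]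

theorem const_smul (h : WeakL2 v w) (c : ℝ) :
    WeakL2 (fun n x => c • v n x) (fun x => c • w x) := by
  refine ⟨fun n => (h.memLp n).const_smul c, h.memLp_lim.const_smul c, fun φ hφ => ?_⟩
  simp only [real_inner_smul_left, integral_const_mul]
  exact (h.tendsto φ hφ).const_mul c

theorem sub (h : WeakL2 v w) (h' : WeakL2 v' w') :
    WeakL2 (fun n x => v n x - v' n x) (fun x => w x - w' x) := by
  simpa [sub_eq_add_neg] using h.add (h'.const_smul (-1))

theorem sum {ι : Type*} (s : Finset ι) {v : ι → ℕ → R3 → E} {w : ι → R3 → E}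
    (h : ∀ i ∈ s, WeakL2 (v i) (w i)) :
    WeakL2 (fun n x => ∑ i ∈ s, v i n x) (fun x => ∑ i ∈ s, w i x) := by
  classical
  induction s using Finset.induction_on with
  | empty => simpa using const (w := fun _ : R3 => (0 : E)) MemLp.zero'
  | insert a s ha ih =>
    simp only [Finset.sum_insert ha]
    exact (h a (by simp)).add (ih fun i hi => h i (by simp [hi]))

theorem congr_lim (h : WeakL2 v w) (hw : w =ᵐ[volume] w') : WeakL2 v w' := by
  refine ⟨h.memLp, h.memLp_lim.ae_eq hw, fun φ hφ => ?_⟩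
  have e : ∫ x, inner ℝ (w x) (φ x) = ∫ x, inner ℝ (w' x) (φ x) :=
    integral_congr_ae (hw.mono fun x hx => by simp only [hx])
  rw [← e]
  exact h.tendsto φ hφ

end WeakL2

theorem norm_integral_inner_le {f g : R3 → E} (hf : MemLp f 2 volume) (hg : MemLp g 2 volume) :
    ‖∫ x, inner ℝ (f x) (g x)‖ₑ ≤ eLpNorm f 2 volume * eLpNorm g 2 volume := by
  refine (enorm_integral_le_lintegral_enorm _).trans ?_
  have h := eLpNorm_le_eLpNorm_mul_eLpNorm_of_nnnorm (p := 2) (q := 2) (r := 1) hf.1 hg.1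
    (fun a b => inner ℝ a b) 1 (Eventually.of_forall fun x => by
      simpa using nnnorm_inner_le_nnnorm (𝕜 := ℝ) (f x) (g x))
  rw [eLpNorm_one_eq_lintegral_enorm] at h
  simpa using h

/-- Sequential Banach-Alaoglu in the dual of the separable Hilbert space `L²`, read through the
Riesz isometry. -/
theorem exists_weakL2_subseq [CompleteSpace E] [SecondCountableTopology E] {v : ℕ → R3 → E}
    (hv : ∀ n, MemLp (v n) 2 volume) {C : ENNReal} (hC : C ≠ ⊤)
    (hb : ∀ n, eLpNorm (v n) 2 volume ≤ C) :
    ∃ (σ : ℕ → ℕ) (w : R3 → E), StrictMono σ ∧ WeakL2 (fun n => v (σ n)) w := by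
  let X := Lp E 2 (volume : Measure R3)
  have : Fact ((2 : ENNReal) ≠ ⊤) := ⟨by norm_num⟩
  let d : X ≃ₗᵢ⋆[ℝ] StrongDual ℝ X := InnerProductSpace.toDual ℝ X
  have hcompact := WeakDual.isSeqCompact_closedBall ℝ X (0 : StrongDual ℝ X) C.toReal
  obtain ⟨l, -, σ, hσ, hl⟩ := hcompact
    (x := fun n => StrongDual.toWeakDual (d ((hv n).toLp (v n)))) (fun n => by
      simp only [Set.mem_preimage, Metric.mem_closedBall, dist_zero_right]
      change ‖d ((hv n).toLp (v n))‖ ≤ _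
      rw [LinearIsometryEquiv.norm_map, Lp.norm_toLp]
      exact ENNReal.toReal_mono hC (hb n))
  let w : X := d.symm (WeakDual.toStrongDual l)
  refine ⟨σ, w, hσ, fun n => hv _, Lp.memLp w, fun φ hφ => ?_⟩
  have h1 := ((WeakDual.eval_continuous (hφ.toLp φ)).tendsto l).comp hl
  have e1 : l (hφ.toLp φ) = ∫ x, inner ℝ (w x) (φ x) := by
    have : l (hφ.toLp φ) = inner ℝ w (hφ.toLp φ) := by
      rw [← InnerProductSpace.toDual_apply_apply]
      change _ = d w _
      simp [w]
    rw [this, L2.inner_def]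
    exact integral_congr_ae (hφ.coeFn_toLp.mono fun x hx => by simp only [hx])
  rw [e1] at h1
  refine h1.congr fun n => ?_
  have : d ((hv (σ n)).toLp (v (σ n))) (hφ.toLp φ) = ∫ x, inner ℝ (v (σ n) x) (φ x) := by
    simp only [d, InnerProductSpace.toDual_apply_apply]
    rw [L2.inner_def]
    refine integral_congr_ae ?_
    filter_upwards [hφ.coeFn_toLp, (hv (σ n)).coeFn_toLp] with x h1 h2
    simp only [h1, h2]
  rw [← this]
  rfl

/-- Testing the weak convergence with the limit itself gives `‖w‖² ≤ C ‖w‖`. -/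
theorem WeakL2.eLpNorm_le {v : ℕ → R3 → E} {w : R3 → E} (h : WeakL2 v w) {C : ENNReal}
    (hb : ∀ n, eLpNorm (v n) 2 volume ≤ C) : eLpNorm w 2 volume ≤ C := by
  have h1 := (h.tendsto w h.memLp_lim).enorm
  have h2 : ‖∫ x, inner ℝ (w x) (w x)‖ₑ = eLpNorm w 2 volume ^ 2 := by
    rw [eLpNorm_two_sq_eq_ofReal h.memLp_lim]
    simp only [real_inner_self_eq_norm_sq]
    rw [Real.enorm_of_nonneg (integral_nonneg fun x => by positivity)]
  rw [h2] at h1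
  have h3 : eLpNorm w 2 volume ^ 2 ≤ C * eLpNorm w 2 volume := by
    refine le_of_tendsto h1 (Eventually.of_forall fun n => ?_)
    exact (norm_integral_inner_le (h.memLp n) h.memLp_lim).trans (by gcongr; exact hb n)
  rcases eq_or_ne (eLpNorm w 2 volume) 0 with h0 | h0
  · simp [h0]
  · rw [pow_two] at h3
    exact (ENNReal.mul_le_mul_iff_left h0 h.memLp_lim.eLpNorm_ne_top).1 h3

/-! ### Translations going to infinity -/

theorem tendsto_eLpNorm_indicator_norm_ge {X : Type*} [NormedAddCommGroup X]
    {f : R3 → X} (hf : MemLp f 2 volume) {ρ : ℕ → ℝ} (hρ : Tendsto ρ atTop atTop) :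
    Tendsto (fun n => eLpNorm ({x : R3 | ρ n ≤ ‖x‖}.indicator f) 2 volume) atTop (𝓝 0) := by
  have hms : ∀ n, MeasurableSet {x : R3 | ρ n ≤ ‖x‖} := fun n =>
    measurableSet_le measurable_const measurable_norm
  refine tendsto_eLpNorm_two_of_dominated (fun n => hf.1.indicator (hms n)) hf.norm
    (fun n => Eventually.of_forall fun x => norm_indicator_le_norm_self _ _)
    (Eventually.of_forall fun x => ?_)
  refine tendsto_const_nhds.congr' ?_
  filter_upwards [hρ.eventually_gt_atTop ‖x‖] with n hn
  rw [Set.indicator_of_notMem]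
  simpa using hn

/-- The pairing is split at `|x| = |y_n| / 2`. Outside, the fixed function `φ` has little mass;
inside, `|x + y_n| ≥ |y_n| / 2`, so that only the tail of `w` enters. -/
theorem weakL2_translate_of_tendsto_norm {w : R3 → E} (hw : MemLp w 2 volume) {y : ℕ → R3}
    (hy : Tendsto (fun n => ‖y n‖) atTop atTop) :
    WeakL2 (fun n x => w (x + y n)) (fun _ => 0) := by
  refine ⟨fun n => memLp_comp_add_right hw _, MemLp.zero', fun φ hφ => ?_⟩
  simp only [inner_zero_left, integral_zero]
  have hρ : Tendsto (fun n => ‖y n‖ / 2) atTop atTop := hy.atTop_div_const (by norm_num)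
  have hms : ∀ n, MeasurableSet {x : R3 | ‖y n‖ / 2 ≤ ‖x‖} := fun n =>
    measurableSet_le measurable_const measurable_norm
  have h1 := ENNReal.Tendsto.mul_const (b := eLpNorm w 2 volume)
    (tendsto_eLpNorm_indicator_norm_ge hφ hρ) (Or.inr hw.eLpNorm_ne_top)
  have h2 := ENNReal.Tendsto.mul_const (b := eLpNorm φ 2 volume)
    (tendsto_eLpNorm_indicator_norm_ge hw hρ) (Or.inr hφ.eLpNorm_ne_top)
  have h3 := h1.add h2
  simp only [zero_mul, add_zero] at h3
  rw [tendsto_zero_iff_enorm_tendsto_zero]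
  refine tendsto_of_tendsto_of_tendsto_of_le_of_le tendsto_const_nhds h3
    (fun n => zero_le) fun n => ?_
  let A : Set R3 := {x : R3 | ‖y n‖ / 2 ≤ ‖x‖}
  have hwy := memLp_comp_add_right hw (y n)
  have hwA : MemLp (A.indicator w) 2 volume := hw.indicator (hms n)
  have hwA' := memLp_comp_add_right hwA (y n)
  have hφA : MemLp (A.indicator φ) 2 volume := hφ.indicator (hms n)
  have hφB : MemLp (Aᶜ.indicator φ) 2 volume := hφ.indicator (hms n).compl
  have e : ∫ x, inner ℝ (w (x + y n)) (φ x) = (∫ x, inner ℝ (A.indicator φ x) (w (x + y n)))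
      + ∫ x, inner ℝ (A.indicator w (x + y n)) (Aᶜ.indicator φ x) := by
    rw [← integral_add (hφA.integrable_inner_two hwy) (hwA'.integrable_inner_two hφB)]
    congr 1 with x
    by_cases hx : x ∈ A
    · simp [hx, real_inner_comm]
    · have hx' : ‖x‖ < ‖y n‖ / 2 := by simpa [A] using hx
      have hxy : x + y n ∈ A := by
        have := norm_sub_le (x + y n) x
        simp only [add_sub_cancel_left] at this
        simp only [A, Set.mem_ofPred_eq]; linarith
      simp [hx, hxy]
  rw [e]
  refine (enorm_add_le _ _).trans (add_le_add ?_ ?_)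
  · refine (norm_integral_inner_le hφA hwy).trans (le_of_eq ?_)
    rw [eLpNorm_comp_add_right hw.1]
  · refine (norm_integral_inner_le hwA' hφB).trans ?_
    rw [eLpNorm_comp_add_right hwA.1]
    gcongr
    exact eLpNorm_mono fun x => norm_indicator_le_norm_self _ _

end Weak

/-! ### Weak convergence of functions in `H¹` -/

theorem H1Pair.of_weakL2 {u : ℕ → R3 → ℝ} {g : ℕ → R3 → R3} {u₀ : R3 → ℝ} {g₀ : R3 → R3}
    (H : ∀ n, H1Pair (u n) (g n)) (hu : WeakL2 u u₀) (hg : WeakL2 g g₀) : H1Pair u₀ g₀ := by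
  refine ⟨hu.memLp_lim, hg.memLp_lim, fun φ hφ => ext_inner_right ℝ fun a => ?_⟩
  have e1 : ∀ u : R3 → ℝ, MemLp u 2 volume →
      inner ℝ (∫ x, u x • ∇ φ x) a = ∫ x, inner ℝ (u x) (inner ℝ (∇ φ x) a) := by
    intro u hu
    rw [real_inner_comm, ← integral_inner (hu.integrable_smul_two (hφ.memLp_gradient 2))]
    congr 1 with x
    rw [inner_smul_right, real_inner_comm a]
    simp [mul_comm]
  have e2 : ∀ g : R3 → R3, MemLp g 2 volume →
      inner ℝ (- ∫ x, φ x • g x) a = - ∫ x, inner ℝ (g x) (φ x • a) := by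
    intro g hg
    rw [inner_neg_left, real_inner_comm, ← integral_inner ((hφ.memLp 2).integrable_smul_two hg)]
    congr 2 with x
    rw [inner_smul_right, inner_smul_right, real_inner_comm]
  have m1 : MemLp (fun x => inner ℝ (∇ φ x) a) 2 volume := (hφ.memLp_gradient 2).inner_const a
  have m2 : MemLp (fun x => φ x • a) 2 volume := by
    refine ((hφ.memLp 2).norm.mul_const ‖a‖).mono
      ((hφ.memLp 2).1.smul aestronglyMeasurable_const) (Eventually.of_forall fun x => ?_)
    simp [norm_smul]
  rw [e1 _ hu.memLp_lim, e2 _ hg.memLp_lim]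
  refine tendsto_nhds_unique (hu.tendsto _ m1) ((hg.tendsto _ m2).neg.congr fun n => ?_)
  rw [← e1 _ (H n).memLp, ← e2 _ (H n).memLp_grad, (H n).integral_eq φ hφ]

/-- Local compactness: a sequence bounded in `H¹` which tends weakly to zero tends to zero
strongly in `L²` on balls. -/
theorem tendsto_eLpNorm_restrict_ball {z : ℕ → R3 → ℝ} {G : ℕ → R3 → R3}
    (H : ∀ n, H1Pair (z n) (G n)) (hz : WeakL2 z (fun _ => 0)) {C : ENNReal} (hC : C ≠ ⊤)
    (hb : ∀ n, eLpNorm (z n) 2 volume ≤ C) (hg : ∀ n, eLpNorm (G n) 2 volume ≤ C) (R : ℝ) :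
    Tendsto (fun n => eLpNorm (z n) 2 (volume.restrict (Metric.closedBall 0 R))) atTop (𝓝 0) := by
  rw [ENNReal.tendsto_nhds_zero]
  intro ε hε
  have hlim : Tendsto (fun δ : ℝ => ENNReal.ofReal δ * C) (𝓝[>] 0) (𝓝 0) := by
    have h1 : Tendsto (fun δ : ℝ => ENNReal.ofReal δ) (𝓝[>] 0) (𝓝 0) := by
      have := (ENNReal.continuous_ofReal.tendsto 0).mono_left (nhdsWithin_le_nhds (s := Set.Ioi 0))
      simpa using this
    simpa using ENNReal.Tendsto.mul_const h1 (Or.inr hC)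
  -- The gradient bound makes translates by at most `δ` differ from `z n` by at most `δ C` in `L²`,
  -- so one kernel scale has mollification error at most `ε / 2` for all `n`.
  obtain ⟨δ, hδ, hδ0⟩ := ((ENNReal.tendsto_nhds_zero.1 hlim (ε / 2)
    (ENNReal.half_pos hε.ne')).and self_mem_nhdsWithin).exists
  obtain ⟨η, hη⟩ := exists_isKernel (Set.mem_Ioi.1 hδ0)
  have hmol : ∀ n, eLpNorm (fun x => mollify η (z n) x - z n x) 2 volume ≤ ε / 2 := by
    intro n
    refine (eLpNorm_mollify_sub_le hη (H n).memLp fun t ht => ?_).trans hδ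
    refine ((H n).eLpNorm_translate_sub_le t).trans ?_
    rw [← ofReal_norm]
    gcongr
    exact hg n
  have hcont : ∀ n, Continuous (mollify η (z n)) := fun n =>
    (contDiff_mollify hη.test (H n).memLp).continuous
  have heq : ∀ n x, mollify η (z n) x = ∫ t, inner ℝ (z n t) (η (x - t)) := fun n x => by
    simp [mollify]
  have hbound : ∀ n x, ‖mollify η (z n) x‖ₑ ≤ C * eLpNorm η 2 volume := by
    intro n x
    rw [heq]
    have h2 := memLp_comp_sub_left (hη.test.memLp 2) x
    refine (norm_integral_inner_le (H n).memLp h2).trans ?_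
    have e : eLpNorm (fun t => η (x - t)) 2 volume = eLpNorm η 2 volume :=
      eLpNorm_comp_measurePreserving (hη.test.memLp 2).1
        (Measure.measurePreserving_sub_left volume x)
    rw [e]
    gcongr
    exact hb n
  -- At a fixed point the mollification is a pairing with a fixed `L²` function, so weak convergence
  -- becomes pointwise convergence; the uniform bound `hbound` then allows dominated convergence on
  -- the ball.
  have hpt : ∀ x, Tendsto (fun n => mollify η (z n) x) atTop (𝓝 0) := by
    intro x
    have := hz.tendsto _ (memLp_comp_sub_left (hη.test.memLp 2) x)
    simpa only [heq, inner_zero_left, integral_zero] using this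
  have hball : Tendsto (fun n => ∫⁻ x in Metric.closedBall (0 : R3) R, ‖mollify η (z n) x‖ₑ ^ 2)
      atTop (𝓝 0) := by
    have := tendsto_lintegral_of_dominated_convergence (f := fun _ => 0)
      (μ := (volume : Measure R3).restrict (Metric.closedBall 0 R))
      (F := fun n x => ‖mollify η (z n) x‖ₑ ^ 2) (fun _ => (C * eLpNorm η 2 volume) ^ 2)
      (fun n => ((hcont n).enorm.measurable.pow_const 2))
      (fun n => Eventually.of_forall fun x => by
        have := hbound n x
        simp only
        gcongr)
      (by
        rw [lintegral_const]
        refine ENNReal.mul_ne_top (ENNReal.pow_ne_top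
          (ENNReal.mul_ne_top hC (hη.test.memLp 2).eLpNorm_ne_top)) ?_
        simpa using (isCompact_closedBall (0 : R3) R).measure_ne_top (μ := volume))
      (Eventually.of_forall fun x => by
        simpa [Function.comp_def] using ((ENNReal.continuous_pow 2).tendsto _).comp (hpt x).enorm)
    simpa using this
  have hε2 : 0 < (ε / 2) ^ 2 := by
    have := ENNReal.half_pos hε.ne'
    positivity
  filter_upwards [ENNReal.tendsto_nhds_zero.1 hball _ hε2] with n hn
  rw [← eLpNorm_two_le_iff] at hn
  have hm := (hcont n).aestronglyMeasurable (μ := volume)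
  calc eLpNorm (z n) 2 (volume.restrict (Metric.closedBall 0 R))
      = eLpNorm (mollify η (z n) - fun x => mollify η (z n) x - z n x) 2
          (volume.restrict (Metric.closedBall 0 R)) := by congr 1; ext x; simp
    _ ≤ _ := eLpNorm_sub_le hm.restrict (hm.sub (H n).memLp.1).restrict (by norm_num)
    _ ≤ ε / 2 + ε / 2 :=
        add_le_add hn ((eLpNorm_mono_measure _ Measure.restrict_le_self).trans (hmol n))
    _ = ε := ENNReal.add_halves ε

/-! ### Vanishing sequences -/

/-- Cauchy-Schwarz applied to `|u| · |u|³`. -/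
theorem lintegral_enorm_pow_four_le {u : R3 → ℝ} (hu : AEStronglyMeasurable u volume) :
    ∫⁻ x, ‖u x‖ₑ ^ 4 ≤ eLpNorm u 2 volume * eLpNorm u 6 volume ^ 3 := by
  have h := ENNReal.lintegral_mul_le_Lp_mul_Lq volume Real.HolderConjugate.two_two hu.enorm
    (hu.enorm.pow_const 3)
  have e6 := eLpNorm_nnreal_pow_eq_lintegral (μ := volume) (f := u) (p := 6) (by norm_num)
  have e2 := eLpNorm_nnreal_pow_eq_lintegral (μ := volume) (f := u) (p := 2) (by norm_num)
  have e3 : ∫⁻ x, (‖u x‖ₑ ^ 3) ^ (2 : ℝ) = eLpNorm u 6 volume ^ (6 : ℝ) := by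
    have : ((6 : NNReal) : ℝ) = 6 := by norm_num
    rw [this] at e6
    have : ((6 : NNReal) : ENNReal) = 6 := by norm_num
    rw [this] at e6
    rw [e6]
    congr 1 with x
    rw [← ENNReal.rpow_natCast, ← ENNReal.rpow_mul]
    norm_num
  have e2' : ∫⁻ x, ‖u x‖ₑ ^ (2 : ℝ) = eLpNorm u 2 volume ^ (2 : ℝ) := by
    simpa using e2.symm
  rw [e3, e2', ← ENNReal.rpow_mul, ← ENNReal.rpow_mul] at h
  calc ∫⁻ x, ‖u x‖ₑ ^ 4 = ∫⁻ x, ((fun x => ‖u x‖ₑ) * fun x => ‖u x‖ₑ ^ 3) x := by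
        congr 1 with x
        simp only [Pi.mul_apply]; ring
    _ ≤ _ := h
    _ = _ := by
      rw [← ENNReal.rpow_natCast _ 3]
      norm_num

theorem norm_add_sq_le_two {X : Type*} [NormedAddCommGroup X] (a b : X) :
    ‖a + b‖ₑ ^ 2 ≤ 2 * (‖a‖ₑ ^ 2 + ‖b‖ₑ ^ 2) := by
  have h : ‖a + b‖ ^ 2 ≤ 2 * (‖a‖ ^ 2 + ‖b‖ ^ 2) := by
    have := norm_add_le a b
    nlinarith [norm_nonneg (a + b), norm_nonneg a, norm_nonneg b, sq_nonneg (‖a‖ - ‖b‖)]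
  have h' := ENNReal.ofReal_le_ofReal h
  rw [ENNReal.ofReal_mul (by norm_num), ENNReal.ofReal_add (by positivity) (by positivity),
    ENNReal.ofReal_pow (norm_nonneg _), ENNReal.ofReal_pow (norm_nonneg _),
    ENNReal.ofReal_pow (norm_nonneg _), ofReal_norm, ofReal_norm, ofReal_norm] at h'
  simpa using h'

theorem lintegral_lintegral_translate_mul {a b : R3 → ENNReal} (ha : Measurable a)
    (hb : AEMeasurable b volume) :
    ∫⁻ y, ∫⁻ x, a (x + -y) * b x = (∫⁻ x, a x) * ∫⁻ x, b x := by
  rw [lintegral_lintegral_swap]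
  · have : ∀ x, ∫⁻ y, a (x + -y) * b x = (∫⁻ y, a y) * b x := by
      intro x
      rw [lintegral_mul_const _ (by fun_prop)]
      congr 1
      simpa [sub_eq_add_neg] using lintegral_sub_left_eq_self a x
    simp only [this]
    exact lintegral_const_mul'' _ hb
  · exact ((ha.comp (measurable_snd.add measurable_fst.neg)).aemeasurable).mul hb.comp_snd

/-- Lions' vanishing lemma, with an average over all translates of a cutoff in place of a covering
by balls. For the localization at `y`, the fourth power integral is at most its `L²` norm, bounded
by `θ`, times the cube of its gradient norm, up to the Sobolev constant. One gradient factor is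
bounded uniformly in `y`; the square of the other is integrable in `y` by Tonelli. -/
theorem exists_vanishing_const : ∃ R : ℝ, 0 < R ∧ ∀ C : ENNReal, C ≠ ⊤ → ∃ K : ENNReal, K ≠ ⊤ ∧
    ∀ (u : R3 → ℝ) (g : R3 → R3), H1Pair u g → eLpNorm u 2 volume ≤ C → eLpNorm g 2 volume ≤ C →
    ∀ θ : ENNReal, θ ≠ ⊤ → (∀ y, eLpNorm u 2 (volume.restrict (Metric.closedBall y R)) ≤ θ) →
      ∫⁻ x, ‖u x‖ₑ ^ 4 ≤ K * θ := by
  obtain ⟨S, hS, hSob⟩ := exists_sobolev_const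
  obtain ⟨D, hD0, hcut⟩ := exists_cutoff
  obtain ⟨χ, hχ, hχ0, hχ1, hχe, hχD⟩ := hcut 0
  obtain ⟨R, hR, hχR⟩ := hχ.exists_ball
  have hχc : Continuous χ := hχ.continuous
  have hgc : Continuous (∇ χ) := continuous_gradient hχ.contDiff_one
  let c := ∫⁻ x, ‖χ x‖ₑ ^ 4
  let A := ∫⁻ x, ‖χ x‖ₑ ^ 2
  let B := ∫⁻ x, ‖∇ χ x‖ₑ ^ 2
  have hA : A ≠ ⊤ := by
    simp only [A]; rw [← eLpNorm_two_sq]; exact ENNReal.pow_ne_top (hχ.memLp 2).eLpNorm_ne_top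
  have hB : B ≠ ⊤ := by
    simp only [B]; rw [← eLpNorm_two_sq]
    exact ENNReal.pow_ne_top (hχ.memLp_gradient 2).eLpNorm_ne_top
  have hctop : c ≠ ⊤ := by
    refine ne_top_of_le_ne_top hA (lintegral_mono fun x => ?_)
    refine pow_le_pow_of_le_one zero_le ?_ (by norm_num)
    rw [Real.enorm_of_nonneg (hχ0 x)]
    simpa using hχ1 x
  -- The cutoff equals one on the unit ball, so the averaging constant can be divided out at the
  -- end.
  have hc0 : c ≠ 0 := by
    intro h0
    have h1 := (lintegral_eq_zero_iff (by fun_prop)).1 h0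
    have h2 : volume (Metric.ball (0 : R3) 1) = 0 := by
      refine measure_mono_null (fun x hx => ?_) (ae_iff.1 h1)
      have : χ x = 1 := hχe x (by simpa using hx)
      simp [this]
    exact (Metric.measure_ball_pos volume (0 : R3) one_pos).ne' h2
  refine ⟨R, hR, fun C hC => ?_⟩
  let K₁ : ENNReal := C + ENNReal.ofReal D * C
  let K : ENNReal := c⁻¹ * (S ^ 3 * K₁ * (2 * (A * C ^ 2 + B * C ^ 2)))
  have hK₁ : K₁ ≠ ⊤ := by finiteness
  have hK : K ≠ ⊤ := by
    have := ENNReal.inv_ne_top.2 hc0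
    simp only [K]; finiteness
  refine ⟨K, hK, fun u g H hu hg θ hθt hθ => ?_⟩
  have hχt : ∀ y, IsTestFunction fun x => χ (x + -y) := fun y => hχ.comp_add_right _
  have hp : ∀ y, H1Pair (fun x => χ (x + -y) * u x)
      (fun x => χ (x + -y) • g x + u x • ∇ χ (x + -y)) := fun y => by
    simpa only [gradient_comp_add_right] using H.test_mul (hχt y)
  let Gy : R3 → ENNReal := fun y =>
    eLpNorm (fun x => χ (x + -y) • g x + u x • ∇ χ (x + -y)) 2 volume
  have hG1 : ∀ y, Gy y ≤ K₁ := by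
    intro y
    refine (eLpNorm_add_le ((hχt y).continuous.aestronglyMeasurable.smul H.memLp_grad.1)
      (H.memLp.1.smul (hgc.comp (continuous_id.add_const _)).aestronglyMeasurable)
      (by norm_num)).trans (add_le_add ?_ ?_)
    · refine (eLpNorm_mono fun x => ?_).trans hg
      change ‖χ (x + -y) • g x‖ ≤ _
      rw [norm_smul, Real.norm_of_nonneg (hχ0 _)]
      exact mul_le_of_le_one_left (norm_nonneg _) (hχ1 _)
    · refine (eLpNorm_le_mul_eLpNorm_of_ae_le_mul (c := D) (g := u)
        (Eventually.of_forall fun x => ?_) 2).trans (by gcongr)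
      change ‖u x • ∇ χ (x + -y)‖ ≤ _
      rw [norm_smul, mul_comm]
      exact mul_le_mul_of_nonneg_right (hχD _) (norm_nonneg _)
  have hG2 : ∫⁻ y, Gy y ^ 2 ≤ 2 * (A * C ^ 2 + B * C ^ 2) := by
    have hpt : ∀ y, Gy y ^ 2 ≤ ∫⁻ x, (2 * (‖χ (x + -y)‖ₑ ^ 2 * ‖g x‖ₑ ^ 2)
        + 2 * (‖∇ χ (x + -y)‖ₑ ^ 2 * ‖u x‖ₑ ^ 2)) := by
      intro y
      simp only [Gy]
      rw [eLpNorm_two_sq]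
      refine lintegral_mono fun x => (norm_add_sq_le_two _ _).trans (le_of_eq ?_)
      rw [enorm_smul, enorm_smul]
      ring
    have hm1 := (hχc.enorm.measurable.pow_const 2)
    have hm2 := (hgc.enorm.measurable.pow_const 2)
    have hmg := H.memLp_grad.1.enorm.pow_const 2
    have hmu := H.memLp.1.enorm.pow_const 2
    have hma : ∀ y, AEMeasurable (fun x => 2 * (‖χ (x + -y)‖ₑ ^ 2 * ‖g x‖ₑ ^ 2)) volume :=
      fun y => ((hm1.comp (measurable_id.add_const (-y))).aemeasurable.mul hmg).const_mul 2
    have hma' : AEMeasurable (fun y => ∫⁻ x, ‖χ (x + -y)‖ₑ ^ 2 * ‖g x‖ₑ ^ 2) volume :=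
      AEMeasurable.lintegral_prod_right' (f := fun z : R3 × R3 => ‖χ (z.2 + -z.1)‖ₑ ^ 2
        * ‖g z.2‖ₑ ^ 2) (((hm1.comp (measurable_snd.add measurable_fst.neg)).aemeasurable).mul
          hmg.comp_snd)
    calc ∫⁻ y, Gy y ^ 2 ≤ ∫⁻ y, (2 * (∫⁻ x, ‖χ (x + -y)‖ₑ ^ 2 * ‖g x‖ₑ ^ 2)
          + 2 * ∫⁻ x, ‖∇ χ (x + -y)‖ₑ ^ 2 * ‖u x‖ₑ ^ 2) := by
          refine lintegral_mono fun y => (hpt y).trans (le_of_eq ?_)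
          rw [lintegral_add_left' (hma y), lintegral_const_mul' _ _ (by norm_num),
            lintegral_const_mul' _ _ (by norm_num)]
      _ = 2 * (A * eLpNorm g 2 volume ^ 2 + B * eLpNorm u 2 volume ^ 2) := by
          rw [lintegral_add_left' (hma'.const_mul 2), lintegral_const_mul' _ _ (by norm_num),
            lintegral_const_mul' _ _ (by norm_num),
            lintegral_lintegral_translate_mul (a := fun x => ‖χ x‖ₑ ^ 2) hm1 hmg,
            lintegral_lintegral_translate_mul (a := fun x => ‖∇ χ x‖ₑ ^ 2) hm2 hmu,
            eLpNorm_two_sq, eLpNorm_two_sq, mul_add]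
      _ ≤ _ := by gcongr
  have h4 : ∀ y, ∫⁻ x, ‖χ (x + -y)‖ₑ ^ 4 * ‖u x‖ₑ ^ 4 ≤ θ * (S ^ 3 * K₁ * Gy y ^ 2) := by
    intro y
    have h1 := lintegral_enorm_pow_four_le (hp y).memLp.1
    have h2 := hSob _ _ (hp y)
    have h3 : eLpNorm (fun x => χ (x + -y) * u x) 2 volume ≤ θ := by
      refine le_trans ?_ (hθ y)
      rw [← eLpNorm_indicator_eq_eLpNorm_restrict Metric.isClosed_closedBall.measurableSet]
      refine eLpNorm_mono fun x => ?_
      by_cases hx : x ∈ Metric.closedBall y R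
      · rw [Set.indicator_of_mem hx, norm_mul, Real.norm_of_nonneg (hχ0 _)]
        exact mul_le_of_le_one_left (norm_nonneg _) (hχ1 _)
      · have : χ (x + -y) = 0 := hχR _ (by
          simpa [dist_eq_norm, sub_eq_add_neg] using hx)
        simp [this]
    calc ∫⁻ x, ‖χ (x + -y)‖ₑ ^ 4 * ‖u x‖ₑ ^ 4 = ∫⁻ x, ‖χ (x + -y) * u x‖ₑ ^ 4 := by
          simp only [enorm_mul, mul_pow]
      _ ≤ _ := h1
      _ ≤ θ * (S * Gy y) ^ 3 := by gcongr
      -- The cube is split as `1 + 2`: the single factor is bounded by `K₁`, and the square is kept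
      -- for the integration in `y`.
      _ = θ * (S ^ 3 * Gy y * Gy y ^ 2) := by ring
      _ ≤ _ := by gcongr; exact hG1 y
  have hmu4 := H.memLp.1.enorm.pow_const 4
  have hfin : c * ∫⁻ x, ‖u x‖ₑ ^ 4 ≤ θ * (S ^ 3 * K₁ * (2 * (A * C ^ 2 + B * C ^ 2))) := by
    rw [← lintegral_lintegral_translate_mul (a := fun x => ‖χ x‖ₑ ^ 4)
      (hχc.enorm.measurable.pow_const 4) hmu4]
    calc _ ≤ ∫⁻ y, θ * (S ^ 3 * K₁ * Gy y ^ 2) := lintegral_mono h4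
      _ = θ * (S ^ 3 * K₁ * ∫⁻ y, Gy y ^ 2) := by
        rw [lintegral_const_mul' _ _ hθt, lintegral_const_mul' _ _ (by finiteness)]
      _ ≤ _ := by gcongr
  calc ∫⁻ x, ‖u x‖ₑ ^ 4 = c⁻¹ * (c * ∫⁻ x, ‖u x‖ₑ ^ 4) := by
        rw [← mul_assoc, ENNReal.inv_mul_cancel hc0 hctop, one_mul]
    _ ≤ c⁻¹ * (θ * (S ^ 3 * K₁ * (2 * (A * C ^ 2 + B * C ^ 2)))) := by gcongr
    _ = K * θ := by simp only [K]; ring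

/-! ### Integral estimates for functions in `H¹` -/

namespace H1Pair

variable {u v : R3 → ℝ} {g h : R3 → R3}

theorem memLp_six (H : H1Pair u g) : MemLp u 6 volume := by
  obtain ⟨S, hS, hSob⟩ := exists_sobolev_const
  exact ⟨H.memLp.1, (hSob u g H).trans_lt
    (ENNReal.mul_lt_top hS.lt_top H.memLp_grad.eLpNorm_lt_top)⟩

theorem integrable_sq (H : H1Pair u g) : Integrable (fun x => u x ^ 2) := H.memLp.integrable_sq'

theorem integrable_pow_six (H : H1Pair u g) : Integrable (fun x => u x ^ 6) := by
  have := H.memLp_six.integrable_norm_pow (by norm_num)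
  refine this.congr (Eventually.of_forall fun x => ?_)
  simp only [Real.norm_eq_abs]
  exact Even.pow_abs (by decide) _

theorem integrable_grad_sq (H : H1Pair u g) : Integrable (fun x => ‖g x‖ ^ 2) :=
  H.memLp_grad.integrable_normsq

end H1Pair

theorem pow_four_le (s : ℝ) : s ^ 4 ≤ s ^ 2 + s ^ 6 := by
  nlinarith [sq_nonneg (s * (s ^ 2 - 1)), sq_nonneg s, sq_nonneg (s ^ 3), sq_nonneg (s ^ 2)]

/-- Young's inequality with an arbitrarily small coefficient on the first term, by comparing `|t|`
with `δ |s|`. -/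
theorem abs_pow_mul_abs_le (k : ℕ) {δ : ℝ} (hδ : 0 < δ) (s t : ℝ) :
    |s| ^ k * |t| ≤ δ * |s| ^ (k + 1) + (δ ^ k)⁻¹ * |t| ^ (k + 1) := by
  have hs := abs_nonneg s
  have ht := abs_nonneg t
  rcases le_total |t| (δ * |s|) with h | h
  · have h1 : |s| ^ k * |t| ≤ |s| ^ k * (δ * |s|) := by gcongr
    have h2 : 0 ≤ (δ ^ k)⁻¹ * |t| ^ (k + 1) := by positivity
    calc _ ≤ |s| ^ k * (δ * |s|) := h1
      _ = δ * |s| ^ (k + 1) := by ring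
      _ ≤ _ := by linarith
  · have h1 : (δ * |s|) ^ k * |t| ≤ |t| ^ k * |t| := by gcongr
    have h2 : 0 ≤ δ * |s| ^ (k + 1) := by positivity
    have h3 : |s| ^ k * |t| = (δ ^ k)⁻¹ * ((δ * |s|) ^ k * |t|) := by
      rw [mul_pow]; field_simp
    calc _ = (δ ^ k)⁻¹ * ((δ * |s|) ^ k * |t|) := h3
      _ ≤ (δ ^ k)⁻¹ * (|t| ^ k * |t|) := by gcongr
      _ = (δ ^ k)⁻¹ * |t| ^ (k + 1) := by ring
      _ ≤ _ := by linarith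

theorem abs_mul_abs_le_sq (s t : ℝ) : |s| * |t| ≤ s ^ 2 + t ^ 2 := by
  nlinarith [sq_abs s, sq_abs t, sq_nonneg (|s| - |t|), sq_nonneg s, sq_nonneg t]

theorem abs_pow_five_mul_abs_le (s t : ℝ) : |s| ^ 5 * |t| ≤ s ^ 6 + t ^ 6 := by
  have h := abs_pow_mul_abs_le 5 one_pos s t
  have e1 : |s| ^ 6 = s ^ 6 := Even.pow_abs (by decide) _
  have e2 : |t| ^ 6 = t ^ 6 := Even.pow_abs (by decide) _
  norm_num [e1, e2] at h
  exact h

theorem H1Pair.integrable_pow_four {u : R3 → ℝ} {g : R3 → R3} (H : H1Pair u g) :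
    Integrable (fun x => u x ^ 4) := by
  refine (H.integrable_sq.add H.integrable_pow_six).mono' (H.memLp.1.pow 4)
    (Eventually.of_forall fun x => ?_)
  rw [Real.norm_of_nonneg (by positivity)]
  exact pow_four_le _

theorem integral_pow_eq_lintegral {u : R3 → ℝ} (hu : AEStronglyMeasurable u volume) {k : ℕ}
    (hk : Even k) : ∫ x, u x ^ k = (∫⁻ x, ‖u x‖ₑ ^ k).toReal := by
  rw [integral_eq_lintegral_of_nonneg_ae (Eventually.of_forall fun x => hk.pow_nonneg _)
    (hu.pow k)]
  congr 2 with x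
  rw [← hk.pow_abs, ENNReal.ofReal_pow (abs_nonneg _), ← Real.enorm_eq_ofReal_abs]

theorem exists_integral_pow_six_le : ∃ S : ℝ, 0 < S ∧ ∀ (u : R3 → ℝ) (g : R3 → R3), H1Pair u g →
    ∫ x, u x ^ 6 ≤ S * (∫ x, ‖g x‖ ^ 2) ^ 3 := by
  obtain ⟨S, hS, hSob⟩ := exists_sobolev_const
  refine ⟨(S ^ 6).toReal + 1, by positivity, fun u g H => ?_⟩
  have h1 := hSob u g H
  have e6 := eLpNorm_nnreal_pow_eq_lintegral (μ := volume) (f := u) (p := 6) (by norm_num)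
  have e6' : eLpNorm u 6 volume ^ 6 = ∫⁻ x, ‖u x‖ₑ ^ 6 := by
    have h6 : ((6 : NNReal) : ℝ) = (6 : ℕ) := by norm_num
    simp only [h6, ENNReal.rpow_natCast] at e6
    exact_mod_cast e6
  have h2 : ∫⁻ x, ‖u x‖ₑ ^ 6 ≤ S ^ 6 * ENNReal.ofReal (∫ x, ‖g x‖ ^ 2) ^ 3 := by
    rw [← e6', ← eLpNorm_two_sq_eq_ofReal H.memLp_grad]
    calc _ ≤ (S * eLpNorm g 2 volume) ^ 6 := by gcongr
      _ = _ := by ring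
  have h0 : 0 ≤ ∫ x, ‖g x‖ ^ 2 := integral_nonneg fun x => by positivity
  rw [integral_pow_eq_lintegral H.memLp.1 (by decide)]
  have h3 := ENNReal.toReal_mono (by finiteness) h2
  rw [ENNReal.toReal_mul, ENNReal.toReal_pow (ENNReal.ofReal _), ENNReal.toReal_ofReal h0] at h3
  refine h3.trans ?_
  gcongr
  linarith

/-! ### Growth of the nonlinearity -/

theorem mul_le_of_cubic_bound {ε C s : ℝ} {y : ℝ} (_hC : 0 ≤ C) (h : y ≤ ε * (|s| + |s| ^ 5)) :
    y ≤ ε * (|s| + |s| ^ 5) + C * |s| ^ 3 :=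
  h.trans (le_add_of_nonneg_right (by positivity))

namespace NonlinearityHyp

variable {f : ℝ → ℝ} {p μ : ℝ}

theorem map_zero (hf : NonlinearityHyp f p μ) : f 0 = 0 := by
  have h1 : Tendsto (fun u : ℝ => f u / u * u) (𝓝[≠] 0) (𝓝 (0 * 0)) :=
    hf.small_at_zero.mul (tendsto_id.mono_left nhdsWithin_le_nhds)
  have h2 : Tendsto f (𝓝[≠] 0) (𝓝 (f 0)) := (hf.continuous.tendsto 0).mono_left nhdsWithin_le_nhds
  rw [mul_zero] at h1
  refine tendsto_nhds_unique h2 (h1.congr' ?_)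
  filter_upwards [self_mem_nhdsWithin] with u hu
  exact div_mul_cancel₀ _ hu

/-- Three ranges of `s`: near zero (f₁) gives `ε|s|`, near infinity `p < 6` gives `ε|s|⁵`, and on
the compact range between, where `|s| ≥ δ`, boundedness of `f` is absorbed by the cubic term. -/
theorem exists_cubic_bound (hf : NonlinearityHyp f p μ) {ε : ℝ} (hε : 0 < ε) :
    ∃ C, 0 ≤ C ∧ ∀ s, |f s| ≤ ε * (|s| + |s| ^ 5) + C * |s| ^ 3 := by
  have hsmall : ∀ᶠ s in 𝓝[≠] (0 : ℝ), |f s / s| < ε := by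
    have := hf.small_at_zero.abs
    rw [abs_zero] at this
    exact this.eventually (gt_mem_nhds hε)
  rw [eventually_nhdsWithin_iff] at hsmall
  obtain ⟨δ, hδ, hδs⟩ := Metric.eventually_nhds_iff.1 hsmall
  obtain ⟨K, hK⟩ := hf.growth
  rw [eventually_map] at hK
  -- This factor is what remains of `|K| |s|^(p-1)` after dividing by `|s|⁵`.
  have hlim : Tendsto (fun s : ℝ => |K| * |s| ^ (-(6 - p))) (cocompact ℝ) (𝓝 0) := by
    have := ((tendsto_rpow_neg_atTop (sub_pos.2 hf.p_lt_six)).comp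
      (tendsto_norm_cocompact_atTop (E := ℝ))).const_mul |K|
    simpa [Function.comp_def] using this
  have hlarge := hK.and ((hlim.eventually (gt_mem_nhds hε)).and
    ((tendsto_norm_cocompact_atTop (E := ℝ)).eventually_ge_atTop 1))
  obtain ⟨T, hT, hTs⟩ := (Metric.hasBasis_cobounded_compl_closedBall (0 : ℝ)).eventually_iff.1
    (Metric.cobounded_eq_cocompact (α := ℝ) ▸ hlarge)
  obtain ⟨N, hN⟩ := (isCompact_closedBall (0 : ℝ) T).exists_bound_of_continuousOn
    hf.continuous.continuousOn
  have hC : 0 ≤ |N| / δ ^ 3 := by positivity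
  refine ⟨|N| / δ ^ 3, hC, fun s => ?_⟩
  by_cases h0 : |s| < δ
  · refine mul_le_of_cubic_bound hC ?_
    rcases eq_or_ne s 0 with rfl | hs
    · simp [hf.map_zero]
    · have := hδs (by simpa using h0) hs
      rw [abs_div, div_lt_iff₀ (abs_pos.2 hs)] at this
      have h5 : 0 ≤ ε * |s| ^ 5 := by positivity
      linarith
  · by_cases h1 : s ∈ Metric.closedBall (0 : ℝ) T
    · have h2 : |f s| ≤ |N| := (hN s h1).trans (le_abs_self _)
      have h3 : δ ^ 3 ≤ |s| ^ 3 := by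
        have := not_lt.1 h0
        gcongr
      have h4 : |N| ≤ |N| / δ ^ 3 * |s| ^ 3 := by
        rw [div_mul_eq_mul_div, le_div_iff₀ (by positivity)]
        gcongr
      have h5 : 0 ≤ ε * (|s| + |s| ^ 5) := by positivity
      linarith
    · refine mul_le_of_cubic_bound hC ?_
      obtain ⟨h2, h3, h4⟩ := hTs h1
      simp only [Real.norm_eq_abs] at h4
      have hs : 0 < |s| := by linarith
      rw [div_le_iff₀ (by positivity)] at h2
      have h5 : |s| ^ (p - 1) = |s| ^ (-(6 - p)) * |s| ^ 5 := by
        rw [← Real.rpow_natCast, ← Real.rpow_add hs]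
        norm_num
        congr 1; ring
      calc |f s| ≤ K * |s| ^ (p - 1) := h2
        _ ≤ |K| * |s| ^ (p - 1) := by gcongr; exact le_abs_self K
        _ = |K| * |s| ^ (-(6 - p)) * |s| ^ 5 := by rw [h5]; ring
        _ ≤ ε * |s| ^ 5 := by gcongr
        _ ≤ ε * (|s| + |s| ^ 5) := by nlinarith

theorem exists_bound (hf : NonlinearityHyp f p μ) {ε : ℝ} (hε : 0 < ε) :
    ∃ C, 0 ≤ C ∧ ∀ s, |f s| ≤ ε * |s| + C * |s| ^ 5 := by
  obtain ⟨C, hC, h⟩ := hf.exists_cubic_bound (half_pos hε)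
  -- This choice gives `C δ ≤ ε / 2`, so the linear part of the interpolated cubic term fits into
  -- the remaining half of `ε`; the `+ 1` covers `C = 0`.
  have hδ : 0 < ε / (2 * (C + 1)) := by positivity
  refine ⟨ε / 2 + C / (ε / (2 * (C + 1))), by positivity, fun s => (h s).trans ?_⟩
  set δ := ε / (2 * (C + 1)) with hδd
  have h1 : |s| ^ 3 ≤ δ * |s| + δ⁻¹ * |s| ^ 5 := by
    have h2 : 0 ≤ |s| * (δ - |s| ^ 2) ^ 2 := by positivity
    have h3 : |s| ^ 3 = δ⁻¹ * (δ * |s| ^ 3) := by field_simp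
    have h4 : δ * |s| + δ⁻¹ * |s| ^ 5 = δ⁻¹ * (δ ^ 2 * |s| + |s| ^ 5) := by field_simp
    rw [h3, h4]
    gcongr
    have h6 : 0 ≤ |s| * (δ ^ 2 + |s| ^ 4) := by positivity
    nlinarith
  have h5 : C * δ ≤ ε / 2 := by
    rw [hδd, mul_div_assoc', div_le_div_iff₀ (by positivity) (by norm_num)]
    nlinarith
  have hs := abs_nonneg s
  calc ε / 2 * (|s| + |s| ^ 5) + C * |s| ^ 3
      ≤ ε / 2 * (|s| + |s| ^ 5) + C * (δ * |s| + δ⁻¹ * |s| ^ 5) := by gcongr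
    _ = (ε / 2 + C * δ) * |s| + (ε / 2 + C / δ) * |s| ^ 5 := by rw [div_eq_mul_inv C]; ring
    _ ≤ (ε / 2 + ε / 2) * |s| + (ε / 2 + C / δ) * |s| ^ 5 := by gcongr
    _ = _ := by ring

/-- The exponent 4 lies strictly between 2 and 6, so the only term with an uncontrolled constant is
`t⁴`. With `t` the remainder this reduces the nonlinear term to the `L⁴` convergence given by
vanishing. -/
theorem exists_mul_bound (hf : NonlinearityHyp f p μ) {τ : ℝ} (hτ : 0 < τ) :
    ∃ C, 0 ≤ C ∧ ∀ s t, |f s * t| ≤ τ * (s ^ 2 + s ^ 6 + t ^ 2 + t ^ 6) + C * t ^ 4 := by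
  obtain ⟨C, hC, h⟩ := hf.exists_cubic_bound (half_pos hτ)
  set δ := τ / (2 * (C + 1)) with hδd
  have hδ : 0 < δ := by positivity
  refine ⟨C * (δ ^ 3)⁻¹, by positivity, fun s t => ?_⟩
  have h5 : C * δ ≤ τ / 2 := by
    rw [hδd, mul_div_assoc', div_le_div_iff₀ (by positivity) (by norm_num)]
    nlinarith
  have e1 : |s| ^ 4 = s ^ 4 := Even.pow_abs (by decide) _
  have e2 : |t| ^ 4 = t ^ 4 := Even.pow_abs (by decide) _
  have h1 := abs_pow_mul_abs_le 3 hδ s t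
  norm_num only [e1, e2] at h1
  have h2 := abs_mul_abs_le_sq s t
  have h3 := abs_pow_five_mul_abs_le s t
  have h4 := pow_four_le s
  rw [abs_mul]
  calc |f s| * |t| ≤ (τ / 2 * (|s| + |s| ^ 5) + C * |s| ^ 3) * |t| := by gcongr; exact h s
    _ = τ / 2 * (|s| * |t| + |s| ^ 5 * |t|) + C * (|s| ^ 3 * |t|) := by ring
    _ ≤ τ / 2 * ((s ^ 2 + t ^ 2) + (s ^ 6 + t ^ 6)) + C * (δ * s ^ 4 + (δ ^ 3)⁻¹ * t ^ 4) := by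
        gcongr
    _ = τ / 2 * ((s ^ 2 + t ^ 2) + (s ^ 6 + t ^ 6)) + C * δ * s ^ 4 + C * (δ ^ 3)⁻¹ * t ^ 4 := by
        ring
    _ ≤ τ / 2 * ((s ^ 2 + t ^ 2) + (s ^ 6 + t ^ 6)) + τ / 2 * (s ^ 2 + s ^ 6)
          + C * (δ ^ 3)⁻¹ * t ^ 4 := by
        have : C * δ * s ^ 4 ≤ τ / 2 * (s ^ 2 + s ^ 6) := by gcongr
        linarith
    _ ≤ _ := by nlinarith [sq_nonneg t, sq_nonneg (t ^ 3)]

/-- Makes `C + δ s⁶ - |f s|` nonnegative, which is what Fatou's lemma needs in the passage to the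
limit. -/
theorem exists_abs_le_const_add (hf : NonlinearityHyp f p μ) {δ : ℝ} (hδ : 0 < δ) :
    ∃ C, 0 ≤ C ∧ ∀ s, |f s| ≤ C + δ * s ^ 6 := by
  obtain ⟨C, hC, h⟩ := hf.exists_mul_bound (τ := δ / 2) (by positivity)
  refine ⟨δ + C + δ / 2, by positivity, fun s => ?_⟩
  have := h s 1
  have h2 : s ^ 2 ≤ 1 + s ^ 6 := by
    nlinarith [sq_nonneg (s ^ 2 - 1), sq_nonneg s, pow_four_le s, sq_nonneg (s ^ 3)]
  simp only [mul_one, one_pow] at this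
  nlinarith

end NonlinearityHyp

theorem abs_rpow_mul_le {r : ℝ} (hr : 4 < r) (hr' : r < 6) (s : ℝ) :
    abs (|s| ^ (r - 2) * s) ≤ |s| + |s| ^ 5 := by
  rcases eq_or_ne s 0 with rfl | hs
  · simp
  have hs' : 0 < |s| := abs_pos.2 hs
  rw [abs_mul, abs_of_nonneg (by positivity)]
  rcases le_total |s| 1 with h | h
  · have h1 : |s| ^ (r - 2) ≤ 1 := Real.rpow_le_one hs'.le h (by linarith)
    have h2 : 0 ≤ |s| ^ 5 := by positivity
    nlinarith
  · have h1 : |s| ^ (r - 2) ≤ |s| ^ (4 : ℝ) := Real.rpow_le_rpow_of_exponent_le h (by linarith)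
    have h2 : |s| ^ (4 : ℝ) = |s| ^ 4 := by exact_mod_cast Real.rpow_natCast |s| 4
    rw [h2] at h1
    nlinarith

/-! ### Weak solutions -/

theorem continuous_weightW {α : ℝ} (hα : 0 < α) : Continuous (weightW α) :=
  continuous_const.add (continuous_norm.rpow_const fun _ => Or.inr hα.le)

theorem weightW_nonneg (α : ℝ) (x : R3) : 0 ≤ weightW α x := by
  unfold weightW; positivity

theorem integrable_bdd_mul_mul {V : R3 → ℝ} (hV : Continuous V) {B : ℝ} (hB : ∀ x, |V x| ≤ B)
    {u v : R3 → ℝ} (hu : MemLp u 2 volume) (hv : MemLp v 2 volume) :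
    Integrable (fun x => V x * u x * v x) := by
  have := (hu.integrable_mul_two hv).bdd_mul (c := B) hV.aestronglyMeasurable
    (Eventually.of_forall hB)
  simpa only [mul_assoc] using this

theorem integrable_weight_mul_mul {q u v : R3 → ℝ} (hq : ∀ x, 0 ≤ q x)
    (hqm : AEStronglyMeasurable q volume) (hu : AEStronglyMeasurable u volume)
    (hv : AEStronglyMeasurable v volume) (hu2 : Integrable fun x => q x * u x ^ 2)
    (hv2 : Integrable fun x => q x * v x ^ 2) : Integrable (fun x => q x * u x * v x) := by
  refine (hu2.add hv2).mono' ((hqm.mul hu).mul hv) (Eventually.of_forall fun x => ?_)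
  rw [Real.norm_eq_abs, mul_assoc, abs_mul, abs_of_nonneg (hq x), abs_mul, Pi.add_apply, ← mul_add]
  exact mul_le_mul_of_nonneg_left (abs_mul_abs_le_sq _ _) (hq x)

theorem NonlinearityHyp.integrable_mul {f : ℝ → ℝ} {p μ : ℝ} (hf : NonlinearityHyp f p μ)
    {u v : R3 → ℝ} {g h : R3 → R3} (Hu : H1Pair u g) (Hv : H1Pair v h) :
    Integrable (fun x => f (u x) * v x) := by
  obtain ⟨C, -, hC⟩ := hf.exists_mul_bound one_pos
  have hi := ((((Hu.integrable_sq.add Hu.integrable_pow_six).add Hv.integrable_sq).add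
    Hv.integrable_pow_six).const_mul 1).add (Hv.integrable_pow_four.const_mul C)
  exact hi.mono' ((hf.continuous.comp_aestronglyMeasurable Hu.memLp.1).mul Hv.memLp.1)
    (Eventually.of_forall fun x => hC _ _)

theorem abs_rpow_mul_mul_le {r : ℝ} (hr : 4 < r) (hr' : r < 6) (s t : ℝ) :
    abs (|s| ^ (r - 2) * s * t) ≤ s ^ 2 + t ^ 2 + (s ^ 6 + t ^ 6) := by
  rw [abs_mul]
  calc _ ≤ (|s| + |s| ^ 5) * |t| := by gcongr; exact abs_rpow_mul_le hr hr' s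
    _ = |s| * |t| + |s| ^ 5 * |t| := by ring
    _ ≤ _ := add_le_add (abs_mul_abs_le_sq s t) (abs_pow_five_mul_abs_le s t)

theorem integrable_rpow_mul_mul {r : ℝ} (hr : 4 < r) (hr' : r < 6)
    {u v : R3 → ℝ} {g h : R3 → R3} (Hu : H1Pair u g) (Hv : H1Pair v h) :
    Integrable (fun x => |u x| ^ (r - 2) * u x * v x) := by
  refine ((Hu.integrable_sq.add Hv.integrable_sq).add
    (Hu.integrable_pow_six.add Hv.integrable_pow_six)).mono' ?_
    (Eventually.of_forall fun x => abs_rpow_mul_mul_le hr hr' _ _)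
  have hc : Continuous fun s : ℝ => |s| ^ (r - 2) :=
    continuous_abs.rpow_const fun _ => Or.inr (by linarith)
  exact ((hc.comp_aestronglyMeasurable Hu.memLp.1).mul Hu.memLp.1).mul Hv.memLp.1

/-- The weak formulation of the modified problem, for a function `u` with weak gradient `g`. -/
structure IsWeakSol (a b : ℝ) (f : ℝ → ℝ) (V : R3 → ℝ) (α r lam : ℝ) (u : R3 → ℝ)
    (g : R3 → R3) : Prop where
  pair : H1Pair u g
  weight : Integrable fun x => lam * weightW α x * u x ^ 2
  eq : ∀ (v : R3 → ℝ) (h : R3 → R3), H1Pair v h →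
    Integrable (fun x => lam * weightW α x * v x ^ 2) →
    (a + b * ∫ x, ‖g x‖ ^ 2) * (∫ x, inner ℝ (g x) (h x)) + (∫ x, V x * u x * v x)
      + (∫ x, lam * weightW α x * u x * v x)
      = (∫ x, f (u x) * v x) + lam * ∫ x, |u x| ^ (r - 2) * u x * v x

theorem PotentialHyp.abs_le {V : R3 → ℝ} {V₀ V₁ μ : ℝ} (hV : PotentialHyp V V₀ V₁ μ) (x : R3) :
    |V x| ≤ V₁ := by
  have := hV.bounds x
  have := hV.V₀_pos
  rw [abs_of_nonneg (by linarith)]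
  linarith

theorem H1Pair.memH {V : R3 → ℝ} {V₀ V₁ μ : ℝ} (hV : PotentialHyp V V₀ V₁ μ) {u : R3 → ℝ}
    {g : R3 → R3} (H : H1Pair u g) : MemH V u := by
  refine ⟨H.memH1, ?_⟩
  have := integrable_bdd_mul_mul hV.contDiff.continuous hV.abs_le H.memLp H.memLp
  simpa only [mul_assoc, ← pow_two] using this

theorem IsSolutionK.isWeakSol {a b : ℝ} {f : ℝ → ℝ} {p μ : ℝ} (hf : NonlinearityHyp f p μ)
    {V : R3 → ℝ} {V₀ V₁ : ℝ} (hV : PotentialHyp V V₀ V₁ μ) {α : ℝ} (hα : 0 < α) {r : ℝ}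
    (hr : 4 < r) (hr' : r < 6) {lam : ℝ} (hlam : 0 ≤ lam) {u : R3 → ℝ}
    (hu : IsSolutionK a b f V α r lam u) :
    IsWeakSol a b f V α r lam u (weakGrad u) := by
  have Hu := hu.1.1.1.h1Pair
  refine ⟨Hu, hu.1.2, fun v h Hv hvW => ?_⟩
  have e := hu.2 v ⟨Hv.memH hV, hvW⟩
  have hae := Hv.weakGrad_ae
  have e1 : ∫ x, inner ℝ (weakGrad u x) (weakGrad v x) = ∫ x, inner ℝ (weakGrad u x) (h x) :=
    integral_congr_ae (hae.mono fun x hx => by simp only [hx])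
  have e2 : ∫ x, (a * inner ℝ (weakGrad u x) (weakGrad v x) + V x * u x * v x
      + lam * weightW α x * u x * v x) = a * (∫ x, inner ℝ (weakGrad u x) (h x))
      + (∫ x, V x * u x * v x) + ∫ x, lam * weightW α x * u x * v x := by
    have i1 := (Hu.memLp_grad.integrable_inner_two Hv.memLp_grad).const_mul a
    have i2 := integrable_bdd_mul_mul hV.contDiff.continuous hV.abs_le Hu.memLp Hv.memLp
    have i3 := integrable_weight_mul_mul (q := fun x => lam * weightW α x)
      (fun x => mul_nonneg hlam (weightW_nonneg α x))
      ((continuous_weightW hα).aestronglyMeasurable.const_mul lam) Hu.memLp.1 Hv.memLp.1 hu.1.2 hvW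
    have i12 : Integrable (fun x => a * inner ℝ (weakGrad u x) (h x) + V x * u x * v x) :=
      i1.add i2
    rw [← integral_const_mul, ← integral_add i1 i2, ← integral_add i12 i3]
    exact integral_congr_ae (hae.mono fun x hx => by simp only [hx])
  have e3 : ∫ x, (f (u x) * v x + lam * |u x| ^ (r - 2) * u x * v x)
      = (∫ x, f (u x) * v x) + lam * ∫ x, |u x| ^ (r - 2) * u x * v x := by
    have i1 := hf.integrable_mul Hu Hv
    have i2 := (integrable_rpow_mul_mul hr hr' Hu Hv).const_mul lam
    rw [← integral_const_mul, ← integral_add i1 i2]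
    simp only [mul_assoc]
  simp only [derivI] at e
  rw [e1, e2, e3, dirichlet] at e
  linarith

theorem IsTestFunction.integrable_weight {φ : R3 → ℝ} (hφ : IsTestFunction φ) {α : ℝ}
    (hα : 0 < α) (lam : ℝ) : Integrable fun x => lam * weightW α x * φ x ^ 2 := by
  refine Continuous.integrable_of_hasCompactSupport
    ((continuous_const.mul (continuous_weightW hα)).mul (hφ.continuous.pow 2)) ?_
  have : HasCompactSupport fun x => φ x ^ 2 :=
    hφ.2.comp_left (g := fun s : ℝ => s ^ 2) (by norm_num)
  exact this.mul_left

/-! ### Kato's inequality -/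

theorem hasDerivAt_div_sqrt {ε : ℝ} (hε : 0 < ε) (s : ℝ) :
    HasDerivAt (fun s => s / √(s ^ 2 + ε ^ 2)) (ε ^ 2 / √(s ^ 2 + ε ^ 2) ^ 3) s := by
  have h0 : 0 < s ^ 2 + ε ^ 2 := by positivity
  have hs : 0 < √(s ^ 2 + ε ^ 2) := Real.sqrt_pos.2 h0
  have h2 : HasDerivAt (fun s => √(s ^ 2 + ε ^ 2)) (s / √(s ^ 2 + ε ^ 2)) s := by
    simpa using (hasDerivAt_sqrt_sq_add hε s).add_const ε
  have h3 := (hasDerivAt_id s).div h2 hs.ne'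
  have e : (1 * √(s ^ 2 + ε ^ 2) - id s * (s / √(s ^ 2 + ε ^ 2))) / √(s ^ 2 + ε ^ 2) ^ 2
      = ε ^ 2 / √(s ^ 2 + ε ^ 2) ^ 3 := by
    have hsq := Real.sq_sqrt h0.le
    simp only [id]
    rw [div_eq_div_iff (by positivity) (by positivity)]
    have : (1 * √(s ^ 2 + ε ^ 2) - s * (s / √(s ^ 2 + ε ^ 2))) * √(s ^ 2 + ε ^ 2) = ε ^ 2 := by
      have : (1 * √(s ^ 2 + ε ^ 2) - s * (s / √(s ^ 2 + ε ^ 2))) * √(s ^ 2 + ε ^ 2)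
          = √(s ^ 2 + ε ^ 2) ^ 2 - s ^ 2 := by field_simp
      rw [this, hsq]; ring
    calc _ = ((1 * √(s ^ 2 + ε ^ 2) - s * (s / √(s ^ 2 + ε ^ 2))) * √(s ^ 2 + ε ^ 2))
          * √(s ^ 2 + ε ^ 2) ^ 2 := by ring
      _ = _ := by rw [this]
  rw [e] at h3
  exact h3

theorem deriv_div_sqrt_mem {ε : ℝ} (hε : 0 < ε) (s : ℝ) :
    0 ≤ ε ^ 2 / √(s ^ 2 + ε ^ 2) ^ 3 ∧ ε ^ 2 / √(s ^ 2 + ε ^ 2) ^ 3 ≤ ε⁻¹ := by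
  have h1 : ε ≤ √(s ^ 2 + ε ^ 2) := Real.le_sqrt_of_sq_le (by nlinarith [sq_nonneg s])
  refine ⟨by positivity, ?_⟩
  calc ε ^ 2 / √(s ^ 2 + ε ^ 2) ^ 3 ≤ ε ^ 2 / ε ^ 3 := by gcongr
    _ = ε⁻¹ := by field_simp

theorem contDiff_div_sqrt {ε : ℝ} (hε : 0 < ε) :
    ContDiff ℝ 1 (fun s : ℝ => s / √(s ^ 2 + ε ^ 2)) := by
  have h0 : ∀ s : ℝ, 0 < s ^ 2 + ε ^ 2 := fun s => by positivity
  exact contDiff_id.div (((contDiff_id.pow 2).add contDiff_const).sqrt fun s => (h0 s).ne')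
    fun s => (Real.sqrt_pos.2 (h0 s)).ne'

section Kato

variable {a b : ℝ} {f : ℝ → ℝ} {p μ : ℝ} {V : R3 → ℝ} {V₀ V₁ : ℝ} {α r lam : ℝ}
  {u : R3 → ℝ} {g : R3 → R3}

/-- The equation is tested with `φ G(u)`, where `G` is a smooth approximation of the sign. The
gradient falling on `G(u)` produces `φ G'(u)|g|² ≥ 0`, which is dropped. The power term is bounded
crudely, since its factor `λ` tends to zero later. -/
theorem IsWeakSol.kato_regularized (ha : 0 < a) (hb : 0 < b) (hf : NonlinearityHyp f p μ)
    (hV : PotentialHyp V V₀ V₁ μ) (hα : 0 < α) (hr : 4 < r) (hr' : r < 6) (hlam : 0 ≤ lam)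
    (hu : IsWeakSol a b f V α r lam u g) {φ : R3 → ℝ} (hφ : IsTestFunction φ)
    (hφ0 : ∀ x, 0 ≤ φ x) {ε : ℝ} (hε : 0 < ε) :
    (a + b * ∫ x, ‖g x‖ ^ 2) * (∫ x, (u x / √(u x ^ 2 + ε ^ 2)) * inner ℝ (g x) (∇ φ x))
      + V₀ * (∫ x, (u x / √(u x ^ 2 + ε ^ 2)) * (u x * φ x))
      + (∫ x, (u x / √(u x ^ 2 + ε ^ 2)) * (lam * weightW α x * u x * φ x))
      ≤ (∫ x, |f (u x)| * φ x) + lam * ∫ x, (|u x| + |u x| ^ 5) * φ x := by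
  have Hu := hu.pair
  let G : ℝ → ℝ := fun s => s / √(s ^ 2 + ε ^ 2)
  have hG1 : ∀ s, |G s| ≤ 1 := abs_div_sqrt_sq_add_le_one ε
  have hGd : ∀ s, deriv G s = ε ^ 2 / √(s ^ 2 + ε ^ 2) ^ 3 := fun s =>
    (hasDerivAt_div_sqrt hε s).deriv
  have hGs : ∀ s, 0 ≤ G s * s := fun s => by
    simp only [G]
    rw [div_mul_eq_mul_div]
    exact div_nonneg (mul_self_nonneg s) (Real.sqrt_nonneg _)
  have HG : H1Pair (fun x => G (u x)) (fun x => deriv G (u x) • g x) :=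
    Hu.comp_scalar (contDiff_div_sqrt hε) (by simp [G]) (L := ε⁻¹) fun s => by
      have := deriv_div_sqrt_mem hε s
      change |deriv G s| ≤ _
      rw [hGd, abs_of_nonneg this.1]; exact this.2
  have Hv := HG.test_mul hφ
  have hvle : ∀ x, |φ x * G (u x)| ≤ φ x := fun x => by
    rw [abs_mul, abs_of_nonneg (hφ0 x)]
    exact mul_le_of_le_one_right (hφ0 x) (hG1 _)
  have hWm : AEStronglyMeasurable (fun x => lam * weightW α x) volume :=
    (continuous_weightW hα).aestronglyMeasurable.const_mul lam
  have hW0 : ∀ x, 0 ≤ lam * weightW α x := fun x => mul_nonneg hlam (weightW_nonneg α x)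
  -- Admissibility in the weighted space follows from `|φ G(u)| ≤ φ` and the compact support of `φ`.
  have hvW : Integrable (fun x => lam * weightW α x * (φ x * G (u x)) ^ 2) := by
    refine (hφ.integrable_weight hα lam).mono' (hWm.mul (Hv.memLp.1.pow 2))
      (Eventually.of_forall fun x => ?_)
    rw [Real.norm_of_nonneg (mul_nonneg (hW0 x) (sq_nonneg _))]
    exact mul_le_mul_of_nonneg_left (sq_le_sq.2 ((hvle x).trans (le_abs_self _))) (hW0 x)
  have heq := hu.eq _ _ Hv hvW
  have hD : 0 ≤ ∫ x, ‖g x‖ ^ 2 := integral_nonneg fun x => by positivity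
  have Hφ := H1Pair.of_test hφ
  have hGm : AEStronglyMeasurable (fun x => G (u x)) volume := HG.memLp.1
  have i1 : Integrable (fun x => G (u x) * inner ℝ (g x) (∇ φ x)) :=
    (Hu.memLp_grad.integrable_inner_two Hφ.memLp_grad).bdd_mul (c := 1) hGm
      (Eventually.of_forall fun x => hG1 _)
  have i2 : Integrable (fun x => G (u x) * (u x * φ x)) :=
    (Hu.memLp.integrable_mul_two Hφ.memLp).bdd_mul (c := 1) hGm
      (Eventually.of_forall fun x => hG1 _)
  have l1 : ∫ x, G (u x) * inner ℝ (g x) (∇ φ x)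
      ≤ ∫ x, inner ℝ (g x) (φ x • deriv G (u x) • g x + G (u x) • ∇ φ x) := by
    refine integral_mono i1 (Hu.memLp_grad.integrable_inner_two Hv.memLp_grad) fun x => ?_
    simp only [inner_add_right, real_inner_smul_right, real_inner_self_eq_norm_sq]
    have : 0 ≤ φ x * (deriv G (u x) * ‖g x‖ ^ 2) := by
      rw [hGd]
      exact mul_nonneg (hφ0 x) (mul_nonneg (deriv_div_sqrt_mem hε _).1 (by positivity))
    linarith
  have l2 : V₀ * (∫ x, G (u x) * (u x * φ x)) ≤ ∫ x, V x * u x * (φ x * G (u x)) := by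
    rw [← integral_const_mul]
    refine integral_mono (i2.const_mul _)
      (integrable_bdd_mul_mul hV.contDiff.continuous hV.abs_le Hu.memLp Hv.memLp) fun x => ?_
    have h1 := (hV.bounds x).1
    have h2 : 0 ≤ G (u x) * u x * φ x := mul_nonneg (hGs _) (hφ0 x)
    simp only
    nlinarith
  have l3 : ∫ x, G (u x) * (lam * weightW α x * u x * φ x)
      = ∫ x, lam * weightW α x * u x * (φ x * G (u x)) := by
    congr 1 with x; ring
  have i4 : Integrable (fun x => |f (u x)| * φ x) := by
    have := (hf.integrable_mul Hu Hφ).norm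
    refine this.congr (Eventually.of_forall fun x => ?_)
    simp [abs_of_nonneg (hφ0 x)]
  have l4 : ∫ x, f (u x) * (φ x * G (u x)) ≤ ∫ x, |f (u x)| * φ x := by
    refine integral_mono (hf.integrable_mul Hu Hv) i4 fun x => ?_
    calc f (u x) * (φ x * G (u x)) ≤ |f (u x) * (φ x * G (u x))| := le_abs_self _
      _ ≤ |f (u x)| * φ x := by rw [abs_mul]; gcongr; exact hvle x
  have i5 : Integrable (fun x => (|u x| + |u x| ^ 5) * φ x) := by
    refine ((Hu.integrable_sq.add Hφ.integrable_sq).add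
      (Hu.integrable_pow_six.add Hφ.integrable_pow_six)).mono'
      ((Hu.memLp.norm.1.add (Hu.memLp.norm.1.pow 5)).mul Hφ.memLp.1)
      (Eventually.of_forall fun x => ?_)
    rw [norm_mul, Real.norm_of_nonneg (by positivity), Real.norm_eq_abs, add_mul]
    exact add_le_add (abs_mul_abs_le_sq _ _) (abs_pow_five_mul_abs_le _ _)
  have l5 : ∫ x, |u x| ^ (r - 2) * u x * (φ x * G (u x)) ≤ ∫ x, (|u x| + |u x| ^ 5) * φ x := by
    refine integral_mono (integrable_rpow_mul_mul hr hr' Hu Hv) i5 fun x => ?_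
    calc _ ≤ |(|u x| ^ (r - 2) * u x) * (φ x * G (u x))| := le_abs_self _
      _ ≤ _ := by
        rw [abs_mul]
        have := abs_rpow_mul_le hr hr' (u x)
        gcongr
        exact hvle x
  have l1' := mul_le_mul_of_nonneg_left l1 (show 0 ≤ a + b * ∫ x, ‖g x‖ ^ 2 by positivity)
  have l5' := mul_le_mul_of_nonneg_left l5 hlam
  simp only [G] at *
  linarith

/-- Kato's inequality for weak solutions. -/
theorem IsWeakSol.kato (ha : 0 < a) (hb : 0 < b) (hf : NonlinearityHyp f p μ)
    (hV : PotentialHyp V V₀ V₁ μ) (hα : 0 < α) (hr : 4 < r) (hr' : r < 6) (hlam : 0 ≤ lam)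
    (hu : IsWeakSol a b f V α r lam u g) {φ : R3 → ℝ} (hφ : IsTestFunction φ)
    (hφ0 : ∀ x, 0 ≤ φ x) :
    (a + b * ∫ x, ‖g x‖ ^ 2) * (∫ x, inner ℝ ((u x / |u x|) • g x) (∇ φ x))
      + V₀ * (∫ x, |u x| * φ x) + (∫ x, lam * weightW α x * |u x| * φ x)
      ≤ (∫ x, |f (u x)| * φ x) + lam * ∫ x, (|u x| + |u x| ^ 5) * φ x := by
  have Hu := hu.pair
  have Hφ := H1Pair.of_test hφ
  let e : ℕ → ℝ := fun n => 1 / ((n : ℝ) + 1)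
  have he : ∀ n, 0 < e n := fun n => by positivity
  have hlim : Tendsto e atTop (𝓝 0) := tendsto_one_div_add_nhds_zero
  have hm : ∀ n, AEStronglyMeasurable (fun x => u x / √(u x ^ 2 + e n ^ 2)) volume := fun n =>
    ((contDiff_div_sqrt (he n)).continuous).comp_aestronglyMeasurable Hu.memLp.1
  -- The smoothed sign is bounded by one and converges pointwise to the sign, so each term on the
  -- left passes to the limit by dominated convergence.
  have key : ∀ k : R3 → ℝ, Integrable k → Tendsto (fun n =>
      ∫ x, (u x / √(u x ^ 2 + e n ^ 2)) * k x) atTop (𝓝 (∫ x, (u x / |u x|) * k x)) := by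
    intro k hk
    refine tendsto_integral_of_dominated_convergence (fun x => ‖k x‖)
      (fun n => (hm n).mul hk.1) hk.norm (fun n => Eventually.of_forall fun x => ?_)
      (Eventually.of_forall fun x => ?_)
    · rw [norm_mul]
      exact mul_le_of_le_one_left (norm_nonneg _) (abs_div_sqrt_sq_add_le_one _ _)
    · exact ((tendsto_div_sqrt_sq_add (u x)).comp hlim).mul_const _
  have h1 := key _ (Hu.memLp_grad.integrable_inner_two Hφ.memLp_grad)
  have h2 := key _ (Hu.memLp.integrable_mul_two Hφ.memLp)
  have h3 := key _ (integrable_weight_mul_mul (q := fun x => lam * weightW α x)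
    (fun x => mul_nonneg hlam (weightW_nonneg α x))
    ((continuous_weightW hα).aestronglyMeasurable.const_mul lam) Hu.memLp.1 Hφ.memLp.1 hu.weight
    (hφ.integrable_weight hα lam))
  have e2 : ∀ x, (u x / |u x|) * (u x * φ x) = |u x| * φ x := fun x => by
    rcases eq_or_ne (u x) 0 with h0 | h0
    · simp [h0]
    · have := abs_pos.2 h0
      field_simp
      rw [sq_abs]
  have e3 : ∀ x, (u x / |u x|) * (lam * weightW α x * u x * φ x)
      = lam * weightW α x * |u x| * φ x := fun x => by
    rw [mul_assoc (lam * _) (|u x|), ← e2]; ring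
  simp only [e2] at h2
  simp only [e3] at h3
  simp only [real_inner_smul_left]
  refine le_of_tendsto (((h1.const_mul _).add (h2.const_mul _)).add h3) (Eventually.of_forall fun n => ?_)
  exact hu.kato_regularized ha hb hf hV hα hr hr' hlam hφ hφ0 (he n)

end Kato

/-! ### Local strong convergence -/

theorem eLpNorm_two_le_of_integral_le {X : Type*} [NormedAddCommGroup X] {f : R3 → X}
    (hf : MemLp f 2 volume) {K : ℝ} (h : ∫ x, ‖f x‖ ^ 2 ≤ K) :
    eLpNorm f 2 volume ≤ ENNReal.ofReal √K := by
  have hK : 0 ≤ K := (integral_nonneg fun x => by positivity).trans h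
  rw [← ENNReal.pow_le_pow_left_iff two_ne_zero, eLpNorm_two_sq_eq_ofReal hf,
    ← ENNReal.ofReal_pow (Real.sqrt_nonneg _), Real.sq_sqrt hK]
  exact ENNReal.ofReal_le_ofReal h

theorem tendsto_eLpNorm_sub_restrict_ball {v : ℕ → R3 → ℝ} {G : ℕ → R3 → R3} {w : R3 → ℝ}
    {h : R3 → R3} (H : ∀ n, H1Pair (v n) (G n)) (hw : WeakL2 v w) (hh : WeakL2 G h) {K : ℝ}
    (hK : ∀ n, ∫ x, v n x ^ 2 ≤ K) (hK' : ∀ n, ∫ x, ‖G n x‖ ^ 2 ≤ K) (R : ℝ) :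
    Tendsto (fun n => eLpNorm (fun x => v n x - w x) 2 (volume.restrict (Metric.closedBall 0 R)))
      atTop (𝓝 0) := by
  have Hw := H1Pair.of_weakL2 H hw hh
  have b1 : ∀ n, eLpNorm (v n) 2 volume ≤ ENNReal.ofReal √K := fun n =>
    eLpNorm_two_le_of_integral_le (H n).memLp (by simpa using hK n)
  have b2 : ∀ n, eLpNorm (G n) 2 volume ≤ ENNReal.ofReal √K := fun n =>
    eLpNorm_two_le_of_integral_le (H n).memLp_grad (hK' n)
  refine tendsto_eLpNorm_restrict_ball (fun n => (H n).sub Hw)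
    (by simpa using hw.sub (WeakL2.const Hw.memLp))
    (C := ENNReal.ofReal √K + ENNReal.ofReal √K) (by finiteness) (fun n => ?_) (fun n => ?_) R
  · exact (eLpNorm_sub_le (H n).memLp.1 Hw.memLp.1 (by norm_num)).trans
      (add_le_add (b1 n) (hw.eLpNorm_le b1))
  · exact (eLpNorm_sub_le (H n).memLp_grad.1 Hw.memLp_grad.1 (by norm_num)).trans
      (add_le_add (b2 n) (hh.eLpNorm_le b2))

theorem tendsto_integral_abs_mul {v : ℕ → R3 → ℝ} {w k : R3 → ℝ} (hv : ∀ n, MemLp (v n) 2 volume)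
    (hw : MemLp w 2 volume) (hk : MemLp k 2 volume) {R : ℝ} (hkR : ∀ x, R < ‖x‖ → k x = 0)
    (h : Tendsto (fun n => eLpNorm (fun x => v n x - w x) 2
      (volume.restrict (Metric.closedBall 0 R))) atTop (𝓝 0)) :
    Tendsto (fun n => ∫ x, |v n x| * k x) atTop (𝓝 (∫ x, |w x| * k x)) := by
  have hms : MeasurableSet (Metric.closedBall (0 : R3) R) := Metric.isClosed_closedBall.measurableSet
  have e : ∀ v : R3 → ℝ, ∫ x, |v x| * k x
      = ∫ x, k x • (Metric.closedBall (0 : R3) R).indicator (fun x => |v x|) x := by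
    intro v
    congr 1 with x
    by_cases hx : x ∈ Metric.closedBall (0 : R3) R
    · rw [Set.indicator_of_mem hx, smul_eq_mul, mul_comm]
    · rw [Set.indicator_of_notMem hx, hkR x (by simpa using hx)]
      simp
  simp only [e]
  refine tendsto_integral_smul_of_eLpNorm hk (fun n => ((hv n).norm).indicator hms)
    (hw.norm.indicator hms) ?_
  refine tendsto_of_tendsto_of_tendsto_of_le_of_le tendsto_const_nhds h (fun n => zero_le)
    fun n => ?_
  rw [← eLpNorm_indicator_eq_eLpNorm_restrict hms]
  refine eLpNorm_mono fun x => ?_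
  by_cases hx : x ∈ Metric.closedBall (0 : R3) R
  · simp only [Set.indicator_of_mem hx]
    exact abs_abs_sub_abs_le_abs_sub _ _
  · simp [Set.indicator_of_notMem hx]

/-- Fatou's lemma for Bochner integrals, with the limit inferior replaced by the limit of a
majorant. -/
theorem integral_le_of_tendsto_of_nonneg {ψ : ℕ → R3 → ℝ} {ψ₀ : R3 → ℝ} {c : ℕ → ℝ} {c₀ : ℝ}
    (hi : ∀ n, Integrable (ψ n)) (hi₀ : Integrable ψ₀) (h0 : ∀ n x, 0 ≤ ψ n x)
    (hae : ∀ᵐ x, Tendsto (fun n => ψ n x) atTop (𝓝 (ψ₀ x))) (hc : ∀ n, ∫ x, ψ n x ≤ c n)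
    (hlim : Tendsto c atTop (𝓝 c₀)) : ∫ x, ψ₀ x ≤ c₀ := by
  have h00 : 0 ≤ᵐ[volume] ψ₀ := hae.mono fun x hx => ge_of_tendsto' hx fun n => h0 n x
  have hc0 : 0 ≤ c₀ := ge_of_tendsto' hlim fun n => (integral_nonneg (h0 n)).trans (hc n)
  rw [← ENNReal.ofReal_le_ofReal_iff hc0, ofReal_integral_eq_lintegral_ofReal hi₀ h00]
  calc ∫⁻ x, ENNReal.ofReal (ψ₀ x)
      = ∫⁻ x, liminf (fun n => ENNReal.ofReal (ψ n x)) atTop := by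
        refine lintegral_congr_ae (hae.mono fun x hx => ?_)
        exact ((ENNReal.continuous_ofReal.tendsto _).comp hx).liminf_eq.symm
    _ ≤ liminf (fun n => ∫⁻ x, ENNReal.ofReal (ψ n x)) atTop :=
        lintegral_liminf_le' fun n => (hi n).1.aemeasurable.ennreal_ofReal
    _ ≤ liminf (fun n => ENNReal.ofReal (c n)) atTop := by
        refine liminf_le_liminf (Eventually.of_forall fun n => ?_)
        rw [← ofReal_integral_eq_lintegral_ofReal (hi n) (Eventually.of_forall (h0 n))]
        exact ENNReal.ofReal_le_ofReal (hc n)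
    _ = ENNReal.ofReal c₀ := ((ENNReal.continuous_ofReal.tendsto _).comp hlim).liminf_eq

/-! ### Bounded sequences of solutions -/

/-- A sequence of weak solutions which is bounded in energy, with parameters tending to zero. -/
structure BoundedSols (a b : ℝ) (f : ℝ → ℝ) (V : R3 → ℝ) (α r : ℝ) (lam : ℕ → ℝ)
    (u : ℕ → R3 → ℝ) (g : ℕ → R3 → R3) (K : ℝ) : Prop where
  sol : ∀ n, IsWeakSol a b f V α r (lam n) (u n) (g n)
  lam_nonneg : ∀ n, 0 ≤ lam n
  lam_tendsto : Tendsto lam atTop (𝓝 0)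
  sq_le : ∀ n, ∫ x, u n x ^ 2 ≤ K
  grad_le : ∀ n, ∫ x, ‖g n x‖ ^ 2 ≤ K
  six_le : ∀ n, ∫ x, u n x ^ 6 ≤ K
  weight_le : ∀ n, ∫ x, lam n * weightW α x * u n x ^ 2 ≤ K

namespace BoundedSols

variable {a b : ℝ} {f : ℝ → ℝ} {p μ : ℝ} {V : R3 → ℝ} {V₀ V₁ : ℝ} {α r : ℝ} {lam : ℕ → ℝ}
  {u : ℕ → R3 → ℝ} {g : ℕ → R3 → R3} {K : ℝ}

theorem comp (h : BoundedSols a b f V α r lam u g K) {σ : ℕ → ℕ} (hσ : StrictMono σ) :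
    BoundedSols a b f V α r (fun n => lam (σ n)) (fun n => u (σ n)) (fun n => g (σ n)) K :=
  ⟨fun _ => h.sol _, fun _ => h.lam_nonneg _, h.lam_tendsto.comp hσ.tendsto_atTop,
    fun _ => h.sq_le _, fun _ => h.grad_le _, fun _ => h.six_le _, fun _ => h.weight_le _⟩

theorem pair (h : BoundedSols a b f V α r lam u g K) (n : ℕ) : H1Pair (u n) (g n) :=
  (h.sol n).pair

theorem pair_translate (h : BoundedSols a b f V α r lam u g K) (y : ℕ → R3) (n : ℕ) :
    H1Pair (fun x => u n (x + y n)) (fun x => g n (x + y n)) :=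
  (h.pair n).comp_add_right _

theorem sq_translate_le (h : BoundedSols a b f V α r lam u g K) (y : ℕ → R3) (n : ℕ) :
    ∫ x, u n (x + y n) ^ 2 ≤ K := by
  rw [integral_add_right_eq_self (fun x => u n x ^ 2)]; exact h.sq_le n

theorem six_translate_le (h : BoundedSols a b f V α r lam u g K) (y : ℕ → R3) (n : ℕ) :
    ∫ x, u n (x + y n) ^ 6 ≤ K := by
  rw [integral_add_right_eq_self (fun x => u n x ^ 6)]; exact h.six_le n

theorem grad_translate_le (h : BoundedSols a b f V α r lam u g K) (y : ℕ → R3) (n : ℕ) :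
    ∫ x, ‖g n (x + y n)‖ ^ 2 ≤ K := by
  rw [integral_add_right_eq_self (fun x => ‖g n x‖ ^ 2)]; exact h.grad_le n

end BoundedSols

/-! ### Kato's inequality for weak limits of translates -/

/-- `L` is the Laplacian of `φ`. Moving the second derivative onto `φ` lets Kato's inequality pass
to the limit from local `L²` convergence of the moduli, without any convergence of their gradients.
-/
theorem IsTestFunction.exists_laplacian {φ : R3 → ℝ} (hφ : IsTestFunction φ) :
    ∃ L : R3 → ℝ, MemLp L 2 volume ∧ (∃ R, ∀ x, R < ‖x‖ → L x = 0) ∧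
      ∀ (u : R3 → ℝ) (g : R3 → R3), H1Pair u g → ∫ x, inner ℝ (g x) (∇ φ x) = -∫ x, u x * L x := by
  let e := EuclideanSpace.basisFun (Fin 3) ℝ
  let ψ : Fin 3 → R3 → ℝ := fun i x => fderiv ℝ φ x (e i)
  have hψ : ∀ i, IsTestFunction (ψ i) := fun i =>
    ⟨(hφ.1.fderiv_right (m := ∞) (by simp)).clm_apply contDiff_const,
      (hφ.2.fderiv (𝕜 := ℝ)).comp_left (g := fun l : R3 →L[ℝ] ℝ => l (e i)) (by simp)⟩
  have hm : ∀ i, MemLp (fun x => inner ℝ (∇ (ψ i) x) (e i)) 2 volume := fun i =>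
    ((hψ i).memLp_gradient 2).inner_const _
  refine ⟨fun x => ∑ i, inner ℝ (∇ (ψ i) x) (e i), memLp_finsetSum _ fun i _ => hm i, ?_,
    fun u g H => ?_⟩
  · have hc : HasCompactSupport fun x => ∑ i, inner ℝ (∇ (ψ i) x) (e i) := by
      have : ∀ i, HasCompactSupport fun x => inner ℝ (∇ (ψ i) x) (e i) := fun i =>
        (hasCompactSupport_gradient (hψ i).2).comp_left (g := fun z : R3 => inner ℝ z (e i))
          (by simp)
      simp only [Fin.sum_univ_three]
      exact ((this 0).add (this 1)).add (this 2)
    obtain ⟨R, -, h0⟩ := hc.isCompact.isBounded.exists_pos_norm_le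
    exact ⟨R, fun x hx => by_contra fun hne => not_lt.2 (h0 x (subset_tsupport _ hne)) hx⟩
  · have h1 : ∀ i, ∫ x, u x * inner ℝ (∇ (ψ i) x) (e i) = - ∫ x, ψ i x * inner ℝ (g x) (e i) := by
      intro i
      have := congrArg (fun z => inner ℝ (e i) z) (H.integral_eq _ (hψ i))
      simp only [inner_neg_right] at this
      rw [← integral_inner (H.memLp.integrable_smul_two ((hψ i).memLp_gradient 2)),
        ← integral_inner (((hψ i).memLp 2).integrable_smul_two H.memLp_grad)] at this
      simpa only [real_inner_smul_right, real_inner_comm (e i)] using this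
    have h2 : ∀ x, inner ℝ (g x) (∇ φ x) = ∑ i, ψ i x * inner ℝ (g x) (e i) := by
      intro x
      rw [← e.sum_inner_mul_inner]
      refine Finset.sum_congr rfl fun i _ => ?_
      rw [mul_comm, inner_gradient_right]
      simp [ψ]
    simp only [h2, Finset.mul_sum]
    rw [integral_finsetSum, integral_finsetSum, ← Finset.sum_neg_distrib]
    · exact Finset.sum_congr rfl fun i _ => by rw [h1, neg_neg]
    · exact fun i _ => H.memLp.integrable_mul_two (hm i)
    · exact fun i _ => ((hψ i).memLp 2).integrable_mul_two (H.memLp_grad.inner_const _)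

section Limit

variable {a b : ℝ} {f : ℝ → ℝ} {p μ : ℝ} {V : R3 → ℝ} {V₀ V₁ : ℝ} {α r : ℝ}

theorem IsWeakSol.kato_translate {lam : ℝ} {u : R3 → ℝ} {g : R3 → R3} (ha : 0 < a) (hb : 0 < b)
    (hf : NonlinearityHyp f p μ)
    (hV : PotentialHyp V V₀ V₁ μ) (hα : 0 < α) (hr : 4 < r) (hr' : r < 6) (hlam : 0 ≤ lam)
    (hu : IsWeakSol a b f V α r lam u g) {φ : R3 → ℝ} (hφ : IsTestFunction φ)
    (hφ0 : ∀ x, 0 ≤ φ x) (y : R3) :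
    (a + b * ∫ x, ‖g x‖ ^ 2) *
        (∫ x, inner ℝ ((u (x + y) / |u (x + y)|) • g (x + y)) (∇ φ x))
      + V₀ * (∫ x, |u (x + y)| * φ x) + (∫ x, lam * weightW α (x + y) * |u (x + y)| * φ x)
      ≤ (∫ x, |f (u (x + y))| * φ x) + lam * ∫ x, (|u (x + y)| + |u (x + y)| ^ 5) * φ x := by
  have h := hu.kato ha hb hf hV hα hr hr' hlam (hφ.comp_add_right (-y)) fun x => hφ0 _
  simp only [gradient_comp_add_right] at h
  rw [← integral_add_right_eq_self (fun x => inner ℝ ((u x / |u x|) • g x) _) y,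
    ← integral_add_right_eq_self (fun x => |u x| * _) y,
    ← integral_add_right_eq_self (fun x => lam * weightW α x * |u x| * _) y,
    ← integral_add_right_eq_self (fun x => |f (u x)| * _) y,
    ← integral_add_right_eq_self (fun x => (|u x| + |u x| ^ 5) * _) y] at h
  simpa using h

/-- Subadditivity of `t ↦ t^α` for `α ≤ 1`. The weight therefore oscillates boundedly on balls of
fixed radius, wherever they are centered. -/
theorem weightW_le_add {α : ℝ} (hα : 0 < α) (hα1 : α ≤ 1) (x y : R3) :
    weightW α y ≤ weightW α (x + y) + ‖x‖ ^ α := by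
  have h1 : ‖y‖ ≤ ‖x + y‖ + ‖x‖ := by
    have := norm_sub_le (x + y) x
    simpa using this
  have h2 : ‖y‖ ^ α ≤ (‖x + y‖ + ‖x‖) ^ α := by gcongr
  have h3 := Real.rpow_add_le_add_rpow (norm_nonneg (x + y)) (norm_nonneg x) hα.le hα1
  unfold weightW
  linarith

/-- On the support of `φ` the weight can be frozen at the center `y` with a loss of `λ R^α`, which
disappears as `λ → 0`. -/
theorem integral_weight_translate_ge {lam : ℝ} (hlam : 0 ≤ lam) (hα : 0 < α) (hα1 : α ≤ 1)
    {v φ : R3 → ℝ} (hv : MemLp v 2 volume) (hφ : IsTestFunction φ) (hφ0 : ∀ x, 0 ≤ φ x) {R : ℝ}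
    (hφR : ∀ x, R < ‖x‖ → φ x = 0) (y : R3) :
    (lam * weightW α y - lam * R ^ α) * (∫ x, |v x| * φ x)
      ≤ ∫ x, lam * weightW α (x + y) * |v x| * φ x := by
  have i1 : Integrable fun x => |v x| * φ x := hv.norm.integrable_mul_two (hφ.memLp 2)
  have hWφ : MemLp (fun x => lam * weightW α (x + y) * φ x) 2 volume :=
    Continuous.memLp_of_hasCompactSupport ((continuous_const.mul ((continuous_weightW hα).comp
      (continuous_id.add continuous_const))).mul hφ.continuous) hφ.2.mul_left
  have i2 : Integrable fun x => lam * weightW α (x + y) * |v x| * φ x :=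
    (hv.norm.integrable_mul_two hWφ).congr (Eventually.of_forall fun x => by
      simp only [Real.norm_eq_abs]; ring)
  rw [← integral_const_mul]
  refine integral_mono (i1.const_mul _) i2 fun x => ?_
  simp only
  by_cases hx : R < ‖x‖
  · simp [hφR x hx]
  · have h1 := weightW_le_add hα hα1 x y
    have h2 : ‖x‖ ^ α ≤ R ^ α := by
      have := not_lt.1 hx
      gcongr
    have h3 : lam * weightW α y - lam * R ^ α ≤ lam * weightW α (x + y) := by
      have := mul_le_mul_of_nonneg_left (h1.trans (add_le_add_right h2 _)) hlam
      linarith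
    calc _ ≤ lam * weightW α (x + y) * (|v x| * φ x) :=
          mul_le_mul_of_nonneg_right h3 (mul_nonneg (abs_nonneg _) (hφ0 x))
      _ = _ := by ring

/-- The sequence `c` need only be a lower bound for `λ_n W(y_n)`. With `c = 0` the inequality is
available before the weights are known to converge, which is how profiles are counted; with equality
it gives the final form containing `a_j`. -/
theorem BoundedSols.kato_limit {lam : ℕ → ℝ} {u : ℕ → R3 → ℝ} {g : ℕ → R3 → R3} {K : ℝ}
    (B : BoundedSols a b f V α r lam u g K) (ha : 0 < a) (hb : 0 < b)
    (hf : NonlinearityHyp f p μ) (hV : PotentialHyp V V₀ V₁ μ) (hα : 0 < α) (hα1 : α ≤ 1)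
    (hr : 4 < r) (hr' : r < 6) {A : ℝ} (hA : Tendsto (fun n => ∫ x, ‖g n x‖ ^ 2) atTop (𝓝 A))
    {y : ℕ → R3} {c : ℕ → ℝ} {c₀ : ℝ} (hc : ∀ n, c n ≤ lam n * weightW α (y n))
    (hc₀ : Tendsto c atTop (𝓝 c₀)) {w : R3 → ℝ} {h : R3 → R3}
    (hw : WeakL2 (fun n x => u n (x + y n)) w) (hh : WeakL2 (fun n x => g n (x + y n)) h)
    {φ : R3 → ℝ} (hφ : IsTestFunction φ) (hφ0 : ∀ x, 0 ≤ φ x) :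
    (a + b * A) * (∫ x, inner ℝ ((w x / |w x|) • h x) (∇ φ x)) + (V₀ + c₀) * (∫ x, |w x| * φ x)
      ≤ ∫ x, |f (w x)| * φ x := by
  obtain ⟨L, hL, ⟨RL, hRL⟩, hLap⟩ := hφ.exists_laplacian
  obtain ⟨Rφ, -, hRφ⟩ := hφ.exists_ball
  obtain ⟨Cφ, hCφ0, hCφ⟩ := hφ.exists_bound
  have Hv := fun n => B.pair_translate y n
  have Hw := H1Pair.of_weakL2 Hv hw hh
  have Hφ := H1Pair.of_test hφ
  have hloc := tendsto_eLpNorm_sub_restrict_ball Hv hw hh (B.sq_translate_le y)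
    (B.grad_translate_le y)
  have t1 := tendsto_integral_abs_mul (fun n => (Hv n).memLp) Hw.memLp hL hRL (hloc RL)
  have t2 := tendsto_integral_abs_mul (fun n => (Hv n).memLp) Hw.memLp (hφ.memLp 2) hRφ (hloc Rφ)
  have hint : ∀ (v : R3 → ℝ) (G : R3 → R3), H1Pair v G →
      Integrable (fun x => |f (v x)| * φ x) := fun v G Hv => by
    refine (hf.integrable_mul Hv Hφ).norm.congr (Eventually.of_forall fun x => ?_)
    simp [abs_of_nonneg (hφ0 x)]
  have hint6 : ∀ (v : R3 → ℝ) (G : R3 → R3), H1Pair v G →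
      Integrable (fun x => v x ^ 6 * φ x) := fun v G Hv => by
    have := Hv.integrable_pow_six.bdd_mul (c := Cφ) hφ.continuous.aestronglyMeasurable
      (Eventually.of_forall hCφ)
    simpa only [mul_comm] using this
  let lhs : ℕ → ℝ := fun n => (a + b * ∫ x, ‖g n x‖ ^ 2) * -(∫ x, |u n (x + y n)| * L x)
    + (V₀ + (c n - lam n * Rφ ^ α)) * (∫ x, |u n (x + y n)| * φ x)
  let lhs₀ : ℝ := (a + b * A) * -(∫ x, |w x| * L x) + (V₀ + (c₀ - 0 * Rφ ^ α)) * (∫ x, |w x| * φ x)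
  have hlhs : Tendsto lhs atTop (𝓝 lhs₀) :=
    ((tendsto_const_nhds.add (hA.const_mul b)).mul t1.neg).add
      ((tendsto_const_nhds.add (hc₀.sub (B.lam_tendsto.mul_const _))).mul t2)
  let E : ℝ := K + (∫ x, φ x ^ 2) + (K + ∫ x, φ x ^ 6)
  have hkato : ∀ n, lhs n ≤ (∫ x, |f (u n (x + y n))| * φ x) + lam n * E := by
    intro n
    have h1 := (B.sol n).kato_translate ha hb hf hV hα hr hr' (B.lam_nonneg n) hφ hφ0 (y n)
    rw [hLap _ _ (Hv n).abs] at h1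
    have h3 : (c n - lam n * Rφ ^ α) * (∫ x, |u n (x + y n)| * φ x)
        ≤ ∫ x, lam n * weightW α (x + y n) * |u n (x + y n)| * φ x := by
      refine le_trans ?_ (integral_weight_translate_ge (B.lam_nonneg n) hα hα1 (Hv n).memLp hφ hφ0
        hRφ (y n))
      exact mul_le_mul_of_nonneg_right (by linarith [hc n])
        (integral_nonneg fun x => mul_nonneg (abs_nonneg _) (hφ0 x))
    have h4 : lhs n ≤ (∫ x, |f (u n (x + y n))| * φ x)
        + lam n * ∫ x, (|u n (x + y n)| + |u n (x + y n)| ^ 5) * φ x := by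
      simp only [lhs]
      linarith
    refine h4.trans ?_
    have h2 : ∫ x, (|u n (x + y n)| + |u n (x + y n)| ^ 5) * φ x ≤ E := by
      have i1 := (Hv n).integrable_sq
      have i2 := (Hv n).integrable_pow_six
      have hE : (∫ x, u n (x + y n) ^ 2) + (∫ x, φ x ^ 2)
          + ((∫ x, u n (x + y n) ^ 6) + ∫ x, φ x ^ 6) ≤ E :=
        add_le_add (add_le_add (B.sq_translate_le y n) le_rfl)
          (add_le_add (B.six_translate_le y n) le_rfl)
      refine le_trans ?_ hE
      have j1 : Integrable fun x => u n (x + y n) ^ 2 + φ x ^ 2 := i1.add Hφ.integrable_sq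
      have j2 : Integrable fun x => u n (x + y n) ^ 6 + φ x ^ 6 := i2.add Hφ.integrable_pow_six
      rw [← integral_add i1 Hφ.integrable_sq, ← integral_add i2 Hφ.integrable_pow_six,
        ← integral_add j1 j2]
      refine integral_mono_of_nonneg
        (Eventually.of_forall fun x => mul_nonneg (by positivity) (hφ0 x)) (j1.add j2)
        (Eventually.of_forall fun x => ?_)
      have e : φ x = |φ x| := (abs_of_nonneg (hφ0 x)).symm
      simp only [add_mul]
      nth_rewrite 1 [e]
      nth_rewrite 2 [e]
      exact add_le_add (abs_mul_abs_le_sq _ _) (abs_pow_five_mul_abs_le _ _)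
    have := mul_le_mul_of_nonneg_left h2 (B.lam_nonneg n)
    linarith
  -- Almost everywhere convergence is needed only on a ball containing the support of `φ`.
  obtain ⟨σ, hσ, hae⟩ := (tendstoInMeasure_of_tendsto_eLpNorm (by norm_num)
    (fun n => (Hv n).memLp.1.restrict) Hw.memLp.1.restrict (hloc Rφ)).exists_seq_tendsto_ae
  rw [ae_restrict_iff' Metric.isClosed_closedBall.measurableSet] at hae
  have hK0 : 0 ≤ K := (integral_nonneg fun x => sq_nonneg _).trans (B.sq_le 0)
  have key : ∀ δ : ℝ, 0 < δ → lhs₀ ≤ (∫ x, |f (w x)| * φ x) + δ * (Cφ * K) := by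
    intro δ hδ
    obtain ⟨C, hC0, hC⟩ := hf.exists_abs_le_const_add hδ
    have hIntψ : ∀ (v : R3 → ℝ) (G : R3 → R3), H1Pair v G →
        Integrable (fun x => (C + δ * v x ^ 6 - |f (v x)|) * φ x) ∧
        ∫ x, (C + δ * v x ^ 6 - |f (v x)|) * φ x
          = C * (∫ x, φ x) + δ * (∫ x, v x ^ 6 * φ x) - ∫ x, |f (v x)| * φ x := by
      intro v G Hv
      have i1 := hφ.integrable.const_mul C
      have i2 := (hint6 v G Hv).const_mul δ
      have i3 := hint v G Hv
      have e : (fun x => (C + δ * v x ^ 6 - |f (v x)|) * φ x)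
          = fun x => (C * φ x + δ * (v x ^ 6 * φ x)) - |f (v x)| * φ x := by
        ext x; ring
      have i12 : Integrable fun x => C * φ x + δ * (v x ^ 6 * φ x) := i1.add i2
      rw [e]
      refine ⟨i12.sub i3, ?_⟩
      rw [integral_sub i12 i3, integral_add i1 i2, integral_const_mul, integral_const_mul]
    -- Reverse Fatou: applied to the nonnegative `(C + δ v⁶ - |f(v)|) φ`, it gives upper
    -- semicontinuity of `∫ |f(v)| φ` up to `δ ∫ v⁶ φ ≤ δ Cφ K`. The constant `C` cancels, and `δ`
    -- is sent to zero at the end.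
    have hfatou := integral_le_of_tendsto_of_nonneg
      (ψ := fun n x => (C + δ * u (σ n) (x + y (σ n)) ^ 6 - |f (u (σ n) (x + y (σ n)))|) * φ x)
      (ψ₀ := fun x => (C + δ * w x ^ 6 - |f (w x)|) * φ x)
      (c := fun n => C * (∫ x, φ x) + δ * (Cφ * K) - (lhs (σ n) - lam (σ n) * E))
      (c₀ := C * (∫ x, φ x) + δ * (Cφ * K) - (lhs₀ - 0 * E))
      (fun n => (hIntψ _ _ (Hv _)).1) (hIntψ _ _ Hw).1
      (fun n x => mul_nonneg (by linarith [hC (u (σ n) (x + y (σ n)))]) (hφ0 x))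
      (by
        filter_upwards [hae] with x hx
        by_cases hxR : x ∈ Metric.closedBall (0 : R3) Rφ
        · have := hx hxR
          exact (((this.pow 6).const_mul δ).const_add C |>.sub
            ((hf.continuous.tendsto _).comp this).abs).mul_const _
        · have : φ x = 0 := hRφ x (by simpa using hxR)
          simp [this])
      (fun n => by
        rw [(hIntψ _ _ (Hv _)).2]
        have h1 := hkato (σ n)
        have h2 : ∫ x, u (σ n) (x + y (σ n)) ^ 6 * φ x ≤ Cφ * K := by
          have : ∫ x, u (σ n) (x + y (σ n)) ^ 6 * φ x ≤ ∫ x, Cφ * u (σ n) (x + y (σ n)) ^ 6 := by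
            refine integral_mono (hint6 _ _ (Hv _)) ((Hv _).integrable_pow_six.const_mul _)
              fun x => ?_
            have h3 := (le_abs_self _).trans (hCφ x)
            have h4 : 0 ≤ u (σ n) (x + y (σ n)) ^ 6 := by positivity
            simp only
            nlinarith
          rw [integral_const_mul] at this
          exact this.trans (by gcongr; exact B.six_translate_le y _)
        have h3 := mul_le_mul_of_nonneg_left h2 hδ.le
        linarith)
      ((tendsto_const_nhds.sub ((hlhs.comp hσ.tendsto_atTop).sub
        ((B.lam_tendsto.comp hσ.tendsto_atTop).mul_const E))))
    rw [(hIntψ _ _ Hw).2] at hfatou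
    have h6 : 0 ≤ δ * ∫ x, w x ^ 6 * φ x :=
      mul_nonneg hδ.le (integral_nonneg fun x => mul_nonneg (by positivity) (hφ0 x))
    linarith
  have e0 : (a + b * A) * -(∫ x, |w x| * L x) + (V₀ + c₀) * (∫ x, |w x| * φ x) = lhs₀ := by
    simp [lhs₀]
  rw [hLap _ _ Hw.abs, e0]
  refine le_of_forall_pos_le_add fun ε hε => ?_
  have hden : 0 < Cφ * K + 1 := by positivity
  refine (key (ε / (Cφ * K + 1)) (by positivity)).trans ?_
  have : ε / (Cφ * K + 1) * (Cφ * K) ≤ ε := by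
    rw [div_mul_eq_mul_div, div_le_iff₀ hden]
    nlinarith
  linarith

end Limit

theorem tendsto_integral_inner_of_eLpNorm {E : Type*} [NormedAddCommGroup E]
    [InnerProductSpace ℝ E] {F G : ℕ → R3 → E} {F₀ G₀ : R3 → E} (hF : ∀ n, MemLp (F n) 2 volume)
    (hF₀ : MemLp F₀ 2 volume) (hG : ∀ n, MemLp (G n) 2 volume) (hG₀ : MemLp G₀ 2 volume)
    (h : Tendsto (fun n => eLpNorm (fun x => F n x - F₀ x) 2 volume) atTop (𝓝 0))
    (h' : Tendsto (fun n => eLpNorm (fun x => G n x - G₀ x) 2 volume) atTop (𝓝 0)) :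
    Tendsto (fun n => ∫ x, inner ℝ (F n x) (G n x)) atTop (𝓝 (∫ x, inner ℝ (F₀ x) (G₀ x))) := by
  have h1 : Tendsto (fun n => (hF n).toLp (F n)) atTop (𝓝 (hF₀.toLp F₀)) := by
    rw [Lp.tendsto_Lp_iff_tendsto_eLpNorm'']; exact h
  have h2 : Tendsto (fun n => (hG n).toLp (G n)) atTop (𝓝 (hG₀.toLp G₀)) := by
    rw [Lp.tendsto_Lp_iff_tendsto_eLpNorm'']; exact h'
  have e : ∀ (F G : R3 → E) (hF : MemLp F 2 volume) (hG : MemLp G 2 volume),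
      inner ℝ (hF.toLp F) (hG.toLp G) = ∫ x, inner ℝ (F x) (G x) := by
    intro F G hF hG
    rw [L2.inner_def]
    refine integral_congr_ae ?_
    filter_upwards [hF.coeFn_toLp, hG.coeFn_toLp] with x h1 h2
    simp only [h1, h2]
  have := h1.inner h2 (𝕜 := ℝ)
  simpa only [e] using this

/-! ### Lower bound for the profiles -/

theorem H1Pair.ae_eq_zero_of_integral_grad_eq_zero {w : R3 → ℝ} {h : R3 → R3} (H : H1Pair w h)
    (h0 : ∫ x, ‖h x‖ ^ 2 = 0) : w =ᵐ[volume] 0 := by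
  obtain ⟨S, -, hS⟩ := exists_integral_pow_six_le
  have h1 := hS w h H
  rw [h0] at h1
  have h2 : ∫ x, w x ^ 6 = 0 :=
    le_antisymm (by simpa using h1) (integral_nonneg fun x => by positivity)
  rw [integral_eq_zero_iff_of_nonneg (fun x => by positivity) H.integrable_pow_six] at h2
  filter_upwards [h2] with x hx
  simpa using hx

/-- Let `X` be the gradient energy of `|w|`. Taking `|f(s)| ≤ V₀|s| + C|s|⁵` and the test function
`|w|`, the `V₀` terms cancel and Sobolev leaves `a X ≤ 2 C S X³`. Since `X > 0`, it is bounded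
below, independently of `A`, because the `b A` term has a favorable sign. -/
theorem exists_grad_lower_bound {a b : ℝ} (ha : 0 < a) (hb : 0 < b) {f : ℝ → ℝ} {p μ : ℝ}
    (hf : NonlinearityHyp f p μ) {V₀ : ℝ} (hV₀ : 0 < V₀) :
    ∃ c : ℝ, 0 < c ∧ ∀ (A : ℝ) (w : R3 → ℝ) (h : R3 → R3), 0 ≤ A → H1Pair w h →
      (∀ φ : R3 → ℝ, IsTestFunction φ → (∀ x, 0 ≤ φ x) →
        (a + b * A) * (∫ x, inner ℝ ((w x / |w x|) • h x) (∇ φ x)) + V₀ * (∫ x, |w x| * φ x)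
          ≤ ∫ x, |f (w x)| * φ x) →
      ¬ w =ᵐ[volume] 0 → c ≤ ∫ x, ‖h x‖ ^ 2 := by
  obtain ⟨S, hS, hSob⟩ := exists_integral_pow_six_le
  obtain ⟨C, hC, hfC⟩ := hf.exists_bound hV₀
  -- From `a ≤ 2CS X²` either `X ≥ 1`, or `X² ≤ X` and the quotient is a lower bound; this avoids a
  -- square root, and `+ 1` covers `C = 0`.
  refine ⟨min 1 (a / (2 * C * S + 1)), by positivity, fun A w h hA H hineq hne => ?_⟩
  have Hw := H.abs
  set X : ℝ := ∫ x, ‖(w x / |w x|) • h x‖ ^ 2 with hX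
  have hX0 : 0 ≤ X := integral_nonneg fun x => by positivity
  have hXle : X ≤ ∫ x, ‖h x‖ ^ 2 := by
    refine integral_mono Hw.integrable_grad_sq H.integrable_grad_sq fun x => ?_
    have : ‖(w x / |w x|) • h x‖ ≤ ‖h x‖ := by
      rw [norm_smul]
      exact mul_le_of_le_one_left (norm_nonneg _) (abs_div_abs_le_one _)
    simp only
    gcongr
  have hXpos : 0 < X := by
    refine lt_of_le_of_ne hX0 fun h0 => hne ?_
    filter_upwards [Hw.ae_eq_zero_of_integral_grad_eq_zero h0.symm] with x hx
    simpa using hx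
  -- `|w|` is not a test function, so the inequality is used along nonnegative test functions
  -- converging to it in `H¹`.
  obtain ⟨φ, hφ, h1, h2, -, h3⟩ := Hw.exists_seq_test
  have hφ0 := h3 fun x => abs_nonneg _
  have c0 : Tendsto (fun _ : ℕ => eLpNorm (fun x => (w x / |w x|) • h x - (w x / |w x|) • h x) 2
      (volume : Measure R3)) atTop (𝓝 0) := by simp
  have t1 := tendsto_integral_inner_of_eLpNorm (fun _ => Hw.memLp_grad) Hw.memLp_grad
    (fun n => (hφ n).memLp_gradient 2) Hw.memLp_grad c0 h2
  have t2 := tendsto_integral_inner_of_eLpNorm (fun n => (hφ n).memLp_gradient 2) Hw.memLp_grad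
    (fun n => (hφ n).memLp_gradient 2) Hw.memLp_grad h2 h2
  simp only [real_inner_self_eq_norm_sq] at t1 t2
  have hstep : ∀ n, (a + b * A) * (∫ x, inner ℝ ((w x / |w x|) • h x) (∇ (φ n) x))
      ≤ C * (S * X ^ 3 + S * (∫ x, ‖∇ (φ n) x‖ ^ 2) ^ 3) := by
    intro n
    have Hφ := H1Pair.of_test (hφ n)
    have h4 := hineq (φ n) (hφ n) (hφ0 n)
    have i1 : Integrable fun x => |w x| * φ n x := Hw.memLp.integrable_mul_two Hφ.memLp
    have i2 : Integrable fun x => w x ^ 6 + φ n x ^ 6 :=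
      H.integrable_pow_six.add Hφ.integrable_pow_six
    have h5 : ∫ x, |f (w x)| * φ n x ≤ V₀ * (∫ x, |w x| * φ n x)
        + C * ((∫ x, w x ^ 6) + ∫ x, φ n x ^ 6) := by
      rw [← integral_add H.integrable_pow_six Hφ.integrable_pow_six, ← integral_const_mul,
        ← integral_const_mul, ← integral_add (i1.const_mul _) (i2.const_mul _)]
      refine integral_mono_of_nonneg
        (Eventually.of_forall fun x => mul_nonneg (abs_nonneg _) (hφ0 n x))
        ((i1.const_mul _).add (i2.const_mul _)) (Eventually.of_forall fun x => ?_)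
      have e : φ n x = |φ n x| := (abs_of_nonneg (hφ0 n x)).symm
      calc |f (w x)| * φ n x ≤ (V₀ * |w x| + C * |w x| ^ 5) * φ n x :=
            mul_le_mul_of_nonneg_right (hfC _) (hφ0 n x)
        _ = V₀ * (|w x| * φ n x) + C * (|w x| ^ 5 * |φ n x|) := by rw [← e]; ring
        _ ≤ _ := by
          simp only
          gcongr
          exact abs_pow_five_mul_abs_le _ _
    have e6 : ∀ x, |w x| ^ 6 = w x ^ 6 := fun x => Even.pow_abs (by decide) _
    have h6 := hSob _ _ Hw
    simp only [e6] at h6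
    have h7 := hSob _ _ Hφ
    have h8 := mul_le_mul_of_nonneg_left (add_le_add h6 h7) hC
    linarith
  have hlim := le_of_tendsto_of_tendsto' (t1.const_mul (a + b * A))
    (((t2.pow 3).const_mul S).const_add (S * X ^ 3) |>.const_mul C) hstep
  rw [← hX] at hlim
  have h9 : a * X ≤ 2 * C * S * X ^ 3 := by
    have : 0 ≤ b * A * X := by positivity
    linarith
  have h10 : a ≤ 2 * C * S * X ^ 2 := by
    have : a * X ≤ (2 * C * S * X ^ 2) * X := by linarith
    exact le_of_mul_le_mul_right this hXpos
  refine le_trans ?_ hXle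
  rcases le_total 1 X with h11 | h11
  · exact (min_le_left _ _).trans h11
  · refine (min_le_right _ _).trans ?_
    rw [div_le_iff₀ (by positivity)]
    have h12 : X ^ 2 ≤ X := by nlinarith
    have h13 : 0 ≤ 2 * C * S := by positivity
    nlinarith

/-! ### The weight along a profile -/

theorem exists_integral_ball_pos {w : R3 → ℝ} (hw : MemLp w 2 volume) (hne : ¬ w =ᵐ[volume] 0) :
    ∃ R : ℝ, 0 < ∫ x in Metric.closedBall (0 : R3) R, w x ^ 2 := by
  by_contra hcon
  push Not at hcon
  refine hne ?_
  have h1 : ∀ n : ℕ, ∀ᵐ x, x ∈ Metric.closedBall (0 : R3) n → w x = 0 := by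
    intro n
    rw [← ae_restrict_iff' Metric.isClosed_closedBall.measurableSet]
    have h2 : ∫ x in Metric.closedBall (0 : R3) n, w x ^ 2 = 0 :=
      le_antisymm (hcon n) (integral_nonneg fun x => sq_nonneg _)
    rw [integral_eq_zero_iff_of_nonneg (fun x => sq_nonneg _) hw.integrable_sq'.restrict] at h2
    filter_upwards [h2] with x hx
    simpa using hx
  filter_upwards [ae_all_iff.2 h1] with x hx
  obtain ⟨n, hn⟩ := exists_nat_ge ‖x‖
  exact hx n (by simpa using hn)

theorem tendsto_setIntegral_sq {s : Set R3} (hs : MeasurableSet s) {v : ℕ → R3 → ℝ}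
    {w : R3 → ℝ} (hv : ∀ n, MemLp (v n) 2 volume) (hw : MemLp w 2 volume)
    (h : Tendsto (fun n => eLpNorm (fun x => v n x - w x) 2 (volume.restrict s)) atTop (𝓝 0)) :
    Tendsto (fun n => ∫ x in s, v n x ^ 2) atTop (𝓝 (∫ x in s, w x ^ 2)) := by
  have h' : Tendsto (fun n => eLpNorm (fun x => s.indicator (v n) x - s.indicator w x) 2 volume)
      atTop (𝓝 0) := by
    refine h.congr fun n => ?_
    rw [← eLpNorm_indicator_eq_eLpNorm_restrict hs]
    refine eLpNorm_congr_ae (Eventually.of_forall fun x => ?_)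
    by_cases hx : x ∈ s <;> simp [hx]
  have e : ∀ v : R3 → ℝ, ∫ x, inner ℝ (s.indicator v x) (s.indicator v x)
      = ∫ x in s, v x ^ 2 := by
    intro v
    rw [← integral_indicator hs]
    refine integral_congr_ae (Eventually.of_forall fun x => ?_)
    by_cases hx : x ∈ s <;> simp [hx, pow_two]
  have hi : ∀ n, MemLp (s.indicator (v n)) 2 volume := fun n => (hv n).indicator hs
  have hi₀ : MemLp (s.indicator w) 2 volume := hw.indicator hs
  have h1 : Tendsto (fun n => ∫ x, inner ℝ (s.indicator (v n) x) (s.indicator (v n) x)) atTop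
      (𝓝 (∫ x, inner ℝ (s.indicator w x) (s.indicator w x))) :=
    tendsto_integral_inner_of_eLpNorm (F := fun n => s.indicator (v n)) (F₀ := s.indicator w)
      (G := fun n => s.indicator (v n)) (G₀ := s.indicator w) hi hi₀ hi hi₀ h' h'
  simp only [e] at h1
  exact h1

/-- A nonzero local limit keeps a fixed amount of mass of `u_n` in a ball around `y_n`, where `W` is
at least `W(y_n) - R^α`. A large `λ_n W(y_n)` would contradict the bound on the weighted energy. -/
theorem BoundedSols.exists_weight_bound {a b : ℝ} {f : ℝ → ℝ} {V : R3 → ℝ} {α r : ℝ}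
    {lam : ℕ → ℝ} {u : ℕ → R3 → ℝ} {g : ℕ → R3 → R3} {K : ℝ}
    (B : BoundedSols a b f V α r lam u g K) (hα : 0 < α) (hα1 : α ≤ 1) {y : ℕ → R3} {w : R3 → ℝ}
    {h : R3 → R3} (hw : WeakL2 (fun n x => u n (x + y n)) w)
    (hh : WeakL2 (fun n x => g n (x + y n)) h) (hne : ¬ w =ᵐ[volume] 0) :
    ∃ Λ : ℝ, ∀ᶠ n in atTop, lam n * weightW α (y n) ≤ Λ := by
  obtain ⟨R, hR⟩ := exists_integral_ball_pos hw.memLp_lim hne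
  have Hv := fun n => B.pair_translate y n
  have hlim := tendsto_setIntegral_sq
    Metric.isClosed_closedBall.measurableSet (fun n => (Hv n).memLp) hw.memLp_lim
    (tendsto_eLpNorm_sub_restrict_ball Hv hw hh (B.sq_translate_le y) (B.grad_translate_le y) R)
  set m := ∫ x in Metric.closedBall (0 : R3) R, w x ^ 2
  have hl : ∀ᶠ n in atTop, lam n * R ^ α ≤ 1 := by
    have := B.lam_tendsto.mul_const (R ^ α)
    rw [zero_mul] at this
    exact this.eventually_le_const one_pos
  -- Eventually at least half of the limit mass `m` is present, and the `+ 1` pays for `λ_n R^α ≤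
  -- 1`.
  refine ⟨K / (m / 2) + 1, ?_⟩
  filter_upwards [hl, hlim.eventually_const_le (half_lt_self hR)] with n hn hmn
  have hWi : Integrable fun x => lam n * weightW α (x + y n) * u n (x + y n) ^ 2 :=
    (B.sol n).weight.comp_add_right (y n)
  have hW0 : ∀ x, 0 ≤ lam n * weightW α x := fun x =>
    mul_nonneg (B.lam_nonneg n) (weightW_nonneg α x)
  have h1 : (lam n * weightW α (y n) - lam n * R ^ α)
      * (∫ x in Metric.closedBall (0 : R3) R, u n (x + y n) ^ 2) ≤ K := by
    calc _ = ∫ x in Metric.closedBall (0 : R3) R,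
          (lam n * weightW α (y n) - lam n * R ^ α) * u n (x + y n) ^ 2 := by
          rw [integral_const_mul]
      _ ≤ ∫ x in Metric.closedBall (0 : R3) R,
            lam n * weightW α (x + y n) * u n (x + y n) ^ 2 := by
          refine setIntegral_mono_on ((Hv n).integrable_sq.integrableOn.const_mul _)
            hWi.integrableOn Metric.isClosed_closedBall.measurableSet fun x hx => ?_
          have h2 : ‖x‖ ^ α ≤ R ^ α := by
            have : ‖x‖ ≤ R := by simpa using hx
            gcongr
          have h3 := mul_le_mul_of_nonneg_left
            ((weightW_le_add hα hα1 x (y n)).trans (add_le_add_right h2 _)) (B.lam_nonneg n)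
          have h4 := sq_nonneg (u n (x + y n))
          nlinarith
      _ ≤ ∫ x, lam n * weightW α (x + y n) * u n (x + y n) ^ 2 :=
          setIntegral_le_integral hWi
            (Eventually.of_forall fun x => mul_nonneg (hW0 _) (sq_nonneg _))
      _ = ∫ x, lam n * weightW α x * u n x ^ 2 :=
          integral_add_right_eq_self (fun x => lam n * weightW α x * u n x ^ 2) _
      _ ≤ K := B.weight_le n
  have hm : 0 < m / 2 := half_pos hR
  have hK : 0 ≤ K := (integral_nonneg fun x => sq_nonneg _).trans (B.sq_le 0)
  by_contra hcon
  have h5 : K / (m / 2) < lam n * weightW α (y n) - lam n * R ^ α := by linarith [not_le.1 hcon]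
  rw [div_lt_iff₀ hm] at h5
  have h6 : 0 ≤ lam n * weightW α (y n) - lam n * R ^ α := by
    have : 0 ≤ K / (m / 2) := by positivity
    linarith [not_le.1 hcon]
  nlinarith

/-! ### Remainders of profile decompositions -/

/-- The remainder after subtracting the profiles `W j` centered at `y j n`. -/
def remainder {E ι : Type*} [AddCommGroup E] [Fintype ι] (v : ℕ → R3 → E) (W : ι → R3 → E)
    (y : ι → ℕ → R3) (n : ℕ) (x : R3) : E :=
  v n x - ∑ j, W j (x - y j n)

theorem memLp_comp_sub_right {X : Type*} [NormedAddCommGroup X] {f : R3 → X} {p : ENNReal}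
    (hf : MemLp f p volume) (y : R3) : MemLp (fun x => f (x - y)) p volume := by
  simpa only [sub_eq_add_neg] using memLp_comp_add_right hf (-y)

theorem H1Pair.comp_sub_right {u : R3 → ℝ} {g : R3 → R3} (H : H1Pair u g) (y : R3) :
    H1Pair (fun x => u (x - y)) (fun x => g (x - y)) := by
  simpa only [sub_eq_add_neg] using H.comp_add_right (-y)

theorem eLpNorm_comp_sub_right {X : Type*} [NormedAddCommGroup X] {f : R3 → X} {p : ENNReal}
    (hf : AEStronglyMeasurable f volume) (y : R3) :
    eLpNorm (fun x => f (x - y)) p volume = eLpNorm f p volume := by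
  simpa only [sub_eq_add_neg] using eLpNorm_comp_add_right hf (-y)

section Bounds

variable {E ι : Type*} [NormedAddCommGroup E] [Fintype ι] {v : ℕ → R3 → E} {y : ι → ℕ → R3}
  {W : ι → R3 → E}

theorem memLp_remainder (hv : ∀ n, MemLp (v n) 2 volume) (hW : ∀ j, MemLp (W j) 2 volume)
    (n : ℕ) : MemLp (remainder v W y n) 2 volume :=
  (hv n).sub (memLp_finsetSum _ fun j _ => memLp_comp_sub_right (hW j) _)

theorem eLpNorm_remainder_le (hv : ∀ n, MemLp (v n) 2 volume) (hW : ∀ j, MemLp (W j) 2 volume)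
    (n : ℕ) : eLpNorm (remainder v W y n) 2 volume
      ≤ eLpNorm (v n) 2 volume + ∑ j, eLpNorm (W j) 2 volume := by
  have hW' := fun j => memLp_comp_sub_right (hW j) (y j n)
  have hs : MemLp (∑ j, fun x => W j (x - y j n)) 2 volume := memLp_finsetSum' _ fun j _ => hW' j
  have e : remainder v W y n = v n - ∑ j, fun x => W j (x - y j n) := by
    ext1 x; simp [remainder]
  rw [e]
  refine (eLpNorm_sub_le (hv n).1 hs.1 (by norm_num)).trans ?_
  gcongr
  refine (eLpNorm_sum_le (fun j _ => (hW' j).1) (by norm_num)).trans (le_of_eq ?_)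
  exact Finset.sum_congr rfl fun j _ => eLpNorm_comp_sub_right (hW j).1 _

end Bounds

section Remainder

variable {E ι : Type*} [NormedAddCommGroup E] [InnerProductSpace ℝ E] [Fintype ι]
  {v : ℕ → R3 → E} {y : ι → ℕ → R3} {W φ : ι → R3 → E}

theorem weakL2_translate_sub {ψ : R3 → E} (hψ : MemLp ψ 2 volume) {η y : ℕ → R3}
    (h : Tendsto (fun n => ‖η n - y n‖) atTop atTop) :
    WeakL2 (fun n x => ψ (x + η n - y n)) (fun _ => 0) := by
  simpa only [add_sub_assoc] using weakL2_translate_of_tendsto_norm hψ h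

theorem weakL2_sum_translate (hφ : ∀ j, MemLp (φ j) 2 volume) {η : ℕ → R3}
    (hd : ∀ j, Tendsto (fun n => ‖η n - y j n‖) atTop atTop) :
    WeakL2 (fun n x => ∑ j, φ j (x + η n - y j n)) (fun _ => 0) := by
  simpa using WeakL2.sum Finset.univ fun j _ => weakL2_translate_sub (hφ j) (hd j)

/-- Seen from center `i`, the pieces at all other centers drift to infinity and vanish weakly.
Taking the `φ j` to be the true profiles gives limit zero; taking test functions near them gives the
approximation error. -/
theorem weakL2_remainder (hφ : ∀ j, MemLp (φ j) 2 volume)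
    (hd : ∀ i j, i ≠ j → Tendsto (fun n => ‖y j n - y i n‖) atTop atTop) (i : ι)
    (hv : WeakL2 (fun n x => v n (x + y i n)) (W i)) :
    WeakL2 (fun n x => remainder v φ y n (x + y i n)) (fun x => W i x - φ i x) := by
  classical
  have h1 : ∀ j, WeakL2 (fun n x => φ j (x + y i n - y j n))
      (fun x => if j = i then φ i x else 0) := by
    intro j
    by_cases hj : j = i
    · subst hj
      simpa using WeakL2.const (hφ j)
    · simpa only [hj, if_false] using weakL2_translate_sub (hφ j) (hd j i hj)
  have h2 := hv.sub (WeakL2.sum Finset.univ fun j _ => h1 j)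
  simpa [remainder] using h2

/-- With `z` the remainder, `‖v‖² - ‖z‖² = ⟨v + z, v - z⟩`, and `v - z` is the sum of translated
profiles. Recentered at `y j`, the sequence `v` tends weakly to `W j` and `z` to zero, so no cross
term between profiles has to be estimated. -/
theorem tendsto_energy_sub (hvL : ∀ n, MemLp (v n) 2 volume)
    (hv : ∀ i, WeakL2 (fun n x => v n (x + y i n)) (W i))
    (hd : ∀ i j, i ≠ j → Tendsto (fun n => ‖y j n - y i n‖) atTop atTop) :
    Tendsto (fun n => (∫ x, ‖v n x‖ ^ 2) - ∫ x, ‖remainder v W y n x‖ ^ 2) atTop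
      (𝓝 (∑ j, ∫ x, ‖W j x‖ ^ 2)) := by
  have hW : ∀ j, MemLp (W j) 2 volume := fun j => (hv j).memLp_lim
  have hz := memLp_remainder (y := y) hvL hW
  have hlim : ∀ j, Tendsto (fun n => ∫ x, inner ℝ
      (v n (x + y j n) + remainder v W y n (x + y j n)) (W j x)) atTop
      (𝓝 (∫ x, ‖W j x‖ ^ 2)) := by
    intro j
    have h1 := ((hv j).add (weakL2_remainder hW hd j (hv j))).tendsto (W j) (hW j)
    simpa only [sub_self, add_zero, real_inner_self_eq_norm_sq] using h1
  refine (tendsto_finsetSum Finset.univ fun j _ => hlim j).congr fun n => ?_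
  have e1 : ∀ j, ∫ x, inner ℝ (v n (x + y j n) + remainder v W y n (x + y j n)) (W j x)
      = ∫ x, inner ℝ (v n x + remainder v W y n x) (W j (x - y j n)) := by
    intro j
    rw [← integral_add_right_eq_self
      (fun x => inner ℝ (v n x + remainder v W y n x) (W j (x - y j n))) (y j n)]
    simp
  have hi : ∀ j, Integrable fun x =>
      inner ℝ (v n x + remainder v W y n x) (W j (x - y j n)) := fun j =>
    MemLp.integrable_inner_two ((hvL n).add (hz n)) (memLp_comp_sub_right (hW j) _)
  simp only [e1]
  rw [← integral_finsetSum _ fun j _ => hi j,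
    ← integral_sub (hvL n).integrable_normsq (hz n).integrable_normsq]
  congr 1 with x
  rw [← inner_sum]
  have e2 : ∑ j, W j (x - y j n) = v n x - remainder v W y n x := by
    simp [remainder]
  rw [e2, inner_add_left, inner_sub_right, inner_sub_right, real_inner_self_eq_norm_sq,
    real_inner_self_eq_norm_sq, real_inner_comm (v n x)]
  ring

end Remainder

theorem h1Pair_remainder {ι : Type*} [Fintype ι] {u : ℕ → R3 → ℝ} {g : ℕ → R3 → R3}
    {w : ι → R3 → ℝ} {h : ι → R3 → R3} (H : ∀ n, H1Pair (u n) (g n)) (Hw : ∀ j, H1Pair (w j) (h j))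
    (y : ι → ℕ → R3) (n : ℕ) : H1Pair (remainder u w y n) (remainder g h y n) :=
  (H n).sub (H1Pair.sum _ fun j _ => (Hw j).comp_sub_right _)

/-! ### Profiles -/

/-- A partial profile decomposition of a sequence: the profile with index `0` is the weak limit of
the sequence itself, the others are nonzero weak limits of translates. -/
structure IsProfile (u : ℕ → R3 → ℝ) (g : ℕ → R3 → R3) (k : ℕ) (σ : ℕ → ℕ)
    (y : Fin (k + 1) → ℕ → R3) (w : Fin (k + 1) → R3 → ℝ) (h : Fin (k + 1) → R3 → R3) : Prop where
  strictMono : StrictMono σ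
  center_zero : ∀ n, y 0 n = 0
  weak : ∀ j, WeakL2 (fun n x => u (σ n) (x + y j n)) (w j)
  weak_grad : ∀ j, WeakL2 (fun n x => g (σ n) (x + y j n)) (h j)
  diverge : ∀ i j, i ≠ j → Tendsto (fun n => ‖y j n - y i n‖) atTop atTop
  ne_zero : ∀ j, j ≠ 0 → ¬ w j =ᵐ[volume] 0

namespace IsProfile

variable {u : ℕ → R3 → ℝ} {g : ℕ → R3 → R3} {k : ℕ} {σ : ℕ → ℕ} {y : Fin (k + 1) → ℕ → R3}
  {w : Fin (k + 1) → R3 → ℝ} {h : Fin (k + 1) → R3 → R3}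

theorem comp (P : IsProfile u g k σ y w h) {τ : ℕ → ℕ} (hτ : StrictMono τ) :
    IsProfile u g k (fun n => σ (τ n)) (fun j n => y j (τ n)) w h :=
  ⟨P.strictMono.comp hτ, fun _ => P.center_zero _, fun j => (P.weak j).comp hτ,
    fun j => (P.weak_grad j).comp hτ, fun i j hij => (P.diverge i j hij).comp hτ.tendsto_atTop,
    P.ne_zero⟩

theorem pair (P : IsProfile u g k σ y w h) (H : ∀ n, H1Pair (u n) (g n)) (j : Fin (k + 1)) :
    H1Pair (w j) (h j) :=
  H1Pair.of_weakL2 (fun n => (H (σ n)).comp_add_right (y j n)) (P.weak j) (P.weak_grad j)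

end IsProfile

section Existence

variable {u : ℕ → R3 → ℝ} {g : ℕ → R3 → R3} {K : ℝ}

theorem exists_weak_h1_subseq (H : ∀ n, H1Pair (u n) (g n)) (hK : ∀ n, ∫ x, u n x ^ 2 ≤ K)
    (hK' : ∀ n, ∫ x, ‖g n x‖ ^ 2 ≤ K) :
    ∃ (σ : ℕ → ℕ) (w : R3 → ℝ) (h : R3 → R3), StrictMono σ ∧ WeakL2 (fun n => u (σ n)) w ∧
      WeakL2 (fun n => g (σ n)) h := by
  obtain ⟨σ, w, hσ, hw⟩ := exists_weakL2_subseq (fun n => (H n).memLp) (C := ENNReal.ofReal √K)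
    ENNReal.ofReal_ne_top fun n => eLpNorm_two_le_of_integral_le (H n).memLp (by simpa using hK n)
  obtain ⟨τ, h, hτ, hh⟩ := exists_weakL2_subseq (fun n => (H (σ n)).memLp_grad)
    (C := ENNReal.ofReal √K) ENNReal.ofReal_ne_top fun n =>
      eLpNorm_two_le_of_integral_le (H (σ n)).memLp_grad (hK' (σ n))
  exact ⟨fun n => σ (τ n), w, h, hσ.comp hτ, hw.comp hτ, hh⟩

theorem exists_isProfile_zero (H : ∀ n, H1Pair (u n) (g n)) (hK : ∀ n, ∫ x, u n x ^ 2 ≤ K)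
    (hK' : ∀ n, ∫ x, ‖g n x‖ ^ 2 ≤ K) : ∃ σ y w h, IsProfile u g 0 σ y w h := by
  obtain ⟨σ, w, h, hσ, hw, hh⟩ := exists_weak_h1_subseq H hK hK'
  refine ⟨σ, fun _ _ => 0, fun _ => w, fun _ => h, hσ, fun _ => rfl, fun _ => by simpa using hw,
    fun _ => by simpa using hh, fun i j hij => absurd (Fin.ext (by omega)) hij,
    fun j hj => absurd (Fin.ext (by omega)) hj⟩

/-- A ball around `η` is contained in a larger ball around the nearby point `y`. This transfers
local convergence seen from `y` to balls whose centers stay within bounded distance of it. -/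
theorem eLpNorm_restrict_closedBall_le {z : R3 → ℝ} {R B : ℝ} {η y : R3} (hy : ‖η - y‖ ≤ B) :
    eLpNorm z 2 (volume.restrict (Metric.closedBall η R))
      ≤ eLpNorm (fun x => z (x + y)) 2 (volume.restrict (Metric.closedBall 0 (R + B))) := by
  have hms : ∀ (c : R3) (ρ : ℝ), MeasurableSet (Metric.closedBall c ρ) := fun c ρ =>
    Metric.isClosed_closedBall.measurableSet
  have hmp : MeasurePreserving (fun x : R3 => x + y)
      (volume.restrict ((fun x => x + y) ⁻¹' Metric.closedBall η R))
      (volume.restrict (Metric.closedBall η R)) :=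
    (measurePreserving_add_right volume y).restrict_preimage (hms _ _)
  have hme : MeasurableEmbedding (fun x : R3 => x + y) := measurableEmbedding_addRight y
  have e : eLpNorm z 2 (volume.restrict (Metric.closedBall η R))
      = eLpNorm (fun x => z (x + y)) 2
        (volume.restrict ((fun x => x + y) ⁻¹' Metric.closedBall η R)) := by
    rw [← hmp.map_eq, hme.eLpNorm_map_measure]
    rfl
  rw [e]
  refine eLpNorm_mono_measure _ (Measure.restrict_mono (fun x hx => ?_) le_rfl)
  simp only [Set.mem_preimage, Metric.mem_closedBall, dist_eq_norm, sub_zero] at hx ⊢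
  calc ‖x‖ = ‖(x + y - η) + (η - y)‖ := by congr 1; abel
    _ ≤ R + B := (norm_add_le _ _).trans (add_le_add hx hy)

/-- Balls in which the remainder keeps mass `ε` supply the new center. It must diverge from the old
ones, around which the remainder tends to zero locally. The new weak limit is nonzero, since
otherwise local compactness would remove the mass. -/
theorem IsProfile.exists_succ (H : ∀ n, H1Pair (u n) (g n)) (hK : ∀ n, ∫ x, u n x ^ 2 ≤ K)
    (hK' : ∀ n, ∫ x, ‖g n x‖ ^ 2 ≤ K) {k : ℕ} {σ : ℕ → ℕ} {y : Fin (k + 1) → ℕ → R3}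
    {w : Fin (k + 1) → R3 → ℝ} {h : Fin (k + 1) → R3 → R3} (P : IsProfile u g k σ y w h) {R : ℝ}
    {ε : ENNReal} (hε : ε ≠ 0) (hfr : ∃ᶠ n in atTop, ∃ c, ε < eLpNorm
      (remainder (fun n => u (σ n)) w y n) 2 (volume.restrict (Metric.closedBall c R))) :
    ∃ σ y w h, IsProfile u g (k + 1) σ y w h := by
  obtain ⟨τ, hτ, hτc⟩ := extraction_of_frequently_atTop hfr
  choose η hη using hτc
  have Hσ : ∀ n, H1Pair (u (σ (τ n))) (g (σ (τ n))) := fun n => H _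
  have Pτ := P.comp hτ
  have Hw := P.pair H
  let z := remainder (fun n => u (σ (τ n))) w (fun j n => y j (τ n))
  let G := remainder (fun n => g (σ (τ n))) h (fun j n => y j (τ n))
  have Hz : ∀ n, H1Pair (z n) (G n) := h1Pair_remainder Hσ Hw _
  have hzη : ∀ n, ε < eLpNorm (z n) 2 (volume.restrict (Metric.closedBall (η n) R)) := hη
  let C : ENNReal := (ENNReal.ofReal √K + ∑ j, eLpNorm (w j) 2 volume)
    + (ENNReal.ofReal √K + ∑ j, eLpNorm (h j) 2 volume)
  have hC : C ≠ ⊤ := by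
    have h1 : ∑ j, eLpNorm (w j) 2 volume ≠ ⊤ :=
      ENNReal.sum_ne_top.2 fun j _ => (Hw j).memLp.eLpNorm_ne_top
    have h2 : ∑ j, eLpNorm (h j) 2 volume ≠ ⊤ :=
      ENNReal.sum_ne_top.2 fun j _ => (Hw j).memLp_grad.eLpNorm_ne_top
    finiteness
  have hzC : ∀ n, eLpNorm (z n) 2 volume ≤ C := fun n =>
    ((eLpNorm_remainder_le (fun n => (Hσ n).memLp) (fun j => (Hw j).memLp) n).trans
      (add_le_add_left (eLpNorm_two_le_of_integral_le (Hσ n).memLp (by simpa using hK _)) _)).trans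
      le_self_add
  have hGC : ∀ n, eLpNorm (G n) 2 volume ≤ C := fun n =>
    ((eLpNorm_remainder_le (fun n => (Hσ n).memLp_grad) (fun j => (Hw j).memLp_grad) n).trans
      (add_le_add_left (eLpNorm_two_le_of_integral_le (Hσ n).memLp_grad (hK' _)) _)).trans
      le_add_self
  have hloc : ∀ {c : ℕ → R3}, WeakL2 (fun n x => z n (x + c n)) (fun _ => 0) → ∀ ρ : ℝ,
      Tendsto (fun n => eLpNorm (fun x => z n (x + c n)) 2
        (volume.restrict (Metric.closedBall 0 ρ))) atTop (𝓝 0) := fun {c} hc ρ =>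
    tendsto_eLpNorm_restrict_ball (fun n => (Hz n).comp_add_right (c n)) hc hC
      (fun n => by rw [eLpNorm_comp_add_right (Hz n).memLp.1]; exact hzC n)
      (fun n => by rw [eLpNorm_comp_add_right (Hz n).memLp_grad.1]; exact hGC n) ρ
  -- If the new center were within distance `B` of an old one, its ball of radius `R` would lie in
  -- the ball of radius `R + B` around the latter, where the remainder tends to zero.
  have hdiv : ∀ j, Tendsto (fun n => ‖η n - y j (τ n)‖) atTop atTop := by
    intro j
    rw [tendsto_atTop]
    intro B
    have hw0 : WeakL2 (fun n x => z n (x + y j (τ n))) (fun _ => 0) := by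
      simpa using weakL2_remainder (fun j => (Hw j).memLp) Pτ.diverge j (Pτ.weak j)
    have h2 := ENNReal.tendsto_nhds_zero.1 (hloc hw0 (R + B)) ε (pos_iff_ne_zero.2 hε)
    filter_upwards [h2] with n hn
    by_contra hcon
    exact absurd ((eLpNorm_restrict_closedBall_le (not_le.1 hcon).le).trans hn) (not_le.2 (hzη n))
  obtain ⟨s, w', h', hs, hw', hh'⟩ := exists_weak_h1_subseq
    (fun n => (Hσ n).comp_add_right (η n)) (K := K)
    (fun n => by rw [integral_add_right_eq_self (fun x => u (σ (τ n)) x ^ 2)]; exact hK _)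
    (fun n => by rw [integral_add_right_eq_self (fun x => ‖g (σ (τ n)) x‖ ^ 2)]; exact hK' _)
  have Ps := Pτ.comp hs
  have hdivs := fun j => (hdiv j).comp hs.tendsto_atTop
  have hne : ¬ w' =ᵐ[volume] 0 := by
    intro h0
    -- At the new center the old profiles vanish weakly, so `u_n` and the remainder have the same
    -- weak limit there.
    have h1 : WeakL2 (fun n x => z (s n) (x + η (s n))) (fun _ => 0) := by
      have h2 := (hw'.congr_lim h0).sub (weakL2_sum_translate (fun j => (Hw j).memLp) hdivs)
      simpa [z, remainder] using h2
    have h3 := tendsto_eLpNorm_restrict_ball (fun n => (Hz (s n)).comp_add_right (η (s n))) h1 hC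
      (fun n => by rw [eLpNorm_comp_add_right (Hz _).memLp.1]; exact hzC _)
      (fun n => by rw [eLpNorm_comp_add_right (Hz _).memLp_grad.1]; exact hGC _) (R + 0)
    obtain ⟨n, hn⟩ := (ENNReal.tendsto_nhds_zero.1 h3 ε (pos_iff_ne_zero.2 hε)).exists
    exact absurd ((eLpNorm_restrict_closedBall_le (by simp)).trans hn) (not_le.2 (hzη (s n)))
  refine ⟨fun n => σ (τ (s n)), Fin.snoc (α := fun _ => ℕ → R3) (fun j n => y j (τ (s n)))
    (fun n => η (s n)), Fin.snoc (α := fun _ => R3 → ℝ) w w',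
    Fin.snoc (α := fun _ => R3 → R3) h h', Ps.strictMono, fun n => ?_, fun j => ?_, fun j => ?_,
    fun i j => ?_, fun j => ?_⟩
  · have : (0 : Fin (k + 1 + 1)) = Fin.castSucc 0 := rfl
    rw [this, Fin.snoc_castSucc]
    exact Ps.center_zero n
  · refine Fin.lastCases ?_ (fun j => ?_) j
    · simpa only [Fin.snoc_last] using hw'
    · simpa only [Fin.snoc_castSucc] using Ps.weak j
  · refine Fin.lastCases ?_ (fun j => ?_) j
    · simpa only [Fin.snoc_last] using hh'
    · simpa only [Fin.snoc_castSucc] using Ps.weak_grad j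
  · refine Fin.lastCases ?_ (fun i => ?_) i
    · refine Fin.lastCases (fun h => absurd rfl h) (fun j _ => ?_) j
      simp only [Fin.snoc_last, Fin.snoc_castSucc, norm_sub_rev (y j _)]
      exact hdivs j
    · refine Fin.lastCases (fun _ => ?_) (fun j hij => ?_) j
      · simp only [Fin.snoc_last, Fin.snoc_castSucc]
        exact hdivs i
      · simp only [Fin.snoc_castSucc]
        exact Ps.diverge i j fun h => hij (by rw [h])
  · refine Fin.lastCases (fun _ => ?_) (fun j hj => ?_) j
    · simpa only [Fin.snoc_last] using hne
    · simpa only [Fin.snoc_castSucc] using Ps.ne_zero j fun h => hj (by rw [h]; rfl)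

end Existence

/-! ### Maximal profile decompositions -/

theorem IsProfile.sum_grad_le {u : ℕ → R3 → ℝ} {g : ℕ → R3 → R3} {K : ℝ} {k : ℕ} {σ : ℕ → ℕ}
    {y : Fin (k + 1) → ℕ → R3} {w : Fin (k + 1) → R3 → ℝ} {h : Fin (k + 1) → R3 → R3}
    (P : IsProfile u g k σ y w h) (hK : ∀ n, ∫ x, ‖g n x‖ ^ 2 ≤ K) :
    ∑ j, ∫ x, ‖h j x‖ ^ 2 ≤ K := by
  have hm : ∀ n, MemLp (g (σ n)) 2 volume := fun n => by
    simpa [P.center_zero] using (P.weak_grad 0).memLp n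
  refine le_of_tendsto' (tendsto_energy_sub hm P.weak_grad P.diverge) fun n => ?_
  have : 0 ≤ ∫ x, ‖remainder (fun n => g (σ n)) h y n x‖ ^ 2 :=
    integral_nonneg fun x => by positivity
  linarith [hK (σ n)]

section

variable {a b : ℝ} {f : ℝ → ℝ} {p μ : ℝ} {V : R3 → ℝ} {V₀ V₁ : ℝ} {α r : ℝ} {lam : ℕ → ℝ}
  {u : ℕ → R3 → ℝ} {g : ℕ → R3 → R3} {K : ℝ}

/-- If every partial decomposition left mass in some ball, arbitrarily many nonzero profiles could
be extracted. Each carries gradient energy at least `c`, while the total is at most `K`. -/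
theorem BoundedSols.exists_vanishing_profile (B : BoundedSols a b f V α r lam u g K) (ha : 0 < a)
    (hb : 0 < b) (hf : NonlinearityHyp f p μ) (hV : PotentialHyp V V₀ V₁ μ) (hα : 0 < α)
    (hα1 : α ≤ 1) (hr : 4 < r) (hr' : r < 6) {D : ℝ}
    (hD : Tendsto (fun n => ∫ x, ‖g n x‖ ^ 2) atTop (𝓝 D)) (R : ℝ) :
    ∃ k σ y w h, IsProfile u g k σ y w h ∧ ∀ ε : ENNReal, ε ≠ 0 → ∀ᶠ n in atTop, ∀ c,
      eLpNorm (remainder (fun n => u (σ n)) w y n) 2 (volume.restrict (Metric.closedBall c R))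
        ≤ ε := by
  by_contra! hcon
  have hall : ∀ k, ∃ σ y w h, IsProfile u g k σ y w h := by
    intro k
    induction k with
    | zero => exact exists_isProfile_zero B.pair B.sq_le B.grad_le
    | succ k ih =>
      obtain ⟨σ, y, w, h, P⟩ := ih
      obtain ⟨ε, hε, hfr⟩ := hcon k σ y w h P
      exact P.exists_succ B.pair B.sq_le B.grad_le hε hfr
  obtain ⟨c, hc, hlow⟩ := exists_grad_lower_bound ha hb hf hV.V₀_pos
  obtain ⟨N, hN⟩ := exists_nat_gt (K / c)
  obtain ⟨σ, y, w, h, P⟩ := hall N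
  have hD0 : 0 ≤ D := ge_of_tendsto' hD fun n => integral_nonneg fun x => by positivity
  have hj : ∀ j : Fin N, c ≤ ∫ x, ‖h j.succ x‖ ^ 2 := by
    intro j
    refine hlow D _ _ hD0 (P.pair B.pair j.succ) (fun φ hφ hφ0 => ?_)
      (P.ne_zero _ (Fin.succ_ne_zero j))
    have := (B.comp P.strictMono).kato_limit ha hb hf hV hα hα1 hr hr'
      (hD.comp P.strictMono.tendsto_atTop) (y := y j.succ) (c := fun _ => 0)
      (fun n => mul_nonneg (B.lam_nonneg _) (weightW_nonneg α _)) tendsto_const_nhds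
      (P.weak j.succ) (P.weak_grad j.succ) hφ hφ0
    simpa using this
  have h1 := P.sum_grad_le B.grad_le
  rw [Fin.sum_univ_succ] at h1
  have h2 : (N : ℝ) * c ≤ ∑ j : Fin N, ∫ x, ‖h j.succ x‖ ^ 2 := by
    have := Finset.sum_le_sum fun j (_ : j ∈ Finset.univ) => hj j
    simpa using this
  have h3 : 0 ≤ ∫ x, ‖h 0 x‖ ^ 2 := integral_nonneg fun x => by positivity
  rw [div_lt_iff₀ hc] at hN
  linarith

/-- Center zero is the origin, where `λ_n W(0) → 0`; at the other centers the weights are bounded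
because the profiles are nonzero. Compactness of a finite box gives one subsequence for all of them.
-/
theorem BoundedSols.exists_weight_limits (B : BoundedSols a b f V α r lam u g K) (hα : 0 < α)
    (hα1 : α ≤ 1) {k : ℕ} {σ : ℕ → ℕ} {y : Fin (k + 1) → ℕ → R3} {w : Fin (k + 1) → R3 → ℝ}
    {h : Fin (k + 1) → R3 → R3} (P : IsProfile u g k σ y w h) :
    ∃ (τ : ℕ → ℕ) (c : Fin (k + 1) → ℝ), StrictMono τ ∧ ∀ j, 0 ≤ c j ∧
      Tendsto (fun n => lam (σ (τ n)) * weightW α (y j (τ n))) atTop (𝓝 (c j)) := by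
  have hW0 : ∀ j n, 0 ≤ lam (σ n) * weightW α (y j n) := fun j n =>
    mul_nonneg (B.lam_nonneg _) (weightW_nonneg α _)
  have hbd : ∀ j, ∃ Λ : ℝ, ∀ᶠ n in atTop, lam (σ n) * weightW α (y j n) ≤ Λ := by
    intro j
    rcases eq_or_ne j 0 with rfl | hj
    · have h1 : Tendsto (fun n => lam (σ n) * weightW α (y 0 n)) atTop (𝓝 0) := by
        simp only [P.center_zero]
        simpa using (B.lam_tendsto.comp P.strictMono.tendsto_atTop).mul_const (weightW α 0)
      exact ⟨1, (h1.eventually_lt_const one_pos).mono fun n hn => hn.le⟩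
    · exact (B.comp P.strictMono).exists_weight_bound hα hα1 (P.weak j) (P.weak_grad j)
        (P.ne_zero j hj)
  choose Λ hΛ using hbd
  have hcpt : IsCompact (Set.univ.pi fun j => Set.Icc 0 (Λ j)) :=
    isCompact_univ_pi fun j => isCompact_Icc
  obtain ⟨c, hc, τ, hτ, hlim⟩ := hcpt.tendsto_subseq'
    (x := fun n j => lam (σ n) * weightW α (y j n))
    ((eventually_all.2 hΛ).mono fun n hn j _ => ⟨hW0 j n, hn j⟩).frequently
  exact ⟨τ, c, hτ, fun j => ⟨(hc j (Set.mem_univ _)).1, (tendsto_pi_nhds.1 hlim) j⟩⟩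

end

/-! ### The energy of the remainder -/

theorem IsTestFunction.add {φ ψ : R3 → ℝ} (hφ : IsTestFunction φ) (hψ : IsTestFunction ψ) :
    IsTestFunction (fun x => φ x + ψ x) :=
  ⟨hφ.1.add hψ.1, hφ.2.add hψ.2⟩

theorem IsTestFunction.sum {ι : Type*} (s : Finset ι) {φ : ι → R3 → ℝ}
    (hφ : ∀ i, IsTestFunction (φ i)) : IsTestFunction (fun x => ∑ i ∈ s, φ i x) := by
  classical
  induction s using Finset.induction_on with
  | empty =>
    simp only [Finset.sum_empty]
    exact ⟨contDiff_const, HasCompactSupport.zero⟩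
  | insert i s hi ih =>
    simp only [Finset.sum_insert hi]
    exact (hφ i).add ih

theorem IsTestFunction.comp_sub_right {φ : R3 → ℝ} (hφ : IsTestFunction φ) (y : R3) :
    IsTestFunction (fun x => φ (x - y)) := by
  simpa only [sub_eq_add_neg] using hφ.comp_add_right (-y)

/-- The equation is tested with `u - s`. Writing `g = (g - k) + k` and `u = (u - s) + s` isolates
the energy of the difference, and the mixed terms go to the right. Smoothness and compact support of
`s` make its weighted norm finite, which is not known for the profiles. -/
theorem IsWeakSol.energy_sub_le {a b : ℝ} {f : ℝ → ℝ} {μ : ℝ} {V : R3 → ℝ} {V₀ V₁ : ℝ}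
    {α r lam : ℝ} {u : R3 → ℝ} {g : R3 → R3} (ha : 0 < a) (hb : 0 < b)
    (hV : PotentialHyp V V₀ V₁ μ) (hα : 0 < α) (hr : 4 < r)
    (hr' : r < 6) (hlam : 0 ≤ lam) (hu : IsWeakSol a b f V α r lam u g) {s : R3 → ℝ}
    (hs : IsTestFunction s) {k : R3 → R3} (hk : H1Pair s k) :
    a * (∫ x, ‖g x - k x‖ ^ 2) + V₀ * (∫ x, (u x - s x) ^ 2)
      ≤ (a + b * ∫ x, ‖g x‖ ^ 2) * |∫ x, inner ℝ (k x) (g x - k x)|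
        + (∫ x, (V₁ + lam * weightW α x) * (|u x - s x| * |s x|))
        + (∫ x, |f (u x) * (u x - s x)|)
        + lam * ((∫ x, u x ^ 2) + (∫ x, (u x - s x) ^ 2)
          + ((∫ x, u x ^ 6) + ∫ x, (u x - s x) ^ 6)) := by
  have Hu := hu.pair
  have Hz := Hu.sub hk
  have hW0 : ∀ x, 0 ≤ lam * weightW α x := fun x => mul_nonneg hlam (weightW_nonneg α x)
  have hWc : Continuous fun x => lam * weightW α x := continuous_const.mul (continuous_weightW hα)
  have hWm := hWc.aestronglyMeasurable (μ := (volume : Measure R3))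
  have hsW := hs.integrable_weight hα lam
  have hus := integrable_weight_mul_mul hW0 hWm Hu.memLp.1 (hs.memLp 2).1 hu.weight hsW
  have hzW : Integrable fun x => lam * weightW α x * (u x - s x) ^ 2 := by
    have h1 : Integrable fun x => lam * weightW α x * u x ^ 2 + lam * weightW α x * s x ^ 2 :=
      hu.weight.add hsW
    refine (h1.sub (hus.const_mul 2)).congr (Eventually.of_forall fun x => ?_)
    simp only [Pi.sub_apply]
    ring
  have heq := hu.eq _ _ Hz hzW
  have hVc := hV.contDiff.continuous
  have e1 : ∫ x, inner ℝ (g x) (g x - k x)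
      = (∫ x, ‖g x - k x‖ ^ 2) + ∫ x, inner ℝ (k x) (g x - k x) := by
    rw [← integral_add Hz.integrable_grad_sq (hk.memLp_grad.integrable_inner_two Hz.memLp_grad)]
    congr 1 with x
    rw [← real_inner_self_eq_norm_sq, ← inner_add_left, sub_add_cancel]
  have hQm : MemLp (fun x => (V₁ + lam * weightW α x) * |s x|) 2 volume :=
    ((continuous_const.add hWc).mul hs.continuous.abs).memLp_of_hasCompactSupport
      (HasCompactSupport.mul_left (hs.2.comp_left (g := fun t : ℝ => |t|) abs_zero))
  have iQ : Integrable fun x => (V₁ + lam * weightW α x) * (|u x - s x| * |s x|) :=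
    (Hz.memLp.norm.integrable_mul_two hQm).congr (Eventually.of_forall fun x => by
      simp only [Real.norm_eq_abs]; ring)
  have iV := integrable_bdd_mul_mul hVc hV.abs_le Hu.memLp Hz.memLp
  have iW := integrable_weight_mul_mul hW0 hWm Hu.memLp.1 Hz.memLp.1 hu.weight hzW
  -- The diagonal part of the weight term is nonnegative and is dropped; `V` is bounded below by
  -- `V₀` in the diagonal part and above by `V₁` in the mixed part.
  have e2 : V₀ * (∫ x, (u x - s x) ^ 2)
      - (∫ x, (V₁ + lam * weightW α x) * (|u x - s x| * |s x|))
      ≤ (∫ x, V x * u x * (u x - s x)) + ∫ x, lam * weightW α x * u x * (u x - s x) := by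
    rw [← integral_const_mul, ← integral_add iV iW,
      ← integral_sub (Hz.integrable_sq.const_mul _) iQ]
    refine integral_mono ((Hz.integrable_sq.const_mul _).sub iQ) (iV.add iW) fun x => ?_
    have h1 := (hV.bounds x).1
    have h2 := (hV.bounds x).2
    have h0 := hV.V₀_pos
    have h3 := hW0 x
    have h4 : -(|u x - s x| * |s x|) ≤ (u x - s x) * s x := by
      rw [← abs_mul]; exact neg_abs_le _
    have h5 : 0 ≤ |u x - s x| * |s x| := by positivity
    have h6 := mul_le_mul_of_nonneg_left h4 (by linarith : 0 ≤ V x + lam * weightW α x)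
    have h7 := mul_le_mul_of_nonneg_right h2 h5
    have h8 := mul_le_mul_of_nonneg_right h1 (sq_nonneg (u x - s x))
    have h9 := mul_nonneg h3 (sq_nonneg (u x - s x))
    have e : V x * u x * (u x - s x) + lam * weightW α x * u x * (u x - s x)
        = V x * (u x - s x) ^ 2 + lam * weightW α x * (u x - s x) ^ 2
          + (V x + lam * weightW α x) * ((u x - s x) * s x) := by ring
    simp only [e]
    linarith
  have e3 : ∫ x, f (u x) * (u x - s x) ≤ ∫ x, |f (u x) * (u x - s x)| :=
    (le_abs_self _).trans abs_integral_le_integral_abs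
  have e4 : ∫ x, |u x| ^ (r - 2) * u x * (u x - s x)
      ≤ (∫ x, u x ^ 2) + (∫ x, (u x - s x) ^ 2) + ((∫ x, u x ^ 6) + ∫ x, (u x - s x) ^ 6) := by
    have j1 : Integrable fun x => u x ^ 2 + (u x - s x) ^ 2 :=
      Hu.integrable_sq.add Hz.integrable_sq
    have j2 : Integrable fun x => u x ^ 6 + (u x - s x) ^ 6 :=
      Hu.integrable_pow_six.add Hz.integrable_pow_six
    rw [← integral_add Hu.integrable_sq Hz.integrable_sq,
      ← integral_add Hu.integrable_pow_six Hz.integrable_pow_six, ← integral_add j1 j2]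
    exact integral_mono (integrable_rpow_mul_mul hr hr' Hu Hz) (j1.add j2) fun x =>
      (le_abs_self _).trans (abs_rpow_mul_mul_le hr hr' _ _)
  have hD : 0 ≤ ∫ x, ‖g x‖ ^ 2 := integral_nonneg fun x => by positivity
  have hc0 : 0 ≤ a + b * ∫ x, ‖g x‖ ^ 2 := by positivity
  have e5 : a * (∫ x, ‖g x - k x‖ ^ 2)
      - (a + b * ∫ x, ‖g x‖ ^ 2) * |∫ x, inner ℝ (k x) (g x - k x)|
      ≤ (a + b * ∫ x, ‖g x‖ ^ 2) * ∫ x, inner ℝ (g x) (g x - k x) := by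
    have h1 := mul_le_mul_of_nonneg_left (neg_abs_le (∫ x, inner ℝ (k x) (g x - k x))) hc0
    have h2 : 0 ≤ b * (∫ x, ‖g x‖ ^ 2) * ∫ x, ‖g x - k x‖ ^ 2 :=
      mul_nonneg (mul_nonneg hb.le hD) (integral_nonneg fun x => by positivity)
    rw [e1]
    nlinarith
  have e4' := mul_le_mul_of_nonneg_left e4 hlam
  linarith

theorem integral_sq_le_of_eLpNorm_le {X : Type*} [NormedAddCommGroup X] {f : R3 → X}
    (hf : MemLp f 2 volume) {C : ENNReal} (hC : C ≠ ⊤) (h : eLpNorm f 2 volume ≤ C) :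
    ∫ x, ‖f x‖ ^ 2 ≤ C.toReal ^ 2 := by
  have h1 : ENNReal.ofReal (∫ x, ‖f x‖ ^ 2) ≤ C ^ 2 := by
    rw [← eLpNorm_two_sq_eq_ofReal hf]; gcongr
  rw [← ENNReal.toReal_pow]
  exact (ENNReal.ofReal_le_iff_le_toReal (by finiteness)).1 h1

theorem integral_inner_sum_translate {E ι : Type*} [NormedAddCommGroup E] [InnerProductSpace ℝ E]
    [Fintype ι] {ψ : ι → R3 → E} {F : R3 → E} (hψ : ∀ j, MemLp (ψ j) 2 volume)
    (hF : MemLp F 2 volume) (y : ι → R3) :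
    ∫ x, inner ℝ (∑ j, ψ j (x - y j)) (F x) = ∑ j, ∫ x, inner ℝ (ψ j x) (F (x + y j)) := by
  have hi : ∀ j, Integrable fun x => inner ℝ (ψ j (x - y j)) (F x) := fun j =>
    (memLp_comp_sub_right (hψ j) (y j)).integrable_inner_two hF
  simp only [sum_inner]
  rw [integral_finsetSum _ fun j _ => hi j]
  refine Finset.sum_congr rfl fun j _ => ?_
  rw [← integral_add_right_eq_self (fun x => inner ℝ (ψ j (x - y j)) (F x)) (y j)]
  simp

theorem weightW_add_le {α : ℝ} (hα : 0 < α) (hα1 : α ≤ 1) (x y : R3) :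
    weightW α (x + y) ≤ weightW α y + ‖x‖ ^ α := by
  simpa using weightW_le_add hα hα1 (-x) (x + y)

/-- Each translated piece lives within `R j` of its center, so the weight there is at most its value
at the center plus `R j ^ α`. This turns an unbounded weight into the bounded quantities `λ W(y j)`.
-/
theorem integral_weight_abs_mul_sum_le {ι : Type*} [Fintype ι] {α lam Q : ℝ} (hα : 0 < α)
    (hα1 : α ≤ 1) (hlam : 0 ≤ lam) (hQ : 0 ≤ Q) {φ : ι → R3 → ℝ} {z : R3 → ℝ}
    (hφ : ∀ j, IsTestFunction (φ j)) (hz : MemLp z 2 volume) {R : ι → ℝ}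
    (hR : ∀ j x, R j < ‖x‖ → φ j x = 0) (y : ι → R3) :
    ∫ x, (Q + lam * weightW α x) * (|z x| * |∑ j, φ j (x - y j)|)
      ≤ ∑ j, (Q + lam * weightW α (y j) + lam * R j ^ α) * ∫ x, |z (x + y j)| * |φ j x| := by
  have hW0 : ∀ x, 0 ≤ Q + lam * weightW α x := fun x =>
    add_nonneg hQ (mul_nonneg hlam (weightW_nonneg α x))
  have hWc : Continuous fun x => Q + lam * weightW α x :=
    continuous_const.add (continuous_const.mul (continuous_weightW hα))
  have hi : ∀ ψ : R3 → ℝ, IsTestFunction ψ → ∀ z : R3 → ℝ, MemLp z 2 volume →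
      Integrable fun x => (Q + lam * weightW α x) * (|z x| * |ψ x|) := by
    intro ψ hψ z hz
    have hm : MemLp (fun x => (Q + lam * weightW α x) * |ψ x|) 2 volume :=
      (hWc.mul hψ.continuous.abs).memLp_of_hasCompactSupport
        (HasCompactSupport.mul_left (hψ.2.comp_left (g := fun t : ℝ => |t|) abs_zero))
    exact (hz.norm.integrable_mul_two hm).congr (Eventually.of_forall fun x => by
      simp only [Real.norm_eq_abs]; ring)
  have hj := fun j => hi _ ((hφ j).comp_sub_right (y j)) z hz
  calc ∫ x, (Q + lam * weightW α x) * (|z x| * |∑ j, φ j (x - y j)|)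
      ≤ ∫ x, ∑ j, (Q + lam * weightW α x) * (|z x| * |φ j (x - y j)|) := by
        refine integral_mono
          (hi _ (IsTestFunction.sum _ fun j => (hφ j).comp_sub_right (y j)) z hz)
          (integrable_finsetSum _ fun j _ => hj j) fun x => ?_
        simp only
        rw [← Finset.mul_sum, ← Finset.mul_sum]
        have := hW0 x
        gcongr
        exact Finset.abs_sum_le_sum_abs _ _
    _ = ∑ j, ∫ x, (Q + lam * weightW α x) * (|z x| * |φ j (x - y j)|) :=
        integral_finsetSum _ fun j _ => hj j
    _ ≤ _ := by
        refine Finset.sum_le_sum fun j _ => ?_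
        rw [← integral_add_right_eq_self
          (fun x => (Q + lam * weightW α x) * (|z x| * |φ j (x - y j)|)) (y j),
          ← integral_const_mul]
        have i1 : Integrable fun x => |z (x + y j)| * |φ j x| :=
          (memLp_comp_add_right hz (y j)).norm.integrable_mul_two ((hφ j).memLp 2).norm
        refine integral_mono ((hj j).comp_add_right (y j)) (i1.const_mul _) fun x => ?_
        simp only [add_sub_cancel_right]
        by_cases hx : R j < ‖x‖
        · simp [hR j x hx]
        · have h2 : ‖x‖ ^ α ≤ R j ^ α := by
            have := not_lt.1 hx
            gcongr
          have h3 := mul_le_mul_of_nonneg_left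
            ((weightW_add_le hα hα1 x (y j)).trans (add_le_add_right h2 _)) hlam
          exact mul_le_mul_of_nonneg_right (by linarith) (by positivity)

section

variable {a b : ℝ} {f : ℝ → ℝ} {p μ : ℝ} {V : R3 → ℝ} {V₀ V₁ : ℝ} {α r : ℝ} {lam : ℕ → ℝ}
  {u : ℕ → R3 → ℝ} {g : ℕ → R3 → R3} {K : ℝ} {ι : Type*} [Fintype ι] {y : ι → ℕ → R3}

theorem BoundedSols.remainder_energy_le (B : BoundedSols a b f V α r lam u g K) (ha : 0 < a)
    (hb : 0 < b) (hV : PotentialHyp V V₀ V₁ μ) (hα : 0 < α)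
    (hα1 : α ≤ 1) (hr : 4 < r) (hr' : r < 6) {φ : ι → R3 → ℝ} (hφ : ∀ j, IsTestFunction (φ j))
    {R : ι → ℝ} (hR : ∀ j x, R j < ‖x‖ → φ j x = 0) {K₁ : ℝ} {n : ℕ}
    (h2 : ∫ x, remainder u φ y n x ^ 2 ≤ K₁) (h6 : ∫ x, remainder u φ y n x ^ 6 ≤ K₁) :
    a * (∫ x, ‖remainder g (fun j => ∇ (φ j)) y n x‖ ^ 2)
        + V₀ * (∫ x, remainder u φ y n x ^ 2)
      ≤ (a + b * K) * |∑ j, ∫ x, inner ℝ (∇ (φ j) x)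
          (remainder g (fun j => ∇ (φ j)) y n (x + y j n))|
        + (∑ j, (V₁ + lam n * weightW α (y j n) + lam n * R j ^ α)
            * ∫ x, |remainder u φ y n (x + y j n)| * |φ j x|)
        + (∫ x, |f (u n x) * remainder u φ y n x|)
        + lam n * (2 * K + 2 * K₁) := by
  have Hφ : ∀ j, H1Pair (φ j) (∇ (φ j)) := fun j => H1Pair.of_test (hφ j)
  have Hz := h1Pair_remainder B.pair Hφ y n
  have h := (B.sol n).energy_sub_le ha hb hV hα hr hr' (B.lam_nonneg n)
    (IsTestFunction.sum Finset.univ fun j => (hφ j).comp_sub_right (y j n))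
    (H1Pair.sum Finset.univ fun j _ => (Hφ j).comp_sub_right (y j n))
  have e1 := integral_inner_sum_translate (fun j => (Hφ j).memLp_grad) Hz.memLp_grad
    fun j => y j n
  have e2 := integral_weight_abs_mul_sum_le hα hα1 (B.lam_nonneg n) hV.V₁_pos.le hφ Hz.memLp hR
    fun j => y j n
  rw [← e1]
  have hD := B.grad_le n
  have h3 : (a + b * ∫ x, ‖g n x‖ ^ 2) * |∫ x, inner ℝ (∑ j, ∇ (φ j) (x - y j n))
        (remainder g (fun j => ∇ (φ j)) y n x)|
      ≤ (a + b * K) * |∫ x, inner ℝ (∑ j, ∇ (φ j) (x - y j n))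
        (remainder g (fun j => ∇ (φ j)) y n x)| := by
    gcongr
  have h4 : lam n * ((∫ x, u n x ^ 2) + (∫ x, remainder u φ y n x ^ 2)
      + ((∫ x, u n x ^ 6) + ∫ x, remainder u φ y n x ^ 6)) ≤ lam n * (2 * K + 2 * K₁) :=
    mul_le_mul_of_nonneg_left (by linarith [B.sq_le n, B.six_le n]) (B.lam_nonneg n)
  simp only [remainder] at *
  linarith

end

/-! ### Strong convergence of the remainder -/

theorem NonlinearityHyp.integral_abs_mul_le {f : ℝ → ℝ} {p μ : ℝ} (hf : NonlinearityHyp f p μ)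
    {τ C : ℝ} (h : ∀ s t, |f s * t| ≤ τ * (s ^ 2 + s ^ 6 + t ^ 2 + t ^ 6) + C * t ^ 4)
    {u v : R3 → ℝ} {g k : R3 → R3} (Hu : H1Pair u g) (Hv : H1Pair v k) :
    ∫ x, |f (u x) * v x| ≤ τ * ((∫ x, u x ^ 2) + (∫ x, u x ^ 6) + (∫ x, v x ^ 2) + ∫ x, v x ^ 6)
      + C * ∫ x, v x ^ 4 := by
  have i1 : Integrable fun x => u x ^ 2 + u x ^ 6 := Hu.integrable_sq.add Hu.integrable_pow_six
  have i2 : Integrable fun x => u x ^ 2 + u x ^ 6 + v x ^ 2 := i1.add Hv.integrable_sq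
  have i3 : Integrable fun x => u x ^ 2 + u x ^ 6 + v x ^ 2 + v x ^ 6 :=
    i2.add Hv.integrable_pow_six
  rw [← integral_add Hu.integrable_sq Hu.integrable_pow_six, ← integral_add i1 Hv.integrable_sq,
    ← integral_add i2 Hv.integrable_pow_six, ← integral_const_mul, ← integral_const_mul,
    ← integral_add (i3.const_mul τ) (Hv.integrable_pow_four.const_mul C)]
  exact integral_mono (hf.integrable_mul Hu Hv).abs
    ((i3.const_mul τ).add (Hv.integrable_pow_four.const_mul C)) fun x => h _ _

theorem add_pow_four_le (s t : ℝ) : (s + t) ^ 4 ≤ 8 * s ^ 4 + 8 * t ^ 4 := by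
  nlinarith [sq_nonneg (s ^ 2 - t ^ 2), sq_nonneg (s - t), mul_nonneg (sq_nonneg (s - t))
    (sq_nonneg (s - t)), mul_nonneg (sq_nonneg (s - t)) (sq_nonneg (s + t)), sq_nonneg (s + t),
    mul_nonneg (sq_nonneg (s - t)) (sq_nonneg s), mul_nonneg (sq_nonneg (s - t)) (sq_nonneg t)]

theorem integral_norm_add_sq_le {X : Type*} [NormedAddCommGroup X] {s t : R3 → X}
    (hs : MemLp s 2 volume) (ht : MemLp t 2 volume) :
    ∫ x, ‖s x + t x‖ ^ 2 ≤ 2 * (∫ x, ‖s x‖ ^ 2) + 2 * ∫ x, ‖t x‖ ^ 2 := by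
  rw [← integral_const_mul, ← integral_const_mul,
    ← integral_add (hs.integrable_normsq.const_mul 2) (ht.integrable_normsq.const_mul 2)]
  refine integral_mono (hs.add ht).integrable_normsq
    ((hs.integrable_normsq.const_mul 2).add (ht.integrable_normsq.const_mul 2)) fun x => ?_
  have := norm_add_le (s x) (t x)
  have h0 := norm_nonneg (s x + t x)
  simp only
  nlinarith [sq_nonneg (‖s x‖ - ‖t x‖)]

theorem tendsto_integral_abs_sub_mul {φ : ℕ → R3 → ℝ} {w : R3 → ℝ}
    (hφ : ∀ m, MemLp (φ m) 2 volume) (hw : MemLp w 2 volume)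
    (h : Tendsto (fun m => eLpNorm (fun x => φ m x - w x) 2 volume) atTop (𝓝 0)) :
    Tendsto (fun m => ∫ x, |w x - φ m x| * |φ m x|) atTop (𝓝 0) := by
  have h1 := tendsto_integral_inner_of_eLpNorm (F := fun m x => |φ m x|) (F₀ := fun x => |w x|)
    (G := fun m x => |w x - φ m x|) (G₀ := fun _ => 0) (fun m => (hφ m).norm) hw.norm
    (fun m => (hw.sub (hφ m)).norm) MemLp.zero'
    (tendsto_of_tendsto_of_tendsto_of_le_of_le tendsto_const_nhds h (fun n => zero_le)
      fun n => eLpNorm_mono fun x => abs_abs_sub_abs_le_abs_sub _ _)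
    (h.congr fun m => by
      refine eLpNorm_congr_norm_ae (Eventually.of_forall fun x => ?_)
      simp [abs_sub_comm])
  simpa using h1

theorem tendsto_integral_inner_sub {E : Type*} [NormedAddCommGroup E] [InnerProductSpace ℝ E]
    {φ : ℕ → R3 → E} {w : R3 → E} (hφ : ∀ m, MemLp (φ m) 2 volume) (hw : MemLp w 2 volume)
    (h : Tendsto (fun m => eLpNorm (fun x => φ m x - w x) 2 volume) atTop (𝓝 0)) :
    Tendsto (fun m => ∫ x, inner ℝ (φ m x) (w x - φ m x)) atTop (𝓝 0) := by
  have h1 := tendsto_integral_inner_of_eLpNorm (G := fun m x => w x - φ m x) (G₀ := fun _ => 0)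
    hφ hw (fun m => hw.sub (hφ m)) MemLp.zero' h
    (h.congr fun m => by
      refine eLpNorm_congr_norm_ae (Eventually.of_forall fun x => ?_)
      simp [norm_sub_rev])
  simpa using h1

section

variable {E ι : Type*} [NormedAddCommGroup E] [Fintype ι]

theorem remainder_eq_add (v : ℕ → R3 → E) (W φ : ι → R3 → E) (y : ι → ℕ → R3) (n : ℕ) (x : R3) :
    remainder v φ y n x
      = remainder v W y n x + -remainder (fun _ _ => (0 : E)) (fun j x => W j x - φ j x) y n x := by
  simp [remainder]

theorem integral_norm_remainder_zero_sq_le {W : ι → R3 → E} (hW : ∀ j, MemLp (W j) 2 volume)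
    (y : ι → ℕ → R3) (n : ℕ) :
    ∫ x, ‖remainder (fun _ _ => (0 : E)) W y n x‖ ^ 2
      ≤ (∑ j, eLpNorm (W j) 2 volume).toReal ^ 2 := by
  have h0 : ∀ _ : ℕ, MemLp (fun _ : R3 => (0 : E)) 2 volume := fun _ => MemLp.zero'
  have hm := memLp_remainder (y := y) h0 hW n
  refine integral_sq_le_of_eLpNorm_le hm
    (ENNReal.sum_ne_top.2 fun j _ => (hW j).eLpNorm_ne_top) ?_
  simpa using eLpNorm_remainder_le (y := y) h0 hW n

theorem exists_integral_norm_remainder_sq_le {v : ℕ → R3 → E} {W : ι → R3 → E} {K : ℝ}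
    (hv : ∀ n, MemLp (v n) 2 volume) (hK : ∀ n, ∫ x, ‖v n x‖ ^ 2 ≤ K)
    (hW : ∀ j, MemLp (W j) 2 volume) :
    ∃ B : ℝ, 0 ≤ B ∧ ∀ (y : ι → ℕ → R3) n, ∫ x, ‖remainder v W y n x‖ ^ 2 ≤ B := by
  have h1 : ∑ j, eLpNorm (W j) 2 volume ≠ ⊤ :=
    ENNReal.sum_ne_top.2 fun j _ => (hW j).eLpNorm_ne_top
  exact ⟨(ENNReal.ofReal √K + ∑ j, eLpNorm (W j) 2 volume).toReal ^ 2, sq_nonneg _, fun y n =>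
    integral_sq_le_of_eLpNorm_le (memLp_remainder hv hW n) (by finiteness)
      ((eLpNorm_remainder_le hv hW n).trans
        (add_le_add_left (eLpNorm_two_le_of_integral_le (hv n) (hK n)) _))⟩

end

section

variable {a b : ℝ} {f : ℝ → ℝ} {p μ : ℝ} {V : R3 → ℝ} {V₀ V₁ : ℝ} {α r : ℝ} {lam : ℕ → ℝ}
  {u : ℕ → R3 → ℝ} {g : ℕ → R3 → R3} {K : ℝ} {ι : Type*} [Fintype ι] {y : ι → ℕ → R3}
  {w : ι → R3 → ℝ} {h : ι → R3 → R3}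

/-- The remainder relative to test functions close to the profiles has small energy. -/
theorem BoundedSols.exists_eventually_remainder_lt (B : BoundedSols a b f V α r lam u g K)
    (ha : 0 < a) (hb : 0 < b) (hf : NonlinearityHyp f p μ) (hV : PotentialHyp V V₀ V₁ μ)
    (hα : 0 < α) (hα1 : α ≤ 1) (hr : 4 < r) (hr' : r < 6)
    (hw : ∀ j, WeakL2 (fun n x => u n (x + y j n)) (w j))
    (hh : ∀ j, WeakL2 (fun n x => g n (x + y j n)) (h j))
    (hd : ∀ i j, i ≠ j → Tendsto (fun n => ‖y j n - y i n‖) atTop atTop) {c : ι → ℝ}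
    (hc : ∀ j, Tendsto (fun n => lam n * weightW α (y j n)) atTop (𝓝 (c j)))
    (hz : Tendsto (fun n => ∫ x, remainder u w y n x ^ 4) atTop (𝓝 0)) {η : ℝ} (hη : 0 < η) :
    ∃ φ : ι → R3 → ℝ, (∀ j, IsTestFunction (φ j)) ∧
      (∑ j, eLpNorm (fun x => w j x - φ j x) 2 volume).toReal ^ 2 ≤ η ∧
      (∑ j, eLpNorm (fun x => h j x - ∇ (φ j) x) 2 volume).toReal ^ 2 ≤ η ∧
      ∀ᶠ n in atTop, a * (∫ x, ‖remainder g (fun j => ∇ (φ j)) y n x‖ ^ 2)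
        + V₀ * (∫ x, remainder u φ y n x ^ 2) < η := by
  have Hw : ∀ j, H1Pair (w j) (h j) := fun j =>
    H1Pair.of_weakL2 (B.pair_translate (y j)) (hw j) (hh j)
  have Hz : ∀ n, H1Pair (remainder u w y n) (remainder g h y n) := h1Pair_remainder B.pair Hw y
  choose φ hφ hφ1 hφ2 _ _ using fun j => (Hw j).exists_seq_test
  obtain ⟨S, hS, hSob⟩ := exists_integral_pow_six_le
  obtain ⟨B₁, hB₁, hzB⟩ := exists_integral_norm_remainder_sq_le (ι := ι)
    (fun n => (B.pair n).memLp) (fun n => by simpa using B.sq_le n) fun j => (Hw j).memLp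
  obtain ⟨B₂, hB₂, hgB⟩ := exists_integral_norm_remainder_sq_le (ι := ι)
    (fun n => (B.pair n).memLp_grad) B.grad_le fun j => (Hw j).memLp_grad
  have hK0 : 0 ≤ K := (integral_nonneg fun x => sq_nonneg _).trans (B.sq_le 0)
  -- Bounds the `L²` and `L⁶` integrals of every remainder whose test functions are within distance
  -- one of the profiles. It must not depend on `m`, because `τ` is fixed through it before `m` is
  -- chosen.
  let K₁ : ℝ := 2 * B₁ + 2 + S * (2 * B₂ + 2) ^ 3
  have hK₁ : 0 ≤ K₁ := by positivity
  have hτ : 0 < η / (4 * (K + K₁ + 1)) := by positivity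
  obtain ⟨C, hC, hfC⟩ := hf.exists_mul_bound hτ
  set τ := η / (4 * (K + K₁ + 1))
  let ρ : ℕ → ℝ := fun m => (∑ j, eLpNorm (fun x => w j x - φ j m x) 2 volume).toReal ^ 2
  let ρ' : ℕ → ℝ := fun m => (∑ j, eLpNorm (fun x => h j x - ∇ (φ j m) x) 2 volume).toReal ^ 2
  have hρ : Tendsto ρ atTop (𝓝 0) := by
    have h1 : Tendsto (fun m => ∑ j, eLpNorm (fun x => w j x - φ j m x) 2 volume) atTop (𝓝 0) := by
      simpa using tendsto_finsetSum Finset.univ fun j _ => (hφ1 j).congr fun m =>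
        eLpNorm_congr_norm_ae (Eventually.of_forall fun x => norm_sub_rev (φ j m x) (w j x))
    simpa using ((ENNReal.tendsto_toReal ENNReal.zero_ne_top).comp h1).pow 2
  have hρ' : Tendsto ρ' atTop (𝓝 0) := by
    have h1 : Tendsto (fun m => ∑ j, eLpNorm (fun x => h j x - ∇ (φ j m) x) 2 volume) atTop
        (𝓝 0) := by
      simpa using tendsto_finsetSum Finset.univ fun j _ => (hφ2 j).congr fun m =>
        eLpNorm_congr_norm_ae (Eventually.of_forall fun x => norm_sub_rev (∇ (φ j m) x) (h j x))
    simpa using ((ENNReal.tendsto_toReal ENNReal.zero_ne_top).comp h1).pow 2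
  let X : ℕ → ℝ := fun m => ∑ j, ∫ x, inner ℝ (∇ (φ j m) x) (h j x - ∇ (φ j m) x)
  let Y : ι → ℕ → ℝ := fun j m => ∫ x, |w j x - φ j m x| * |φ j m x|
  have hX : Tendsto X atTop (𝓝 0) := by
    simpa only [Finset.sum_const_zero] using tendsto_finsetSum Finset.univ fun j _ =>
      tendsto_integral_inner_sub (fun m => (hφ j m).memLp_gradient 2) (Hw j).memLp_grad (hφ2 j)
  have hY : ∀ j, Tendsto (Y j) atTop (𝓝 0) := fun j =>
    tendsto_integral_abs_sub_mul (fun m => (hφ j m).memLp 2) (Hw j).memLp (hφ1 j)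
  -- What is left of the energy bound after `n → ∞` with the approximations `φ j m` fixed. As `m →
  -- ∞` only `τ (2K + 2K₁) < η` survives, so some `m` makes it smaller than `η`.
  let L : ℕ → ℝ := fun m => (a + b * K) * |X m| + (∑ j, (V₁ + c j) * Y j m)
    + (τ * (2 * K + 2 * K₁) + C * (8 * (ρ m + S * ρ' m ^ 3)))
  have hL : Tendsto L atTop (𝓝 ((a + b * K) * |0| + (∑ j, (V₁ + c j) * 0)
      + (τ * (2 * K + 2 * K₁) + C * (8 * (0 + S * 0 ^ 3))))) :=
    ((hX.abs.const_mul _).add (tendsto_finsetSum _ fun j _ => (hY j).const_mul _)).add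
      (((hρ.add ((hρ'.pow 3).const_mul S)).const_mul 8).const_mul C |>.const_add _)
  have hτη : τ * (2 * K + 2 * K₁) < η := by
    rw [div_mul_eq_mul_div, div_lt_iff₀ (by positivity)]
    nlinarith
  have hL' := hL.eventually_lt_const (by simpa using hτη)
  -- The approximation error must be below `η` for the conclusion and below one for `K₁` to apply.
  have hmin : 0 < min η 1 := lt_min hη one_pos
  obtain ⟨m, hLm, hρm, hρm'⟩ := (hL'.and ((hρ.eventually_lt_const hmin).and
    (hρ'.eventually_lt_const hmin))).exists
  have hρm1 := hρm.le.trans (min_le_right _ _)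
  have hρm1' := hρm'.le.trans (min_le_right _ _)
  refine ⟨fun j => φ j m, fun j => hφ j m, hρm.le.trans (min_le_left _ _),
    hρm'.le.trans (min_le_left _ _), ?_⟩
  have Hφ : ∀ j, H1Pair (φ j m) (∇ (φ j m)) := fun j => H1Pair.of_test (hφ j m)
  -- Up to sign, the difference between the remainder taken with the profiles and the one taken with
  -- their smooth approximations; its size is controlled uniformly in `n` and in the positions of
  -- the centers.
  let e := remainder (fun _ _ => (0 : ℝ)) (fun j x => w j x - φ j m x) y
  let e' := remainder (fun _ _ => (0 : R3)) (fun j x => h j x - ∇ (φ j m) x) y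
  have He : ∀ n, H1Pair (e n) (e' n) :=
    h1Pair_remainder (fun _ => H1Pair.zero) (fun j => (Hw j).sub (Hφ j)) y
  have he2 : ∀ n, ∫ x, e n x ^ 2 ≤ ρ m := fun n => by
    simpa using integral_norm_remainder_zero_sq_le (fun j => ((Hw j).sub (Hφ j)).memLp) y n
  have he2' : ∀ n, ∫ x, ‖e' n x‖ ^ 2 ≤ ρ' m := fun n =>
    integral_norm_remainder_zero_sq_le (fun j => ((Hw j).sub (Hφ j)).memLp_grad) y n
  have he4 : ∀ n, ∫ x, e n x ^ 4 ≤ ρ m + S * ρ' m ^ 3 := fun n => by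
    calc ∫ x, e n x ^ 4 ≤ ∫ x, (e n x ^ 2 + e n x ^ 6) :=
          integral_mono (He n).integrable_pow_four
            ((He n).integrable_sq.add (He n).integrable_pow_six) fun x => pow_four_le _
      _ = (∫ x, e n x ^ 2) + ∫ x, e n x ^ 6 :=
          integral_add (He n).integrable_sq (He n).integrable_pow_six
      _ ≤ _ := by
          refine add_le_add (he2 n) ((hSob _ _ (He n)).trans ?_)
          have h0 : 0 ≤ ∫ x, ‖e' n x‖ ^ 2 := integral_nonneg fun x => by positivity
          gcongr
          exact he2' n
  let Z := remainder u (fun j => φ j m) y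
  let G := remainder g (fun j => ∇ (φ j m)) y
  have HZ : ∀ n, H1Pair (Z n) (G n) := h1Pair_remainder B.pair Hφ y
  have eZ : ∀ n x, Z n x = remainder u w y n x + -e n x := fun n x => remainder_eq_add u w _ y n x
  have eG : ∀ n x, G n x = remainder g h y n x + -e' n x := fun n x =>
    remainder_eq_add g h _ y n x
  have hZ2 : ∀ n, ∫ x, Z n x ^ 2 ≤ 2 * B₁ + 2 := fun n => by
    have h1 := integral_norm_add_sq_le (Hz n).memLp (He n).memLp.neg
    have h2 := hzB y n
    simp only [Pi.neg_apply, Real.norm_eq_abs, sq_abs, even_two.neg_pow] at h1 h2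
    simp only [eZ]
    linarith [he2 n]
  have hG2 : ∀ n, ∫ x, ‖G n x‖ ^ 2 ≤ 2 * B₂ + 2 := fun n => by
    have h1 := integral_norm_add_sq_le (Hz n).memLp_grad (He n).memLp_grad.neg
    have h2 := hgB y n
    simp only [Pi.neg_apply, norm_neg] at h1 h2
    simp only [eG]
    linarith [he2' n]
  have hZ6 : ∀ n, ∫ x, Z n x ^ 6 ≤ S * (2 * B₂ + 2) ^ 3 := fun n => by
    refine (hSob _ _ (HZ n)).trans ?_
    have h0 : 0 ≤ ∫ x, ‖G n x‖ ^ 2 := integral_nonneg fun x => by positivity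
    gcongr
    exact hG2 n
  have hS0 : 0 ≤ S * (2 * B₂ + 2) ^ 3 := by positivity
  have hZ2' : ∀ n, ∫ x, Z n x ^ 2 ≤ K₁ := fun n => (hZ2 n).trans (by simp only [K₁]; linarith)
  have hZ6' : ∀ n, ∫ x, Z n x ^ 6 ≤ K₁ := fun n => (hZ6 n).trans (by simp only [K₁]; linarith)
  have hZ4 : ∀ n, ∫ x, Z n x ^ 4
      ≤ 8 * (∫ x, remainder u w y n x ^ 4) + 8 * (ρ m + S * ρ' m ^ 3) := fun n => by
    calc ∫ x, Z n x ^ 4 ≤ ∫ x, (8 * remainder u w y n x ^ 4 + 8 * e n x ^ 4) := by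
          refine integral_mono (HZ n).integrable_pow_four (((Hz n).integrable_pow_four.const_mul 8).add
            ((He n).integrable_pow_four.const_mul 8)) fun x => ?_
          have := add_pow_four_le (remainder u w y n x) (-e n x)
          simp only [eZ]
          simpa [Even.neg_pow (by decide : Even 4)] using this
      _ = 8 * (∫ x, remainder u w y n x ^ 4) + 8 * ∫ x, e n x ^ 4 := by
          rw [integral_add ((Hz n).integrable_pow_four.const_mul 8)
            ((He n).integrable_pow_four.const_mul 8), integral_const_mul, integral_const_mul]
      _ ≤ _ := by linarith [he4 n]
  have hfZ : ∀ n, ∫ x, |f (u n x) * Z n x| ≤ τ * (2 * K + 2 * K₁)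
      + C * (8 * (∫ x, remainder u w y n x ^ 4) + 8 * (ρ m + S * ρ' m ^ 3)) := fun n => by
    refine (hf.integral_abs_mul_le hfC (B.pair n) (HZ n)).trans ?_
    exact add_le_add (mul_le_mul_of_nonneg_left
      (by linarith [B.sq_le n, B.six_le n, hZ2' n, hZ6' n]) hτ.le)
      (mul_le_mul_of_nonneg_left (hZ4 n) hC)
  choose R _ hR using fun j => (hφ j m).exists_ball
  have hmain := fun n => B.remainder_energy_le ha hb hV hα hα1 hr hr' (fun j => hφ j m) hR
    (hZ2' n) (hZ6' n)
  -- Seen from center `j`, the gradient of the approximate remainder tends weakly to `h j - ∇(φ j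
  -- m)`, not to zero; hence the limit `X m`, which is small only for large `m`.
  have tX : Tendsto (fun n => ∑ j, ∫ x, inner ℝ (∇ (φ j m) x) (G n (x + y j n))) atTop
      (𝓝 (X m)) := by
    refine tendsto_finsetSum _ fun j _ => ?_
    have := (weakL2_remainder (fun j => (Hφ j).memLp_grad) hd j (hh j)).tendsto _
      (Hφ j).memLp_grad
    simpa only [real_inner_comm] using this
  have tY : ∀ j, Tendsto (fun n => ∫ x, |Z n (x + y j n)| * |φ j m x|) atTop (𝓝 (Y j m)) := by
    intro j
    have HZj : ∀ n, H1Pair (fun x => Z n (x + y j n)) (fun x => G n (x + y j n)) := fun n =>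
      (HZ n).comp_add_right _
    refine tendsto_integral_abs_mul (fun n => (HZj n).memLp) ((Hw j).sub (Hφ j)).memLp
      ((hφ j m).memLp 2).norm (R := R j) (fun x hx => by simp [hR j x hx]) ?_
    refine tendsto_eLpNorm_sub_restrict_ball HZj
      (weakL2_remainder (fun j => (Hφ j).memLp) hd j (hw j))
      (weakL2_remainder (fun j => (Hφ j).memLp_grad) hd j (hh j))
      (K := max (2 * B₁ + 2) (2 * B₂ + 2)) (fun n => ?_) (fun n => ?_) (R j)
    · rw [integral_add_right_eq_self (fun x => Z n x ^ 2)]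
      exact (hZ2 n).trans (le_max_left _ _)
    · rw [integral_add_right_eq_self (fun x => ‖G n x‖ ^ 2)]
      exact (hG2 n).trans (le_max_right _ _)
  have hlim : Tendsto (fun n => (a + b * K)
      * |∑ j, ∫ x, inner ℝ (∇ (φ j m) x) (G n (x + y j n))|
      + (∑ j, (V₁ + lam n * weightW α (y j n) + lam n * R j ^ α)
        * ∫ x, |Z n (x + y j n)| * |φ j m x|)
      + (τ * (2 * K + 2 * K₁)
        + C * (8 * (∫ x, remainder u w y n x ^ 4) + 8 * (ρ m + S * ρ' m ^ 3)))
      + lam n * (2 * K + 2 * K₁)) atTop (𝓝 ((a + b * K) * |X m|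
      + (∑ j, (V₁ + c j + 0 * R j ^ α) * Y j m)
      + (τ * (2 * K + 2 * K₁) + C * (8 * 0 + 8 * (ρ m + S * ρ' m ^ 3)))
      + 0 * (2 * K + 2 * K₁))) :=
    (((tX.abs.const_mul _).add (tendsto_finsetSum _ fun j _ =>
      (((hc j).const_add V₁).add (B.lam_tendsto.mul_const _)).mul (tY j))).add
      ((((hz.const_mul 8).add_const _).const_mul C).const_add _)).add
      (B.lam_tendsto.mul_const _)
  have hLm' : (a + b * K) * |X m| + (∑ j, (V₁ + c j + 0 * R j ^ α) * Y j m)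
      + (τ * (2 * K + 2 * K₁) + C * (8 * 0 + 8 * (ρ m + S * ρ' m ^ 3)))
      + 0 * (2 * K + 2 * K₁) < η := by
    simpa [L] using hLm
  filter_upwards [hlim.eventually_lt_const hLm'] with n hn
  exact ((hmain n).trans (by gcongr; exact hfZ n)).trans_lt hn

end

section

variable {a b : ℝ} {f : ℝ → ℝ} {p μ : ℝ} {V : R3 → ℝ} {V₀ V₁ : ℝ} {α r : ℝ} {lam : ℕ → ℝ}
  {u : ℕ → R3 → ℝ} {g : ℕ → R3 → R3} {K : ℝ}

/-- The true remainder is an approximate one plus a sum of translated approximation errors. Both are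
of order `η` in `H¹`, for arbitrary `η`. -/
theorem BoundedSols.tendsto_remainder (B : BoundedSols a b f V α r lam u g K)
    (ha : 0 < a) (hb : 0 < b) (hf : NonlinearityHyp f p μ) (hV : PotentialHyp V V₀ V₁ μ)
    (hα : 0 < α) (hα1 : α ≤ 1) (hr : 4 < r) (hr' : r < 6) {ι : Type*} [Fintype ι]
    {y : ι → ℕ → R3} {w : ι → R3 → ℝ} {h : ι → R3 → R3}
    (hw : ∀ j, WeakL2 (fun n x => u n (x + y j n)) (w j))
    (hh : ∀ j, WeakL2 (fun n x => g n (x + y j n)) (h j))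
    (hd : ∀ i j, i ≠ j → Tendsto (fun n => ‖y j n - y i n‖) atTop atTop) {c : ι → ℝ}
    (hc : ∀ j, Tendsto (fun n => lam n * weightW α (y j n)) atTop (𝓝 (c j)))
    (hz : Tendsto (fun n => ∫ x, remainder u w y n x ^ 4) atTop (𝓝 0)) :
    Tendsto (fun n => ∫ x, remainder u w y n x ^ 2) atTop (𝓝 0) ∧
      Tendsto (fun n => ∫ x, ‖remainder g h y n x‖ ^ 2) atTop (𝓝 0) := by
  have Hw : ∀ j, H1Pair (w j) (h j) := fun j =>
    H1Pair.of_weakL2 (B.pair_translate (y j)) (hw j) (hh j)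
  have hV₀ := hV.V₀_pos
  have key : ∀ η : ℝ, 0 < η → ∀ᶠ n in atTop, ∫ x, remainder u w y n x ^ 2 ≤ (2 / V₀ + 2) * η ∧
      ∫ x, ‖remainder g h y n x‖ ^ 2 ≤ (2 / a + 2) * η := by
    intro η hη
    obtain ⟨φ, hφ, hρ, hρ', hev⟩ :=
      B.exists_eventually_remainder_lt ha hb hf hV hα hα1 hr hr' hw hh hd hc hz hη
    filter_upwards [hev] with n hn
    have Hφ : ∀ j, H1Pair (φ j) (∇ (φ j)) := fun j => H1Pair.of_test (hφ j)
    have HZ := h1Pair_remainder B.pair Hφ y n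
    have He := h1Pair_remainder (fun _ => H1Pair.zero) (fun j => (Hw j).sub (Hφ j)) y n
    have e1 : ∀ x, remainder u w y n x = remainder u φ y n x
        + remainder (fun _ _ => (0 : ℝ)) (fun j x => w j x - φ j x) y n x := fun x => by
      rw [remainder_eq_add u w φ]; ring
    have e2 : ∀ x, remainder g h y n x = remainder g (fun j => ∇ (φ j)) y n x
        + remainder (fun _ _ => (0 : R3)) (fun j x => h j x - ∇ (φ j) x) y n x := fun x => by
      rw [remainder_eq_add g h (fun j => ∇ (φ j))]; abel
    have h1 := integral_norm_add_sq_le HZ.memLp He.memLp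
    have h2 := integral_norm_add_sq_le HZ.memLp_grad He.memLp_grad
    have h3 := (integral_norm_remainder_zero_sq_le
      (fun j => ((Hw j).sub (Hφ j)).memLp) y n).trans hρ
    have h4 := (integral_norm_remainder_zero_sq_le
      (fun j => ((Hw j).sub (Hφ j)).memLp_grad) y n).trans hρ'
    simp only [← e1, ← e2, Real.norm_eq_abs, sq_abs] at h1 h2 h3 h4
    have h5 : 0 ≤ a * ∫ x, ‖remainder g (fun j => ∇ (φ j)) y n x‖ ^ 2 :=
      mul_nonneg ha.le (integral_nonneg fun x => by positivity)
    have h6 : 0 ≤ V₀ * ∫ x, remainder u φ y n x ^ 2 :=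
      mul_nonneg hV₀.le (integral_nonneg fun x => by positivity)
    have h7 : ∫ x, remainder u φ y n x ^ 2 ≤ η / V₀ := by
      rw [le_div_iff₀ hV₀]; linarith
    have h8 : ∫ x, ‖remainder g (fun j => ∇ (φ j)) y n x‖ ^ 2 ≤ η / a := by
      rw [le_div_iff₀ ha]; linarith
    constructor
    · calc _ ≤ 2 * (η / V₀) + 2 * η := by linarith
        _ = _ := by ring
    · calc _ ≤ 2 * (η / a) + 2 * η := by linarith
        _ = _ := by ring
  have fin : ∀ (I : ℕ → ℝ) (C : ℝ), 0 < C → (∀ n, 0 ≤ I n) →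
      (∀ η : ℝ, 0 < η → ∀ᶠ n in atTop, I n ≤ C * η) → Tendsto I atTop (𝓝 0) := by
    intro I C hC h0 hI
    refine Metric.tendsto_nhds.2 fun ε hε => ?_
    filter_upwards [hI (ε / (2 * C)) (by positivity)] with n hn
    rw [Real.dist_eq, sub_zero, abs_of_nonneg (h0 n)]
    refine hn.trans_lt ?_
    rw [mul_div_assoc', div_lt_iff₀ (by positivity)]
    nlinarith
  exact ⟨fin _ _ (by positivity) (fun n => integral_nonneg fun x => sq_nonneg _)
      fun η hη => (key η hη).mono fun n hn => hn.1,
    fin _ _ (by positivity) (fun n => integral_nonneg fun x => sq_nonneg _)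
      fun η hη => (key η hη).mono fun n hn => hn.2⟩

/-- Profile decomposition of a bounded sequence of solutions, with strong convergence. -/
theorem BoundedSols.exists_profile_decomposition (B : BoundedSols a b f V α r lam u g K)
    (ha : 0 < a) (hb : 0 < b) (hf : NonlinearityHyp f p μ) (hV : PotentialHyp V V₀ V₁ μ)
    (hα : 0 < α) (hα1 : α ≤ 1) (hr : 4 < r) (hr' : r < 6) :
    ∃ (k : ℕ) (σ : ℕ → ℕ) (y : Fin (k + 1) → ℕ → R3) (w : Fin (k + 1) → R3 → ℝ)
      (h : Fin (k + 1) → R3 → R3) (c : Fin (k + 1) → ℝ), IsProfile u g k σ y w h ∧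
      (∀ j, 0 ≤ c j) ∧
      Tendsto (fun n => ∫ x, remainder (fun n => u (σ n)) w y n x ^ 2) atTop (𝓝 0) ∧
      Tendsto (fun n => ∫ x, ‖remainder (fun n => g (σ n)) h y n x‖ ^ 2) atTop (𝓝 0) ∧
      ∀ j (φ : R3 → ℝ), IsTestFunction φ → (∀ x, 0 ≤ φ x) →
        (a + b * ∑ i, ∫ x, ‖h i x‖ ^ 2) * (∫ x, inner ℝ ((w j x / |w j x|) • h j x) (∇ φ x))
          + (V₀ + c j) * (∫ x, |w j x| * φ x) ≤ ∫ x, |f (w j x)| * φ x := by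
  obtain ⟨R, -, hvan⟩ := exists_vanishing_const
  -- The nonlocal coefficient must converge before any limit inequality can be stated. Its limit `D`
  -- is identified with the sum of profile energies only after strong convergence is known.
  obtain ⟨D, -, s, hs, hD⟩ := (isCompact_Icc (a := (0 : ℝ)) (b := K)).tendsto_subseq
    (x := fun n => ∫ x, ‖g n x‖ ^ 2)
    fun n => ⟨integral_nonneg fun x => by positivity, B.grad_le n⟩
  have Bs := B.comp hs
  obtain ⟨k, σ, y, w, h, P, hP⟩ :=
    Bs.exists_vanishing_profile ha hb hf hV hα hα1 hr hr' hD R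
  obtain ⟨τ, c, hτ, hc⟩ := Bs.exists_weight_limits hα hα1 P
  have Pτ := P.comp hτ
  have Bτ := Bs.comp Pτ.strictMono
  have Hw := P.pair Bs.pair
  have Hz := h1Pair_remainder Bτ.pair Hw (fun j n => y j (τ n))
  have hz : Tendsto (fun n => ∫ x, remainder (fun n => u (s (σ (τ n)))) w
      (fun j n => y j (τ n)) n x ^ 4) atTop (𝓝 0) := by
    obtain ⟨C₁, hC₁, hz₁⟩ : ∃ C : ENNReal, C ≠ ⊤ ∧ ∀ n, eLpNorm (remainder
        (fun n => u (s (σ (τ n)))) w (fun j n => y j (τ n)) n) 2 volume ≤ C := by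
      refine ⟨ENNReal.ofReal √K + ∑ j, eLpNorm (w j) 2 volume, ?_, fun n =>
        (eLpNorm_remainder_le (fun n => (Bτ.pair n).memLp) (fun j => (Hw j).memLp) n).trans
          (add_le_add_left (eLpNorm_two_le_of_integral_le (Bτ.pair n).memLp
            (by simpa using Bτ.sq_le n)) _)⟩
      have : ∑ j, eLpNorm (w j) 2 volume ≠ ⊤ :=
        ENNReal.sum_ne_top.2 fun j _ => (Hw j).memLp.eLpNorm_ne_top
      finiteness
    obtain ⟨C₂, hC₂, hz₂⟩ : ∃ C : ENNReal, C ≠ ⊤ ∧ ∀ n, eLpNorm (remainder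
        (fun n => g (s (σ (τ n)))) h (fun j n => y j (τ n)) n) 2 volume ≤ C := by
      refine ⟨ENNReal.ofReal √K + ∑ j, eLpNorm (h j) 2 volume, ?_, fun n =>
        (eLpNorm_remainder_le (fun n => (Bτ.pair n).memLp_grad)
          (fun j => (Hw j).memLp_grad) n).trans
          (add_le_add_left (eLpNorm_two_le_of_integral_le (Bτ.pair n).memLp_grad
            (Bτ.grad_le n)) _)⟩
      have : ∑ j, eLpNorm (h j) 2 volume ≠ ⊤ :=
        ENNReal.sum_ne_top.2 fun j _ => (Hw j).memLp_grad.eLpNorm_ne_top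
      finiteness
    obtain ⟨Q, hQ, hv⟩ := hvan (C₁ + C₂) (by finiteness)
    have hl : Tendsto (fun n => ∫⁻ x, ‖remainder (fun n => u (s (σ (τ n)))) w
        (fun j n => y j (τ n)) n x‖ₑ ^ 4) atTop (𝓝 0) := by
      refine ENNReal.tendsto_nhds_zero.2 fun ε hε => ?_
      have hlim : Tendsto (fun θ : ENNReal => Q * θ) (𝓝 0) (𝓝 0) := by
        simpa using ENNReal.Tendsto.const_mul (tendsto_id (x := 𝓝 (0 : ENNReal))) (Or.inr hQ)
      have hlim' : Tendsto (fun n : ℕ => ((n : ENNReal))⁻¹) atTop (𝓝 0) :=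
        ENNReal.tendsto_inv_nat_nhds_zero
      -- The mass threshold is `1 / N`; `N ≥ 1` keeps it finite, as the vanishing lemma requires.
      obtain ⟨N, hN, hN1⟩ := ((ENNReal.tendsto_nhds_zero.1 (hlim.comp hlim') ε hε).and
        (eventually_ge_atTop 1)).exists
      have hN0 : ((N : ENNReal))⁻¹ ≠ 0 := by simp
      have hNt : ((N : ENNReal))⁻¹ ≠ ⊤ := by simp; omega
      filter_upwards [hτ.tendsto_atTop.eventually (hP _ hN0)] with n hn
      exact (hv _ _ (Hz n) ((hz₁ n).trans le_self_add) ((hz₂ n).trans le_add_self) _ hNt hn).trans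
        hN
    refine ((ENNReal.tendsto_toReal ENNReal.zero_ne_top).comp hl).congr fun n => ?_
    exact (integral_pow_eq_lintegral (Hz n).memLp.1 (by decide)).symm
  obtain ⟨hz2, hg2⟩ := Bτ.tendsto_remainder ha hb hf hV hα hα1 hr hr' Pτ.weak Pτ.weak_grad
    Pτ.diverge (fun j => (hc j).2) hz
  -- The energy splitting together with the vanishing gradient of the remainder shows that no energy
  -- is lost.
  have hsum : ∑ i, ∫ x, ‖h i x‖ ^ 2 = D := by
    have h1 := (tendsto_energy_sub (fun n => (Bτ.pair n).memLp_grad) Pτ.weak_grad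
      Pτ.diverge).add hg2
    simp only [sub_add_cancel, add_zero] at h1
    exact tendsto_nhds_unique h1 (hD.comp Pτ.strictMono.tendsto_atTop)
  refine ⟨k, fun n => s (σ (τ n)), fun j n => y j (τ n), w, h, c,
    ⟨hs.comp Pτ.strictMono, Pτ.center_zero, Pτ.weak, Pτ.weak_grad, Pτ.diverge, Pτ.ne_zero⟩,
    fun j => (hc j).1, hz2, hg2, fun j φ hφ hφ0 => ?_⟩
  rw [hsum]
  exact Bτ.kato_limit ha hb hf hV hα hα1 hr hr' (hD.comp Pτ.strictMono.tendsto_atTop)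
    (fun n => le_rfl) (hc j).2 (Pτ.weak j) (Pτ.weak_grad j) hφ hφ0

end

/-! ### The space `H` -/

section

variable {V : R3 → ℝ} {V₀ V₁ μ : ℝ}

theorem innerH_eq (hV : PotentialHyp V V₀ V₁ μ) (a : ℝ) {u v : R3 → ℝ} {g k : R3 → R3}
    (Hu : H1Pair u g) (Hv : H1Pair v k) :
    innerH a V u v = a * (∫ x, inner ℝ (g x) (k x)) + ∫ x, V x * u x * v x := by
  rw [← integral_const_mul, ← integral_add
    ((Hu.memLp_grad.integrable_inner_two Hv.memLp_grad).const_mul a)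
    (integrable_bdd_mul_mul hV.contDiff.continuous hV.abs_le Hu.memLp Hv.memLp)]
  refine integral_congr_ae ?_
  filter_upwards [Hu.weakGrad_ae, Hv.weakGrad_ae] with x h1 h2
  rw [h1, h2]

/-- Since `V` is bounded, `V φ` is an admissible `L²` test function, and the inner product of `H`
splits into two `L²` pairings. -/
theorem weakConvH_of_weakL2 (hV : PotentialHyp V V₀ V₁ μ) (a : ℝ) {v : ℕ → R3 → ℝ}
    {G : ℕ → R3 → R3} {w : R3 → ℝ} {h : R3 → R3} (H : ∀ n, H1Pair (v n) (G n))
    (hv : WeakL2 v w) (hG : WeakL2 G h) : WeakConvH a V v w := by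
  have Hw := H1Pair.of_weakL2 H hv hG
  refine ⟨fun n => (H n).memH hV, Hw.memH hV, fun φ hφ => ?_⟩
  have Hφ := hφ.1.h1Pair
  have hVφ : MemLp (fun x => V x * φ x) 2 volume := by
    refine (Hφ.memLp.const_mul V₁).mono
      (hV.contDiff.continuous.aestronglyMeasurable.mul Hφ.memLp.1)
      (Eventually.of_forall fun x => ?_)
    rw [norm_mul, norm_mul, Real.norm_eq_abs, Real.norm_of_nonneg hV.V₁_pos.le]
    exact mul_le_mul_of_nonneg_right (hV.abs_le x) (norm_nonneg _)
  have e : ∀ u : R3 → ℝ, ∫ x, V x * u x * φ x = ∫ x, inner ℝ (u x) (V x * φ x) := fun u => by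
    congr 1 with x
    simp only [RCLike.inner_apply, conj_trivial]
    ring
  simp only [innerH_eq hV a (H _) Hφ, innerH_eq hV a Hw Hφ, e]
  exact ((hG.tendsto _ Hφ.memLp_grad).const_mul a).add (hv.tendsto _ hVφ)

theorem tendsto_normH_zero (hV : PotentialHyp V V₀ V₁ μ) {a : ℝ} (ha : 0 < a) {z : ℕ → R3 → ℝ}
    {G : ℕ → R3 → R3} (H : ∀ n, H1Pair (z n) (G n))
    (hz : Tendsto (fun n => ∫ x, z n x ^ 2) atTop (𝓝 0))
    (hG : Tendsto (fun n => ∫ x, ‖G n x‖ ^ 2) atTop (𝓝 0)) :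
    Tendsto (fun n => normH a V (z n)) atTop (𝓝 0) := by
  have h1 := (hG.const_mul a).add (hz.const_mul V₁)
  rw [mul_zero, mul_zero, add_zero] at h1
  have h0 : ∀ n x, 0 ≤ V x * z n x * z n x := fun n x => by
    rw [mul_assoc]
    exact mul_nonneg (hV.V₀_pos.le.trans (hV.bounds x).1) (mul_self_nonneg _)
  have h2 : Tendsto (fun n => innerH a V (z n) (z n)) atTop (𝓝 0) := by
    refine tendsto_of_tendsto_of_tendsto_of_le_of_le tendsto_const_nhds h1 (fun n => ?_)
      fun n => ?_
    · rw [innerH_eq hV a (H n) (H n)]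
      simp only [real_inner_self_eq_norm_sq]
      exact add_nonneg (mul_nonneg ha.le (integral_nonneg fun x => by positivity))
        (integral_nonneg (h0 n))
    · simp only [innerH_eq hV a (H n) (H n), real_inner_self_eq_norm_sq]
      rw [← integral_const_mul V₁]
      refine add_le_add le_rfl (integral_mono (integrable_bdd_mul_mul hV.contDiff.continuous
        hV.abs_le (H n).memLp (H n).memLp) ((H n).integrable_sq.const_mul V₁) fun x => ?_)
      simp only [mul_assoc, pow_two]
      exact mul_le_mul_of_nonneg_right (hV.bounds x).2 (mul_self_nonneg _)
  simpa [normH] using h2.sqrt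

theorem exists_boundedSols {a b : ℝ} {f : ℝ → ℝ} {p : ℝ} (hf : NonlinearityHyp f p μ)
    (hV : PotentialHyp V V₀ V₁ μ) {α : ℝ} (hα : 0 < α) {r : ℝ} (hr : 4 < r) (hr' : r < 6)
    {lam : ℕ → ℝ} (hlam : ∀ n, 0 ≤ lam n) (hlam0 : Tendsto lam atTop (𝓝 0))
    {u : ℕ → R3 → ℝ} (hu : ∀ n, IsSolutionK a b f V α r (lam n) (u n))
    {M : ℝ} (hM : ∀ n, normE V α (lam n) (u n) ≤ M) :
    ∃ K, BoundedSols a b f V α r lam u (fun n => weakGrad (u n)) K := by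
  obtain ⟨S, hS, hSob⟩ := exists_integral_pow_six_le
  have hsol := fun n => (hu n).isWeakSol hf hV hα hr hr' (hlam n)
  have hV₀ := hV.V₀_pos
  have H := fun n => (hsol n).pair
  have h3 : ∀ n, (∫ x, ‖weakGrad (u n) x‖ ^ 2) + V₀ * (∫ x, u n x ^ 2)
      + (∫ x, lam n * weightW α x * u n x ^ 2) ≤ M ^ 2 := by
    intro n
    have hle := (Real.sqrt_le_iff.1 (hM n)).2
    refine le_trans ?_ hle
    have i1 := (H n).integrable_grad_sq
    have i2 := (H n).integrable_sq.const_mul V₀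
    have i2' := ((H n).memH hV).2
    have i12 : Integrable fun x => ‖weakGrad (u n) x‖ ^ 2 + V₀ * u n x ^ 2 := i1.add i2
    have i12' : Integrable fun x => ‖weakGrad (u n) x‖ ^ 2 + V x * u n x ^ 2 := i1.add i2'
    rw [← integral_const_mul, ← integral_add i1 i2, ← integral_add i12 (hsol n).weight]
    refine integral_mono (i12.add (hsol n).weight) (i12'.add (hsol n).weight) fun x => ?_
    simp only
    gcongr
    exact (hV.bounds x).1
  have n1 : ∀ n, 0 ≤ ∫ x, ‖weakGrad (u n) x‖ ^ 2 := fun n =>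
    integral_nonneg fun x => by positivity
  have n2 : ∀ n, 0 ≤ V₀ * ∫ x, u n x ^ 2 := fun n =>
    mul_nonneg hV₀.le (integral_nonneg fun x => by positivity)
  have n3 : ∀ n, 0 ≤ ∫ x, lam n * weightW α x * u n x ^ 2 := fun n =>
    integral_nonneg fun x => mul_nonneg (mul_nonneg (hlam n) (weightW_nonneg α x)) (sq_nonneg _)
  have g1 : ∀ n, ∫ x, ‖weakGrad (u n) x‖ ^ 2 ≤ M ^ 2 := fun n => by
    linarith [h3 n, n1 n, n2 n, n3 n]
  have k1 : 0 ≤ M ^ 2 / V₀ := by positivity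
  have k2 : 0 ≤ S * (M ^ 2) ^ 3 := by positivity
  have k3 : 0 ≤ M ^ 2 := by positivity
  -- The bounds for the gradient and weighted energies, the `L²` norm and (by Sobolev) the `L⁶` norm
  -- are added, so that one constant serves all four.
  refine ⟨M ^ 2 + M ^ 2 / V₀ + S * (M ^ 2) ^ 3, hsol, hlam, hlam0, fun n => ?_, fun n => ?_,
    fun n => ?_, fun n => ?_⟩
  · have : ∫ x, u n x ^ 2 ≤ M ^ 2 / V₀ := by
      rw [le_div_iff₀ hV₀]; linarith [h3 n, n1 n, n3 n]
    linarith
  · linarith [g1 n]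
  · have : ∫ x, u n x ^ 6 ≤ S * (M ^ 2) ^ 3 := by
      refine (hSob _ _ (H n)).trans ?_
      have := n1 n
      gcongr
      exact g1 n
    linarith
  · linarith [h3 n, n1 n, n2 n]

end
-- Assembly of the profile decomposition
theorem mainTheorem4
    (a b : ℝ) (ha : 0 < a) (hb : 0 < b)
    (f : ℝ → ℝ) (p μ : ℝ) (hf : NonlinearityHyp f p μ)
    (V : R3 → ℝ) (V₀ V₁ : ℝ) (hV : PotentialHyp V V₀ V₁ μ)
    (α : ℝ) (hα : 0 < α) (hα' : α < (μ - 2) / μ)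
    (r : ℝ) (hr : max p 4 < r) (hr' : r < 6)
    (lam : ℕ → ℝ) (hlam : ∀ n, 0 ≤ lam n) (hlam0 : Tendsto lam atTop (𝓝 0))
    (u : ℕ → R3 → ℝ) (hu : ∀ n, IsSolutionK a b f V α r (lam n) (u n))
    (M : ℝ) (hM : ∀ n, normE V α (lam n) (u n) ≤ M) :
    ∃ (σ : ℕ → ℕ) (k : ℕ) (as : Fin k → ℝ) (u₀ : R3 → ℝ) (w : Fin k → R3 → ℝ) (A : ℝ)
      (y : Fin k → ℕ → R3),
      StrictMono σ ∧
      (∀ j, 0 ≤ as j) ∧ 0 ≤ A ∧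
      MemH V u₀ ∧ (∀ j, MemH V (w j)) ∧
      (∀ j, ¬ (w j =ᵐ[volume] 0)) ∧
      -- (i) weak convergence of the sequence and of its translates
      WeakConvH a V (fun n => u (σ n)) u₀ ∧
      (∀ j, WeakConvH a V (fun n x => u (σ n) (x + y j n)) (w j)) ∧
      -- (ii) the centers escape to infinity and diverge from each other
      (∀ j, Tendsto (fun n => ‖y j n‖) atTop atTop) ∧
      (∀ i j, i ≠ j → Tendsto (fun n => ‖y j n - y i n‖) atTop atTop) ∧
      -- (iii) strong convergence of the remainder to zero
      Tendsto (fun n => normH a V (fun x => u (σ n) x - u₀ x - ∑ i, w i (x - y i n)))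
        atTop (𝓝 0) ∧
      -- (iv) the value of the nonlocal coefficient
      A = dirichlet u₀ + ∑ i, dirichlet (w i) ∧
      -- (v) the differential inequality, in the weak sense
      (∀ j, MemH1 (fun x => |w j x|) ∧
        ∀ φ : R3 → ℝ, IsTestFunction φ → (∀ x, 0 ≤ φ x) →
          (a + b * A) * (∫ x, inner ℝ (weakGrad (fun x => |w j x|) x) (∇ φ x))
              + (V₀ + as j) * (∫ x, |w j x| * φ x)
            ≤ ∫ x, |f (w j x)| * φ x) := by
  have hr4 : 4 < r := (le_max_right _ _).trans_lt hr
  have hα1 : α ≤ 1 := by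
    have hμ := hf.two_lt_mu
    refine hα'.le.trans ?_
    rw [div_le_one (by linarith)]
    linarith
  obtain ⟨K, B⟩ := exists_boundedSols hf hV hα hr4 hr' hlam hlam0 hu hM
  obtain ⟨k, σ, y, w, h, c, P, hc, hz, hg, hineq⟩ :=
    B.exists_profile_decomposition ha hb hf hV hα hα1 hr4 hr'
  have Hw := P.pair B.pair
  have hweak : ∀ j, WeakConvH a V (fun n x => u (σ n) (x + y j n)) (w j) := fun j =>
    weakConvH_of_weakL2 hV a (fun n => (B.pair (σ n)).comp_add_right (y j n)) (P.weak j)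
      (P.weak_grad j)
  have hA : ∑ i, ∫ x, ‖h i x‖ ^ 2 = dirichlet (w 0) + ∑ i : Fin k, dirichlet (w i.succ) := by
    rw [Fin.sum_univ_succ, (Hw 0).dirichlet_eq]
    congr 1
    exact Finset.sum_congr rfl fun i _ => (Hw i.succ).dirichlet_eq.symm
  -- Profile zero, centered at the origin, is `u₀`; the successors are the profiles at infinity.
  refine ⟨σ, k, fun j => c j.succ, w 0, fun j => w j.succ, ∑ i, ∫ x, ‖h i x‖ ^ 2,
    fun j => y j.succ, P.strictMono, fun j => hc _,
    Finset.sum_nonneg fun i _ => integral_nonneg fun x => by positivity, (Hw 0).memH hV,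
    fun j => (Hw _).memH hV, fun j => P.ne_zero _ (Fin.succ_ne_zero j), ?_, fun j => hweak _,
    fun j => ?_, fun i j hij => P.diverge _ _ fun e => hij (Fin.succ_injective _ e), ?_, hA,
    fun j => ?_⟩
  · simpa [P.center_zero] using hweak 0
  -- Escape to infinity is divergence from the center at the origin.
  · simpa [P.center_zero] using P.diverge 0 j.succ (Fin.succ_ne_zero j).symm
  · refine (tendsto_normH_zero hV ha
      (h1Pair_remainder (fun n => B.pair (σ n)) Hw y) hz hg).congr fun n => ?_
    congr 1
    ext x
    simp only [remainder, Fin.sum_univ_succ, P.center_zero, sub_zero, sub_sub]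
  · have Habs := (Hw j.succ).abs
    refine ⟨Habs.memH1, fun φ hφ hφ0 => ?_⟩
    have e : ∫ x, inner ℝ (weakGrad (fun x => |w j.succ x|) x) (∇ φ x)
        = ∫ x, inner ℝ ((w j.succ x / |w j.succ x|) • h j.succ x) (∇ φ x) :=
      integral_congr_ae (Habs.weakGrad_ae.mono fun x hx => by simp only [hx])
    rw [e]
    exact hineq j.succ φ hφ hφ0
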